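/- Let $m\ge 2$ and $n\ge 1$ be integers, and let $p_1,\dots,p_m>0$ satisfy $\sum_{j=1}^m p_j=1$. Consider $n$ independent trials, each of which falls in exactly one of $m$ cells, in cell $j$ with probability $p_j$. Let $U_j$ be the number of trials that fall in cell $j$, and let $$W=\sum_{j=1}^m\frac{(U_j-np_j)^2}{np_j}$$ be Pearson's statistic. Put $p_*=\min_{1\le j\le m}p_j$. For $k\ge1$ let $C_b^k(\mathbb{R}^+)$ be the class of continuous functions $h:[0,\infty)\to\mathbb{R}$ that are $k$ times differentiable on $(0,\infty)$ and for which $h,h',\dots,h^{(k)}$ are bounded on $(0,\infty)$. Write $\|g\|=\sup_{x>0}|g(x)|$, and let $\chi^2_{(m-1)}h=\mathbb{E}h(Y)$, where $Y$ has the chi-square distribution with $m-1$ degrees of freedom. Suppose that $np_*\ge1$. Then, for every $h\in C_b^2(\mathbb{R}^+)$, $$|\mathbb{E}h(W)-\chi^2_{(m-1)}h|\le\frac{12}{\sqrt{np_*}}\{6\|h\|+46\|h'\|+84\|h''\|\},$$ and, for every $h\in C_b^5(\mathbb{R}^+)$, $$|\mathbb{E}h(W)-\chi^2_{(m-1)}h|\le\frac{4m}{np_*}\{19\|h\|+366\|h'\|+2016\|h''\|+5264\|h^{(3)}\|+106965\|h^{(4)}\|+302922\|h^{(5)}\|\}.$$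 -/

import Mathlib

open MeasureTheory ProbabilityTheory

namespace PearsonChiSquare

/-- The chi-square distribution with `d ≥ 1` degrees of freedom, that is the Gamma distribution
with shape `d / 2` and rate `1 / 2`. -/
noncomputable def chiSquare (d : ℕ) : Measure ℝ :=
  gammaMeasure ((d : ℝ) / 2) (1 / 2)

/-- `‖g‖ = sup_{x > 0} |g x|`. -/
noncomputable def supNorm (g : ℝ → ℝ) : ℝ :=
  ⨆ x : Set.Ioi (0 : ℝ), |g x|

/-- The class `C_b^k(ℝ⁺)`: `h` is `k` times differentiable on `(0, ∞)` (the `k`-th derivative need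
not be continuous), and `h` and its derivatives up to order `k` are bounded there. The value of `h`
at the boundary point `0` is the one given by continuity. Values of `h` on `(-∞, 0)` are
irrelevant: the derivatives are only taken at points of the open half-line. -/
structure MemCb (k : ℕ) (h : ℝ → ℝ) : Prop where
  continuousOn : ContinuousOn h (Set.Ici 0)
  differentiableAt : ∀ i < k, ∀ x : ℝ, 0 < x → DifferentiableAt ℝ (iteratedDeriv i h) x
  bounded : ∀ i ≤ k, ∃ C : ℝ, ∀ x : ℝ, 0 < x → |iteratedDeriv i h x| ≤ C

/-- The number of the `n` trials with outcomes `x` that fall in cell `j`. -/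
def cellCount {n m : ℕ} (x : Fin n → Fin m) (j : Fin m) : ℕ :=
  (Finset.univ.filter fun i => x i = j).card

/-- Pearson's statistic `∑ j, (U j - n p j) ^ 2 / (n p j)` of the observed counts `U`. -/
noncomputable def pearsonStat {m : ℕ} (n : ℕ) (p : Fin m → ℝ) (U : Fin m → ℕ) : ℝ :=
  ∑ j, ((U j : ℝ) - n * p j) ^ 2 / (n * p j)

/-- `p_* = min_j p j` (for `m ≥ 1` cells). -/
noncomputable def pMin {m : ℕ} (p : Fin m → ℝ) : ℝ := ⨅ j, p j

end PearsonChiSquare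

open PearsonChiSquare

namespace PearsonChiSquare
-- The proof is Stein's method for the chi-square law with d = m - 1 degrees of freedom. One solves
-- x u' + (d - x) u / 2 = h - E h(Y) on (0, ∞), so that E h(W) - E h(Y) is the expectation of the
-- left-hand side at W, and shows that this expectation is small because W almost satisfies the
-- integration by parts that characterises the chi-square law.
--
-- On the analytic side, u has bounded derivatives. Differentiating the equation gives one of the
-- same form with d + 2 in place of d (`SteinSol.derivSol`), so zeroth-order bounds can be iterated.
-- Those come from comparison with explicit barriers through the integrating factor x^(s/2)
-- exp(-x/2) (`SteinSol.le_barrier_left`, `SteinSol.le_barrier_right`).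
--
-- On the probabilistic side, the size-bias identity E[U_j F(U)] = n p_j E[F(U' + e_j)], with U' the
-- counts of n - 1 trials (`trialExp_count_mul`), turns the Stein operator at W into an expectation
-- over n - 1 trials (`IsCells.exp_stein`). Adding a trial to cell j moves W by (2 d_j + 1) / (n
-- p_j), which is of order ρ = 1 / √(n p_*). In the Taylor expansion the main terms cancel and an
-- error of order ρ remains (`IsCells.abs_exp_stein_le`).
--
-- For order ρ² the surviving first-order terms are d_j φ'(W) / (n p_j) and d_j³ φ''(W) / (n p_j)²,
-- odd in the centred counts. The size-bias identity gives E[d_j G(W)] ≈ 2 E[d_j G'(W)], so E[d_j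
-- g(W)] is negligible once g is written as G - 2 G' with G bounded (`exists_sub_two_mul_deriv_eq`,
-- `IsCells.abs_exp_coord_mul_le`). The same device reduces d_j³ to d_j
-- (`IsCells.abs_exp_coord_cube_mul_le`), and `IsCells.abs_exp_stein_le_sq` collects everything.
--
-- The solution is controlled only on the open half-line while W can vanish, so the argument runs
-- with u(· + ε) and ε → 0 (`abs_trialExp_sub_le`). When n p_* is small, the claim is weaker than
-- the trivial bound 2‖h‖.
open Filter Topology Set

/-! ### The chi-square Stein equation: barriers and bounds for its solutions. -/

section Stein

/-- The weight `x ^ (s / 2) * exp (-x / 2)`. -/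
noncomputable def chiWeight (s x : ℝ) : ℝ := x ^ (s / 2) * Real.exp (-(x / 2))

lemma chiWeight_pos (s : ℝ) {x : ℝ} (hx : 0 < x) : 0 < chiWeight s x := by
  unfold chiWeight; positivity

lemma chiWeight_add_two (s : ℝ) {x : ℝ} (hx : 0 < x) :
    chiWeight (s + 2) x = x * chiWeight s x := by
  have : (s + 2) / 2 = s / 2 + 1 := by ring
  rw [chiWeight, this, Real.rpow_add_one hx.ne', chiWeight]; ring

lemma chiWeight_eq_mul (s : ℝ) {x : ℝ} (hx : 0 < x) :
    chiWeight s x = x * chiWeight (s - 2) x := by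
  have := chiWeight_add_two (s - 2) hx
  rwa [sub_add_cancel] at this

lemma hasDerivAt_chiWeight (s : ℝ) {x : ℝ} (hx : 0 < x) :
    HasDerivAt (chiWeight s) ((s - x) / 2 * chiWeight (s - 2) x) x := by
  have h1 : HasDerivAt (fun x : ℝ => x ^ (s / 2)) (s / 2 * x ^ (s / 2 - 1)) x :=
    Real.hasDerivAt_rpow_const (Or.inl hx.ne')
  have h2 : HasDerivAt (fun x : ℝ => Real.exp (-(x / 2))) (Real.exp (-(x / 2)) * (-(1 / 2))) x :=
    (((hasDerivAt_id x).div_const 2).neg).exp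
  have h3 := h1.mul h2
  have e1 : chiWeight s x = x * chiWeight (s - 2) x := chiWeight_eq_mul s hx
  have e2 : (s - 2) / 2 = s / 2 - 1 := by ring
  refine h3.congr_deriv ?_
  have e3 : x ^ (s / 2) * Real.exp (-(x / 2)) = x * (x ^ (s / 2 - 1) * Real.exp (-(x / 2))) := by
    rw [← e2]; exact e1
  rw [chiWeight, e2]
  linear_combination (-1 / 2) * e3

lemma tendsto_chiWeight_zero {s : ℝ} (hs : 0 < s) :
    Tendsto (chiWeight s) (𝓝[>] 0) (𝓝 0) := by
  have : ContinuousAt (chiWeight s) 0 := by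
    unfold chiWeight
    refine ContinuousAt.mul ?_ (by fun_prop)
    exact Real.continuousAt_rpow_const _ _ (Or.inr (by positivity))
  have h := this.tendsto
  have h0 : chiWeight s 0 = 0 := by
    unfold chiWeight; rw [Real.zero_rpow (by positivity)]; simp
  rw [h0] at h
  exact h.mono_left nhdsWithin_le_nhds

lemma tendsto_chiWeight_atTop (s : ℝ) : Tendsto (chiWeight s) atTop (𝓝 0) := by
  have := tendsto_rpow_mul_exp_neg_mul_atTop_nhds_zero (s / 2) (1 / 2) (by norm_num)
  refine this.congr fun x => ?_
  unfold chiWeight; congr 2; ring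

lemma nonpos_of_deriv_nonpos_of_tendsto_zero {y y' : ℝ → ℝ} {b : ℝ} (hb : 0 < b)
    (hd : ∀ x, 0 < x → x ≤ b → HasDerivAt y (y' x) x) (hn : ∀ x, 0 < x → x ≤ b → y' x ≤ 0)
    (h0 : Tendsto y (𝓝[>] 0) (𝓝 0)) : y b ≤ 0 := by
  have hanti : AntitoneOn y (Ioc 0 b) := by
    refine antitoneOn_of_hasDerivWithinAt_nonpos (f' := y') (convex_Ioc 0 b)
      (fun x hx => (hd x hx.1 hx.2).continuousAt.continuousWithinAt) ?_ ?_
    · intro x hx; have := interior_subset hx; exact (hd x this.1 this.2).hasDerivWithinAt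
    · intro x hx; have := interior_subset hx; exact hn x this.1 this.2
  refine ge_of_tendsto h0 ?_
  filter_upwards [Ioo_mem_nhdsGT hb] with x hx
  exact hanti ⟨hx.1, hx.2.le⟩ ⟨hb, le_rfl⟩ hx.2.le

lemma nonpos_of_deriv_nonneg_of_tendsto_zero {y y' : ℝ → ℝ} {a : ℝ}
    (hd : ∀ x, a ≤ x → HasDerivAt y (y' x) x) (hn : ∀ x, a ≤ x → 0 ≤ y' x)
    (h0 : Tendsto y atTop (𝓝 0)) : y a ≤ 0 := by
  have hmono : MonotoneOn y (Ici a) := by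
    refine monotoneOn_of_hasDerivWithinAt_nonneg (f' := y') (convex_Ici a)
      (fun x hx => (hd x hx).continuousAt.continuousWithinAt) ?_ ?_
    · intro x hx; have := interior_subset hx; exact (hd x this).hasDerivWithinAt
    · intro x hx; have := interior_subset hx; exact hn x this
  refine ge_of_tendsto h0 ?_
  filter_upwards [eventually_ge_atTop a] with x hx
  exact hmono self_mem_Ici hx hx

/-- `u`, with derivative `u'`, solves `x u' + (s - x) u / 2 = H` on the open half-line, and
`x ^ (s / 2) * exp (-x / 2) * u` vanishes at both ends. -/
structure SteinSol (s : ℝ) (u u' H : ℝ → ℝ) : Prop where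
  hasDerivAt : ∀ x, 0 < x → HasDerivAt u (u' x) x
  eqn : ∀ x, 0 < x → x * u' x + (s - x) / 2 * u x = H x
  zero : Tendsto (fun x => chiWeight s x * u x) (𝓝[>] 0) (𝓝 0)
  top : Tendsto (fun x => chiWeight s x * u x) atTop (𝓝 0)

namespace SteinSol

variable {s C : ℝ} {u u' H : ℝ → ℝ}

lemma neg (h : SteinSol s u u' H) :
    SteinSol s (fun x => -u x) (fun x => -u' x) (fun x => -H x) where
  hasDerivAt x hx := (h.hasDerivAt x hx).neg
  eqn x hx := by have := h.eqn x hx; linarith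
  zero := by simpa using h.zero.neg
  top := by simpa using h.top.neg

/-- `chiWeight s` is the integrating factor: the derivative of `chiWeight s * v` is `chiWeight (s -
2)` times the Stein operator of v. Comparing u with b is thus comparing H with the operator applied
to b. -/
lemma hasDerivAt_weight_mul_sub (h : SteinSol s u u' H) {b b' : ℝ → ℝ} {x : ℝ} (hx : 0 < x)
    (hb : HasDerivAt b (b' x) x) :
    HasDerivAt (fun x => chiWeight s x * u x - chiWeight s x * b x)
      (chiWeight (s - 2) x * (H x - (x * b' x + (s - x) / 2 * b x))) x := by
  have h1 := (hasDerivAt_chiWeight s hx).mul (h.hasDerivAt x hx)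
  have h2 := (hasDerivAt_chiWeight s hx).mul hb
  refine (h1.sub h2).congr_deriv ?_
  rw [chiWeight_eq_mul s hx, ← h.eqn x hx]; ring

/-- The weighted difference of u and b starts from 0 at the origin and decreases when b is a
supersolution. From the right the difference must instead increase to its limit 0 at infinity, so
`le_barrier_right` asks for a subsolution. -/
lemma le_barrier_left (h : SteinSol s u u' H) {b b' : ℝ → ℝ} {z : ℝ} (hz : 0 < z)
    (hb : ∀ x, 0 < x → x ≤ z → HasDerivAt b (b' x) x)
    (hle : ∀ x, 0 < x → x ≤ z → H x ≤ x * b' x + (s - x) / 2 * b x)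
    (h0 : Tendsto (fun x => chiWeight s x * b x) (𝓝[>] 0) (𝓝 0)) : u z ≤ b z := by
  have := nonpos_of_deriv_nonpos_of_tendsto_zero
    (y := fun x => chiWeight s x * u x - chiWeight s x * b x) hz
    (fun x hx hxz => h.hasDerivAt_weight_mul_sub hx (hb x hx hxz))
    (fun x hx hxz => mul_nonpos_of_nonneg_of_nonpos (chiWeight_pos _ hx).le
      (by linarith [hle x hx hxz])) (by simpa using h.zero.sub h0)
  have hw := chiWeight_pos s hz
  by_contra! hc
  nlinarith

lemma le_barrier_right (h : SteinSol s u u' H) {b b' : ℝ → ℝ} {z : ℝ} (hz : 0 < z)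
    (hb : ∀ x, z ≤ x → HasDerivAt b (b' x) x)
    (hle : ∀ x, z ≤ x → x * b' x + (s - x) / 2 * b x ≤ H x)
    (h0 : Tendsto (fun x => chiWeight s x * b x) atTop (𝓝 0)) : u z ≤ b z := by
  have := nonpos_of_deriv_nonneg_of_tendsto_zero
    (y := fun x => chiWeight s x * u x - chiWeight s x * b x)
    (fun x hx => h.hasDerivAt_weight_mul_sub (hz.trans_le hx) (hb x hx))
    (fun x hx => mul_nonneg (chiWeight_pos _ (hz.trans_le hx)).le
      (by linarith [hle x hx])) (by simpa using h.top.sub h0)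
  have hw := chiWeight_pos s hz
  by_contra! hc
  nlinarith

/-- The barrier is 2C / |s - x|. Its zeroth-order term in the operator is exactly C to the left of s
and -C to the right, and its derivative term has the favourable sign on each side. -/
lemma dist_mul_le (h : SteinSol s u u' H) (hs : 0 < s) (hH : ∀ x, 0 < x → |H x| ≤ C)
    {x : ℝ} (hx : 0 < x) : |s - x| * u x ≤ 2 * C := by
  have hC : 0 ≤ C := (abs_nonneg _).trans (hH x hx)
  have hd : ∀ y, y ≠ s → HasDerivAt (fun y => 2 * C / (s - y)) (2 * C / (s - y) ^ 2) y := by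
    intro y hy
    have hy' : s - y ≠ 0 := sub_ne_zero.2 hy.symm
    have := ((hasDerivAt_const y (2 * C)).div ((hasDerivAt_id y).const_sub s) hy')
    refine this.congr_deriv ?_
    simp
  rcases lt_trichotomy x s with hxs | rfl | hxs
  · have hlim : Tendsto (fun y => chiWeight s y * (2 * C / (s - y))) (𝓝[>] 0) (𝓝 0) := by
      have h1 : Tendsto (fun y => 2 * C / (s - y)) (𝓝[>] 0) (𝓝 (2 * C / (s - 0))) :=
        (hd 0 hs.ne).continuousAt.tendsto.mono_left nhdsWithin_le_nhds
      simpa using (tendsto_chiWeight_zero hs).mul h1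
    have := h.le_barrier_left hx (b := fun y => 2 * C / (s - y)) (fun y _ hy => hd y (by linarith))
      (fun y hy0 hy => by
        have h1 : 0 < s - y := by linarith
        have h2 := (abs_le.1 (hH y hy0)).2
        have h3 : (s - y) / 2 * (2 * C / (s - y)) = C := by field_simp
        have h4 : 0 ≤ y * (2 * C / (s - y) ^ 2) := by positivity
        linarith) hlim
    have h1 : 0 < s - x := by linarith
    rw [abs_of_pos h1]
    calc (s - x) * u x ≤ (s - x) * (2 * C / (s - x)) := by gcongr
      _ = 2 * C := by field_simp
  · simpa using hC
  · have hd' : ∀ y, s < y → HasDerivAt (fun y => 2 * C / (y - s)) (-(2 * C / (y - s) ^ 2)) y := by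
      intro y hy
      have := (hd y hy.ne').neg
      refine (this.congr_deriv ?_).congr_of_eventuallyEq ?_
      · rw [show (s - y) ^ 2 = (y - s) ^ 2 by ring]
      · refine Eventually.of_forall fun z => ?_
        simp only [Pi.neg_apply]
        rw [← div_neg, neg_sub]
    have hlim : Tendsto (fun y => chiWeight s y * (2 * C / (y - s))) atTop (𝓝 0) := by
      have h1 : Tendsto (fun y => 2 * C / (y - s)) atTop (𝓝 0) :=
        tendsto_const_nhds.div_atTop (tendsto_atTop_add_const_right _ _ tendsto_id)
      simpa using (tendsto_chiWeight_atTop s).mul h1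
    have := h.le_barrier_right hx (b := fun y => 2 * C / (y - s)) (fun y hy => hd' y (by linarith))
      (fun y hy => by
        have h1 : 0 < y - s := by linarith
        have hy0 : 0 < y := by linarith
        have h2 := (abs_le.1 (hH y hy0)).1
        have h3 : (s - y) / 2 * (2 * C / (y - s)) = -C := by
          rw [show s - y = -(y - s) by ring]; field_simp
        have h4 : 0 ≤ y * (2 * C / (y - s) ^ 2) := by positivity
        linarith) hlim
    have h1 : 0 < x - s := by linarith
    rw [abs_of_neg (by linarith), neg_sub]
    calc (x - s) * u x ≤ (x - s) * (2 * C / (x - s)) := by gcongr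
      _ = 2 * C := by field_simp

lemma dist_mul_abs_le (h : SteinSol s u u' H) (hs : 0 < s) (hH : ∀ x, 0 < x → |H x| ≤ C)
    {x : ℝ} (hx : 0 < x) : |s - x| * |u x| ≤ 2 * C := by
  rcases abs_cases (u x) with ⟨e, _⟩ | ⟨e, _⟩ <;> rw [e]
  · exact h.dist_mul_le hs hH hx
  · exact h.neg.dist_mul_le hs (fun y hy => by rw [abs_neg]; exact hH y hy) hx

lemma mul_abs_deriv_le (h : SteinSol s u u' H) (hs : 0 < s) (hH : ∀ x, 0 < x → |H x| ≤ C)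
    {x : ℝ} (hx : 0 < x) : x * |u' x| ≤ 2 * C := by
  have h1 := h.dist_mul_abs_le hs hH hx
  have h2 := h.eqn x hx
  have h3 : x * u' x = H x - (s - x) / 2 * u x := by linarith
  have h4 : x * |u' x| = |x * u' x| := by rw [abs_mul, abs_of_pos hx]
  rw [h4, h3]
  refine (abs_sub _ _).trans ?_
  rw [abs_mul, abs_div, abs_two]
  linarith [hH x hx]

/-- Unlike the previous estimate this one does not degenerate at x = s. The barriers are C (2 + x) /
s to the left of s and C s / x to the right; the second is a subsolution because s ≥ 2. -/
lemma le_of_two_le (h : SteinSol s u u' H) (hs : 2 ≤ s) (hH : ∀ x, 0 < x → |H x| ≤ C)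
    {x : ℝ} (hx : 0 < x) : u x ≤ (1 + 2 / s) * C := by
  have hC : 0 ≤ C := (abs_nonneg _).trans (hH x hx)
  have hs0 : 0 < s := by linarith
  rcases le_total x s with hxs | hxs
  · have hd : ∀ y, HasDerivAt (fun y => C * ((2 + y) / s)) (C * (1 / s)) y := fun y =>
      (((hasDerivAt_id y).const_add 2).div_const s).const_mul C
    have hlim : Tendsto (fun y => chiWeight s y * (C * ((2 + y) / s))) (𝓝[>] 0) (𝓝 0) := by
      have h1 : Tendsto (fun y => C * ((2 + y) / s)) (𝓝[>] 0) (𝓝 (C * ((2 + 0) / s))) :=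
        (hd 0).continuousAt.tendsto.mono_left nhdsWithin_le_nhds
      simpa using (tendsto_chiWeight_zero hs0).mul h1
    have := h.le_barrier_left hx (fun y _ _ => hd y) (fun y hy0 hy => by
        have h2 := (abs_le.1 (hH y hy0)).2
        have h3 : y * (C * (1 / s)) + (s - y) / 2 * (C * ((2 + y) / s))
          = C + C * ((s - y) * y / (2 * s)) := by field_simp; ring
        have h4 : 0 ≤ C * ((s - y) * y / (2 * s)) := by
          have : 0 ≤ s - y := by linarith
          positivity
        linarith) hlim
    refine this.trans ?_
    have : (2 + x) / s ≤ (1 + 2 / s) := by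
      rw [add_div]; have := (div_le_one hs0).2 hxs; linarith
    nlinarith
  · have hd : ∀ y, 0 < y → HasDerivAt (fun y => C * (s / y)) (-(C * (s / y ^ 2))) y := by
      intro y hy
      have := ((hasDerivAt_const y s).div (hasDerivAt_id y) hy.ne').const_mul C
      refine this.congr_deriv ?_
      simp; ring
    have hlim : Tendsto (fun y => chiWeight s y * (C * (s / y))) atTop (𝓝 0) := by
      have h1 : Tendsto (fun y => C * (s / y)) atTop (𝓝 (C * 0)) :=
        (tendsto_const_nhds.div_atTop tendsto_id).const_mul C
      simpa using (tendsto_chiWeight_atTop s).mul h1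
    have := h.le_barrier_right hx (fun y hy => hd y (by linarith)) (fun y hy => by
        have hy0 : 0 < y := by linarith
        have h2 := (abs_le.1 (hH y hy0)).1
        have h3 : y * (-(C * (s / y ^ 2))) + (s - y) / 2 * (C * (s / y))
          = -C - C * ((s - 2) * (y - s) / (2 * y)) := by field_simp; ring
        have h4 : 0 ≤ C * ((s - 2) * (y - s) / (2 * y)) := by
          have h5 : 0 ≤ s - 2 := by linarith
          have h6 : 0 ≤ y - s := by linarith
          positivity
        linarith) hlim
    refine this.trans ?_
    have h5 : s / x ≤ 1 := (div_le_one hx).2 hxs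
    have h6 : 0 ≤ 2 / s := by positivity
    nlinarith

lemma abs_le_of_two_le (h : SteinSol s u u' H) (hs : 2 ≤ s) (hH : ∀ x, 0 < x → |H x| ≤ C)
    {x : ℝ} (hx : 0 < x) : |u x| ≤ (1 + 2 / s) * C := by
  refine abs_le'.2 ⟨h.le_of_two_le hs hH hx, ?_⟩
  exact h.neg.le_of_two_le hs (fun y hy => by rw [abs_neg]; exact hH y hy) hx

/-- The derivative of a solution solves the equation with `s + 2` in place of `s`. -/
lemma derivSol (h : SteinSol s u u' H) (hs : 0 < s) (hH : ∀ x, 0 < x → |H x| ≤ C)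
    {H' : ℝ → ℝ} (hH' : ∀ x, 0 < x → HasDerivAt H (H' x) x) :
    ∃ u'', SteinSol (s + 2) u' u'' (fun x => H' x + u x / 2) := by
  -- The weight for s + 2 supplies the extra factor x, and x u' is bounded, so the boundary
  -- conditions pass to u'.
  have hbd : ∀ x, 0 < x → |chiWeight (s + 2) x * u' x| ≤ 2 * C * chiWeight s x := by
    intro x hx
    have := h.mul_abs_deriv_le hs hH hx
    have hw := chiWeight_pos s hx
    rw [chiWeight_add_two s hx, abs_mul, abs_mul, abs_of_pos hx, abs_of_pos hw]
    nlinarith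
  refine ⟨fun x => (H' x + u x / 2 - (s + 2 - x) / 2 * u' x) / x, ⟨?_, ?_, ?_, ?_⟩⟩
  · intro x hx
    have hnum := (hH' x hx).sub
      ((((hasDerivAt_id x).const_sub s).div_const 2).mul (h.hasDerivAt x hx))
    have hq := hnum.div (hasDerivAt_id x) hx.ne'
    refine (hq.congr_deriv ?_).congr_of_eventuallyEq ?_
    · have h1 : H x = x * u' x + (s - x) / 2 * u x := (h.eqn x hx).symm
      simp only [Pi.sub_apply, Pi.mul_apply, id]
      rw [h1]
      field_simp
      ring
    · filter_upwards [lt_mem_nhds hx] with y hy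
      have := h.eqn y hy
      simp only [Pi.sub_apply, Pi.mul_apply, Pi.div_apply, id]
      rw [eq_div_iff hy.ne']
      linarith
  · intro x hx
    field_simp
    ring
  · refine squeeze_zero_norm' ?_ (by simpa using (tendsto_chiWeight_zero hs).const_mul (2 * C))
    filter_upwards [self_mem_nhdsWithin] with x hx
    exact hbd x hx
  · refine squeeze_zero_norm' ?_ (by simpa using (tendsto_chiWeight_atTop s).const_mul (2 * C))
    filter_upwards [eventually_gt_atTop 0] with x hx
    exact hbd x hx

/-- A solution whose right-hand side is `h` with Lipschitz constant `A` is bounded by `2 A`. -/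
lemma le_two_mul_of_monotone (h : SteinSol s u u' H) (hs : 0 < s) {A : ℝ}
    (hmono : ∀ x y, 0 < x → x ≤ y → |H y - H x| ≤ A * (y - x)) {z : ℝ} (hz : 0 < z) :
    u z ≤ 2 * A := by
  have hd : ∀ x : ℝ, HasDerivAt (fun _ : ℝ => 2 * A) 0 x := fun x => hasDerivAt_const _ _
  -- For the constant barrier 2A the operator equals (s - x) A, and H minus this is monotone. Its
  -- sign at z therefore persists on all of (0, z] or on all of [z, ∞), and one of the two barrier
  -- lemmas applies.
  have hm : ∀ x y, 0 < x → x ≤ y → H x - (s - x) * A ≤ H y - (s - y) * A := by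
    intro x y hx hxy
    have := (abs_le.1 (hmono x y hx hxy)).1
    linarith
  rcases le_total (H z - (s - z) * A) 0 with hk | hk
  · exact h.le_barrier_left hz (b := fun _ => 2 * A) (b' := fun _ => 0) (fun x _ _ => hd x)
      (fun x hx hxz => by have := hm x z hx hxz; linarith)
      (by simpa using (tendsto_chiWeight_zero hs).mul_const (2 * A))
  · exact h.le_barrier_right hz (b := fun _ => 2 * A) (b' := fun _ => 0) (fun x _ => hd x)
      (fun x hxz => by have := hm z x hz hxz; linarith)
      (by simpa using (tendsto_chiWeight_atTop s).mul_const (2 * A))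

lemma abs_le_two_mul (h : SteinSol s u u' H) (hs : 0 < s) {A : ℝ}
    (hmono : ∀ x y, 0 < x → x ≤ y → |H y - H x| ≤ A * (y - x)) {z : ℝ} (hz : 0 < z) :
    |u z| ≤ 2 * A := by
  refine abs_le'.2 ⟨h.le_two_mul_of_monotone hs hmono hz, ?_⟩
  refine h.neg.le_two_mul_of_monotone hs (fun x y hx hxy => ?_) hz
  have := hmono x y hx hxy
  rwa [neg_sub_neg, abs_sub_comm]

end SteinSol
end Stein

/-! ### The chi-square law and the existence of the Stein solution. -/

lemma integrableOn_chiWeight {s : ℝ} (hs : 0 < s) : IntegrableOn (chiWeight (s - 2)) (Ioi 0) := by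
  have := integrableOn_rpow_mul_exp_neg_mul_rpow (s := (s - 2) / 2) (p := 1) (b := 1 / 2)
    (by linarith) one_pos (by norm_num)
  refine this.congr_fun (fun x _ => ?_) measurableSet_Ioi
  simp only [Real.rpow_one, chiWeight]
  congr 2; ring

lemma continuousOn_chiWeight (s : ℝ) : ContinuousOn (chiWeight s) (Ioi 0) :=
  fun _ hx => (hasDerivAt_chiWeight s hx).continuousAt.continuousWithinAt

instance isProbabilityMeasure_chiSquare (d : ℕ) [NeZero d] :
    IsProbabilityMeasure (chiSquare d) :=
  isProbabilityMeasure_gammaMeasure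
    (by have : (0 : ℝ) < d := Nat.cast_pos.2 (NeZero.pos d)
        positivity) (by norm_num)

lemma integral_chiSquare {d : ℕ} (hd : 0 < d) (g : ℝ → ℝ) :
    ∫ x, g x ∂(chiSquare d) = (1 / 2) ^ ((d : ℝ) / 2) / Real.Gamma ((d : ℝ) / 2) *
      ∫ x in Ioi 0, g x * chiWeight (d - 2) x := by
  have hd' : (0 : ℝ) < d := Nat.cast_pos.2 hd
  rw [chiSquare, gammaMeasure, integral_withDensity_eq_integral_toReal_smul
    (by unfold gammaPDF; fun_prop) (ae_of_all _ fun x => by simp [gammaPDF]),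
    ← setIntegral_eq_integral_of_ae_compl_eq_zero (s := Ioi 0), ← integral_const_mul]
  · refine setIntegral_congr_fun measurableSet_Ioi fun x (hx : 0 < x) => ?_
    simp only [gammaPDF, smul_eq_mul]
    rw [ENNReal.toReal_ofReal (gammaPDFReal_nonneg (by positivity) (by norm_num) x),
      gammaPDFReal, if_pos hx.le, chiWeight]
    rw [show ((d : ℝ) - 2) / 2 = d / 2 - 1 by ring, show 1 / 2 * x = x / 2 by ring]
    ring
  · have h0 : ∀ᵐ x : ℝ, x ≠ 0 := by simp [ae_iff]
    filter_upwards [h0] with x hx hx'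
    have : x < 0 := lt_of_le_of_ne (not_lt.1 hx') hx
    simp [gammaPDF_of_neg this]

/-- Existence of the solution of the chi-square Stein equation. -/
lemma exists_steinSol {d : ℕ} (hd : 0 < d) {h : ℝ → ℝ} (hc : Continuous h) {A : ℝ}
    (hA : ∀ x, |h x| ≤ A) :
    ∃ u u', SteinSol d u u' (fun x => h x - ∫ x, h x ∂(chiSquare d)) := by
  set c := ∫ x, h x ∂(chiSquare d) with hc_def
  have hd' : (0 : ℝ) < d := Nat.cast_pos.2 hd
  have : NeZero d := ⟨hd.ne'⟩
  set f : ℝ → ℝ := fun x => (h x - c) * chiWeight (d - 2) x with hf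
  have hbdd : ∀ k : ℝ → ℝ, Continuous k → (∃ B, ∀ x, |k x| ≤ B) →
      IntegrableOn (fun x => k x * chiWeight (d - 2) x) (Ioi 0) := by
    rintro k hk ⟨B, hB⟩
    exact (integrableOn_chiWeight hd').bdd_mul hk.aestronglyMeasurable (ae_of_all _ hB)
  have hfi : IntegrableOn f (Ioi 0) := hbdd (fun x => h x - c) (by fun_prop)
    ⟨A + |c|, fun x => (abs_sub _ _).trans (by linarith [hA x])⟩
  -- Since c is the mean of h, the centred integrand has total mass zero; this is what makes the
  -- primitive v vanish at infinity as well as at 0.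
  have hf0 : ∫ x in Ioi 0, f x = 0 := by
    have h1 := integral_chiSquare hd h
    have h2 := integral_chiSquare hd (fun _ => (1 : ℝ))
    simp only [integral_const, probReal_univ, one_smul] at h2
    have i1 := hbdd h hc ⟨A, hA⟩
    have i2 := hbdd (fun _ => 1) continuous_const ⟨1, by simp⟩
    have e : ∫ x in Ioi 0, f x = (∫ x in Ioi 0, h x * chiWeight (d - 2) x)
        - c * ∫ x in Ioi 0, 1 * chiWeight (d - 2) x := by
      rw [← integral_const_mul, ← integral_sub i1 (i2.const_mul c)]
      refine integral_congr_ae (ae_of_all _ fun x => ?_)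
      simp only [hf]; ring
    have hK : (1 / 2 : ℝ) ^ ((d : ℝ) / 2) / Real.Gamma ((d : ℝ) / 2) ≠ 0 := by
      have := Real.Gamma_pos_of_pos (s := (d : ℝ) / 2) (by positivity)
      positivity
    apply mul_left_cancel₀ hK
    rw [e, mul_sub, ← h1, mul_left_comm, ← h2]
    ring
  have hII : ∀ x, 0 ≤ x → IntervalIntegrable f volume 0 x := fun x hx => by
    rw [intervalIntegrable_iff_integrableOn_Ioc_of_le hx]
    exact hfi.mono_set Ioc_subset_Ioi_self
  have hfc : ContinuousOn f (Ioi 0) :=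
    ((hc.sub continuous_const).continuousOn).mul (continuousOn_chiWeight _)
  set v : ℝ → ℝ := fun x => ∫ t in (0 : ℝ)..x, f t with hv
  have hvd : ∀ x, 0 < x → HasDerivAt v (f x) x := fun x hx =>
    intervalIntegral.integral_hasDerivAt_right (hII x hx.le)
      (hfc.stronglyMeasurableAtFilter isOpen_Ioi x hx)
      (hfc.continuousAt (isOpen_Ioi.mem_nhds hx))
  have hvtop : Tendsto v atTop (𝓝 0) := by
    rw [← hf0]; exact intervalIntegral_tendsto_integral_Ioi 0 hfi tendsto_id
  have hv0 : Tendsto v (𝓝[>] 0) (𝓝 0) := by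
    have h1 : ContinuousOn v (Icc 0 1) := by
      have := intervalIntegral.continuousOn_primitive_interval (f := f) (μ := volume)
        (a := 0) (b := 1) (by
          rw [uIcc_of_le zero_le_one, integrableOn_Icc_iff_integrableOn_Ioc]
          exact hfi.mono_set Ioc_subset_Ioi_self)
      rwa [uIcc_of_le zero_le_one] at this
    have h2 := (h1 0 (by simp)).tendsto
    have h3 : v 0 = 0 := by simp [hv]
    rw [h3] at h2
    refine h2.mono_left ?_
    rw [← nhdsWithin_Ioo_eq_nhdsGT (zero_lt_one' ℝ)]
    exact nhdsWithin_mono _ Ioo_subset_Icc_self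
  refine ⟨fun x => v x / chiWeight d x,
    fun x => (h x - c - (d - x) / 2 * (v x / chiWeight d x)) / x, ⟨?_, ?_, ?_, ?_⟩⟩
  · intro x hx
    have hw := chiWeight_pos d hx
    refine ((hvd x hx).div (hasDerivAt_chiWeight d hx) hw.ne').congr_deriv ?_
    have hw2 := chiWeight_pos ((d : ℝ) - 2) hx
    simp only [hf]
    rw [chiWeight_eq_mul d hx]
    field_simp
  · intro x hx
    field_simp
    ring
  · refine hv0.congr' ?_
    filter_upwards [self_mem_nhdsWithin] with x hx
    have hw := chiWeight_pos d hx
    field_simp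
  · refine hvtop.congr' ?_
    filter_upwards [eventually_gt_atTop 0] with x hx
    have hw := chiWeight_pos d hx
    field_simp

/-- First and second order bounds for the derivatives of the solution of the Stein equation. -/
lemma exists_steinSol_bounds {d : ℕ} (hd : 0 < d) {h h1 h2 : ℝ → ℝ} (hc : Continuous h)
    {A0 A1 A2 : ℝ} (hA0 : ∀ x, |h x| ≤ A0)
    (hd1 : ∀ x, 0 < x → HasDerivAt h (h1 x) x) (hd2 : ∀ x, 0 < x → HasDerivAt h1 (h2 x) x)
    (hA1 : ∀ x, 0 < x → |h1 x| ≤ A1) (hA2 : ∀ x, 0 < x → |h2 x| ≤ A2) :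
    ∃ u0 u1 u2, SteinSol d u0 u1 (fun x => h x - ∫ x, h x ∂(chiSquare d)) ∧
      SteinSol (d + 2) u1 u2 (fun x => h1 x + u0 x / 2) ∧
      (∀ x, 0 < x → |u0 x| ≤ 2 * A1) ∧
      (∀ x, 0 < x → (d + 2) * |u1 x| ≤ 4 * A0 + 4 * A1) ∧
      (∀ x, 0 < x → |u1 x| ≤ 10 / 3 * A1) ∧
      (∀ x, 0 < x → x * |u2 x| ≤ 4 * A1) ∧
      (∀ x, 0 < x → (d + 4) * |u2 x| ≤ 2 * A2 + 32 / 3 * A1) ∧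
      (∃ u3, SteinSol (d + 4) u2 u3 (fun x => h2 x + u1 x)) := by
  have hd' : (0 : ℝ) < d := Nat.cast_pos.2 hd
  have hd1' : (1 : ℝ) ≤ d := Nat.one_le_cast.2 hd
  have : NeZero d := ⟨hd.ne'⟩
  obtain ⟨u0, u1, hu0⟩ := exists_steinSol hd hc hA0
  set c := ∫ x, h x ∂(chiSquare d) with hc_def
  have hcA : |c| ≤ A0 := by
    have := norm_integral_le_of_norm_le_const (μ := chiSquare d) (f := h)
      (C := A0) (ae_of_all _ fun x => hA0 x)
    simpa using this
  have hH0 : ∀ x, 0 < x → |h x - c| ≤ 2 * A0 := fun x _ =>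
    (abs_sub _ _).trans (by linarith [hA0 x])
  have hA1' : 0 ≤ A1 := (abs_nonneg _).trans (hA1 1 one_pos)
  have hlip : ∀ x y, 0 < x → x ≤ y → |(h y - c) - (h x - c)| ≤ A1 * (y - x) := by
    intro x y hx hxy
    have := (convex_Ioi (0 : ℝ)).norm_image_sub_le_of_norm_hasDerivWithin_le (f := h) (f' := h1)
      (C := A1) (fun z hz => (hd1 z hz).hasDerivWithinAt) (fun z hz => hA1 z hz)
      (mem_Ioi.2 hx) (mem_Ioi.2 (hx.trans_le hxy))
    rw [Real.norm_eq_abs, Real.norm_eq_abs, abs_of_nonneg (sub_nonneg.2 hxy)] at this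
    simpa using this
  have b0 : ∀ x, 0 < x → |u0 x| ≤ 2 * A1 := fun x hx => hu0.abs_le_two_mul hd' hlip hx
  obtain ⟨u2, hu1⟩ := hu0.derivSol hd' hH0 (fun x hx => (hd1 x hx).sub_const c)
  have hH1 : ∀ x, 0 < x → |h1 x + u0 x / 2| ≤ 2 * A1 := fun x hx => by
    refine (abs_add_le _ _).trans ?_
    rw [abs_div, abs_two]; linarith [hA1 x hx, b0 x hx]
  have b1 : ∀ x, 0 < x → |u1 x| ≤ 10 / 3 * A1 := fun x hx => by
    refine (hu1.abs_le_of_two_le (by linarith) hH1 hx).trans ?_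
    have : 2 / ((d : ℝ) + 2) ≤ 2 / 3 := by gcongr; linarith
    nlinarith
  -- Write d + 2 = (d + 2 - x) + x. The first part is controlled by the equation for u1, the second
  -- by x |u1| ≤ 4 A0 from the equation for u0. The resulting decay in d later cancels the number of
  -- cells; the last bound below uses the same split.
  have b1' : ∀ x, 0 < x → (d + 2) * |u1 x| ≤ 4 * A0 + 4 * A1 := fun x hx => by
    have e1 := hu0.mul_abs_deriv_le hd' hH0 hx
    have e2 := hu1.dist_mul_abs_le (by linarith) hH1 hx
    have e3 : (d : ℝ) + 2 - x ≤ |(d : ℝ) + 2 - x| := le_abs_self _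
    nlinarith [abs_nonneg (u1 x)]
  have b2 : ∀ x, 0 < x → x * |u2 x| ≤ 4 * A1 := fun x hx => by
    have := hu1.mul_abs_deriv_le (by linarith) hH1 hx; linarith
  obtain ⟨u3, hu2'⟩ := hu1.derivSol (by linarith) hH1
    (fun x hx => (hd2 x hx).add ((hu0.hasDerivAt x hx).div_const 2))
  -- Each differentiation contributes u1 / 2, hence a full u1 on the right after two.
  have hu2 : SteinSol (d + 4) u2 u3 (fun x => h2 x + u1 x) := by
    convert hu2' using 1
    · ring
    · funext x; ring
  have hH2 : ∀ x, 0 < x → |h2 x + u1 x| ≤ A2 + 10 / 3 * A1 := fun x hx =>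
    (abs_add_le _ _).trans (by linarith [hA2 x hx, b1 x hx])
  refine ⟨u0, u1, u2, hu0, hu1, b0, b1', b1, b2, fun x hx => ?_, u3, hu2⟩
  have e2 := hu2.dist_mul_abs_le (by linarith) hH2 hx
  have e3 : (d : ℝ) + 4 - x ≤ |(d : ℝ) + 4 - x| := le_abs_self _
  nlinarith [abs_nonneg (u2 x), b2 x hx]

/-! ### Multinomial expectations, the size-bias identity and moments of the counts. -/

section Trials

variable {m : ℕ}

/-- The indicator vector of a cell. -/
def unitVec (k : Fin m) : Fin m → ℝ := fun j => if j = k then 1 else 0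

lemma unitVec_apply (k j : Fin m) : unitVec k j = if j = k then 1 else 0 := rfl

lemma sum_unitVec (k : Fin m) : ∑ j, unitVec k j = 1 := by simp [unitVec_apply]

/-- The expectation of `F (U - c)`, where `U` is the vector of cell counts of `L` independent
trials with cell probabilities `p`. -/
noncomputable def trialExp (p c : Fin m → ℝ) : ℕ → ((Fin m → ℝ) → ℝ) → ℝ
  | 0, F => F (-c)
  | L + 1, F => ∑ k, p k * trialExp p c L (fun d => F (d + unitVec k))

variable {p c : Fin m → ℝ} {L : ℕ}

lemma trialExp_succ (F : (Fin m → ℝ) → ℝ) :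
    trialExp p c (L + 1) F = ∑ k, p k * trialExp p c L (fun d => F (d + unitVec k)) := rfl

lemma trialExp_add (F G : (Fin m → ℝ) → ℝ) :
    trialExp p c L (fun d => F d + G d) = trialExp p c L F + trialExp p c L G := by
  induction L generalizing F G with
  | zero => rfl
  | succ L ih =>
    simp only [trialExp_succ]
    rw [← Finset.sum_add_distrib]
    refine Finset.sum_congr rfl fun k _ => ?_
    rw [ih]; ring

lemma trialExp_const_mul (a : ℝ) (F : (Fin m → ℝ) → ℝ) :
    trialExp p c L (fun d => a * F d) = a * trialExp p c L F := by
  induction L generalizing F with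
  | zero => rfl
  | succ L ih =>
    simp only [trialExp_succ]
    rw [Finset.mul_sum]
    refine Finset.sum_congr rfl fun k _ => ?_
    rw [ih]; ring

lemma trialExp_sub (F G : (Fin m → ℝ) → ℝ) :
    trialExp p c L (fun d => F d - G d) = trialExp p c L F - trialExp p c L G := by
  have h1 := trialExp_add (p := p) (c := c) (L := L) F (fun d => (-1) * G d)
  rw [trialExp_const_mul] at h1
  simp only [neg_one_mul, ← sub_eq_add_neg] at h1
  exact h1

lemma trialExp_sum {ι : Type*} (s : Finset ι) (F : ι → (Fin m → ℝ) → ℝ) :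
    trialExp p c L (fun d => ∑ i ∈ s, F i d) = ∑ i ∈ s, trialExp p c L (F i) := by
  classical
  induction s using Finset.induction_on with
  | empty => simpa using trialExp_const_mul (p := p) (c := c) (L := L) 0 (fun _ => 0)
  | insert i s hi ih =>
    simp only [Finset.sum_insert hi]
    rw [trialExp_add, ih]

lemma trialExp_const (hs : ∑ j, p j = 1) (a : ℝ) : trialExp p c L (fun _ => a) = a := by
  induction L with
  | zero => rfl
  | succ L ih => simp only [trialExp_succ, ih, ← Finset.sum_mul, hs, one_mul]

/-- The counts always add up to L, so only points of that hyperplane are reached. This is how the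
sum of the centred counts, 0, -1 or -2 according to the number of trials, becomes available in
pointwise estimates. -/
lemma trialExp_mono (hp : ∀ j, 0 ≤ p j) {F G : (Fin m → ℝ) → ℝ}
    (h : ∀ d : Fin m → ℝ, ∑ j, d j = L - ∑ j, c j → F d ≤ G d) :
    trialExp p c L F ≤ trialExp p c L G := by
  induction L generalizing F G with
  | zero => exact h _ (by simp)
  | succ L ih =>
    refine Finset.sum_le_sum fun k _ => mul_le_mul_of_nonneg_left (ih fun d hd => h _ ?_) (hp k)
    simp only [Pi.add_apply, Finset.sum_add_distrib, hd]
    rw [sum_unitVec]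
    push_cast; ring

lemma trialExp_congr (hp : ∀ j, 0 ≤ p j) {F G : (Fin m → ℝ) → ℝ}
    (h : ∀ d : Fin m → ℝ, ∑ j, d j = L - ∑ j, c j → F d = G d) :
    trialExp p c L F = trialExp p c L G :=
  le_antisymm (trialExp_mono hp fun d hd => (h d hd).le)
    (trialExp_mono hp fun d hd => (h d hd).ge)

lemma abs_trialExp_le (hp : ∀ j, 0 ≤ p j) {F G : (Fin m → ℝ) → ℝ}
    (h : ∀ d : Fin m → ℝ, ∑ j, d j = L - ∑ j, c j → |F d| ≤ G d) :
    |trialExp p c L F| ≤ trialExp p c L G := by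
  refine abs_le'.2 ⟨trialExp_mono hp fun d hd => (abs_le.1 (h d hd)).2, ?_⟩
  rw [← neg_one_mul, ← trialExp_const_mul]
  exact trialExp_mono hp fun d hd => by have := (abs_le.1 (h d hd)).1; linarith

/-- The size-bias identity for multinomial counts. -/
lemma trialExp_count_mul (j : Fin m) (F : (Fin m → ℝ) → ℝ) :
    trialExp p c (L + 1) (fun d => (d j + c j) * F d) =
      (L + 1) * p j * trialExp p c L (fun d => F (d + unitVec j)) := by
  induction L generalizing F with
  | zero =>
    simp only [trialExp]
    rw [Finset.sum_eq_single j]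
    · simp [unitVec_apply]
    · intro k _ hk; simp [unitVec_apply, hk.symm]
    · simp
  | succ L ih =>
    rw [trialExp_succ]
    -- Split off one trial, falling in cell k. The remaining count of cell j is handled by
    -- induction, and the indicator of k = j supplies the missing unit in the factor L + 2.
    have e : ∀ k, trialExp p c (L + 1)
        (fun d => ((d + unitVec k) j + c j) * F (d + unitVec k)) =
        (L + 1) * p j * trialExp p c L (fun d => F (d + unitVec j + unitVec k)) +
        (if k = j then 1 else 0) * trialExp p c (L + 1) (fun d => F (d + unitVec k)) := by
      intro k
      have h1 : (fun d : Fin m → ℝ => ((d + unitVec k) j + c j) * F (d + unitVec k)) =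
          fun d => (d j + c j) * F (d + unitVec k) +
            (if k = j then 1 else 0) * F (d + unitVec k) := by
        funext d
        simp only [Pi.add_apply, unitVec_apply, eq_comm (a := j)]
        ring
      rw [h1, trialExp_add, ih (fun d => F (d + unitVec k)), trialExp_const_mul]
    simp only [e, mul_add, Finset.sum_add_distrib, ite_mul, one_mul, zero_mul, mul_ite, mul_zero,
      Finset.sum_ite_eq', Finset.mem_univ, if_true]
    rw [trialExp_succ (L := L) (fun d => F (d + unitVec j)), Finset.mul_sum]
    push_cast
    have : ∀ k, p k * ((L + 1) * p j *
        trialExp p c L (fun d => F (d + unitVec j + unitVec k))) = (L + 1) * p j *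
        (p k * trialExp p c L (fun d => F (d + unitVec k + unitVec j))) := by
      intro k
      simp only [add_right_comm]
      ring
    simp only [this, ← Finset.mul_sum]
    ring

/-- One trial changes a single coordinate by a Bernoulli variable. -/
lemma trialExp_succ_coord (hs : ∑ j, p j = 1) (j : Fin m) (f : ℝ → ℝ) :
    trialExp p c (L + 1) (fun d => f (d j)) =
      trialExp p c L (fun d => p j * f (d j + 1) + (1 - p j) * f (d j)) := by
  have hq : ∑ k ∈ Finset.univ.erase j, p k = 1 - p j := by
    rw [← hs, ← Finset.add_sum_erase _ _ (Finset.mem_univ j)]; ring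
  rw [trialExp_succ, ← Finset.add_sum_erase _ _ (Finset.mem_univ j), trialExp_add,
    trialExp_const_mul, trialExp_const_mul, ← hq, Finset.sum_mul]
  congr 1
  · simp [unitVec_apply]
  · refine Finset.sum_congr rfl fun k hk => ?_
    have : j ≠ k := (Finset.ne_of_mem_erase hk).symm
    simp [unitVec_apply, this]

/-- Each trial adds an independent centred Bernoulli variable with second, third and fourth moments
q(1 - q), q(1 - q)(1 - 2q) and q(1 - q)(1 - 3q(1 - q)); expanding the powers gives recursions in L.
-/
lemma trialExp_centered_moments (hs : ∑ j, p j = 1) (j : Fin m) :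
    trialExp p c L (fun d => d j + c j - L * p j) = 0 ∧
    trialExp p c L (fun d => (d j + c j - L * p j) ^ 2) = L * (p j * (1 - p j)) ∧
    trialExp p c L (fun d => (d j + c j - L * p j) ^ 3) =
      L * (p j * (1 - p j)) * (1 - 2 * p j) ∧
    trialExp p c L (fun d => (d j + c j - L * p j) ^ 4) =
      3 * L * (L - 1) * (p j * (1 - p j)) ^ 2
        + L * (p j * (1 - p j)) * (1 - 3 * (p j * (1 - p j))) := by
  induction L with
  | zero => simp [trialExp]
  | succ L ih =>
    obtain ⟨h1, h2, h3, h4⟩ := ih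
    set q := p j with hq
    have key := fun f : ℝ → ℝ => trialExp_succ_coord (p := p) (c := c) (L := L) hs j f
    refine ⟨?_, ?_, ?_, ?_⟩
    · rw [key (fun x => x + c j - (L + 1 : ℕ) * q)]
      refine Eq.trans (congrArg _ (funext fun d => ?_)) h1
      push_cast; ring
    · rw [key (fun x => (x + c j - (L + 1 : ℕ) * q) ^ 2)]
      have : (fun d : Fin m → ℝ => p j * (d j + 1 + c j - (L + 1 : ℕ) * q) ^ 2 +
          (1 - p j) * (d j + c j - (L + 1 : ℕ) * q) ^ 2) =
          fun d => (d j + c j - L * q) ^ 2 + q * (1 - q) := by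
        funext d; rw [← hq]; push_cast; ring
      rw [this, trialExp_add, trialExp_const hs, h2]
      push_cast; ring
    · rw [key (fun x => (x + c j - (L + 1 : ℕ) * q) ^ 3)]
      have : (fun d : Fin m → ℝ => p j * (d j + 1 + c j - (L + 1 : ℕ) * q) ^ 3 +
          (1 - p j) * (d j + c j - (L + 1 : ℕ) * q) ^ 3) =
          fun d => (d j + c j - L * q) ^ 3 + 3 * (q * (1 - q)) * (d j + c j - L * q)
            + q * (1 - q) * (1 - 2 * q) := by
        funext d; rw [← hq]; push_cast; ring
      rw [this, trialExp_add, trialExp_add, trialExp_const hs, trialExp_const_mul, h1, h3]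
      push_cast; ring
    · rw [key (fun x => (x + c j - (L + 1 : ℕ) * q) ^ 4)]
      have : (fun d : Fin m → ℝ => p j * (d j + 1 + c j - (L + 1 : ℕ) * q) ^ 4 +
          (1 - p j) * (d j + c j - (L + 1 : ℕ) * q) ^ 4) =
          fun d => (d j + c j - L * q) ^ 4 + 6 * (q * (1 - q)) * (d j + c j - L * q) ^ 2
            + 4 * (q * (1 - q) * (1 - 2 * q)) * (d j + c j - L * q)
            + q * (1 - q) * (1 - 3 * (q * (1 - q))) := by
        funext d; rw [← hq]; push_cast; ring
      rw [this, trialExp_add, trialExp_add, trialExp_add, trialExp_const hs, trialExp_const_mul,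
        trialExp_const_mul, h1, h2, h4]
      push_cast; ring

/-- The left side is E (Y - δ)⁴ expanded, with Y the properly centred count; the factor 0 is its
vanishing first moment. The leading part is at most 3 l², and the rest is at most 33 l + 16, which
is below l² for l ≥ 40. -/
lemma fourth_moment_aux {q l δ L : ℝ} (hp0 : 0 ≤ q) (hp1 : q ≤ 1) (hL : 0 ≤ L)
    (hLq : L * q = l - δ) (hδ0 : 0 ≤ δ) (hδ2 : δ ≤ 2) (hl : 40 ≤ l) :
    3 * L * (L - 1) * (q * (1 - q)) ^ 2 + L * (q * (1 - q)) * (1 - 3 * (q * (1 - q)))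
      + -4 * δ * (L * (q * (1 - q)) * (1 - 2 * q)) + 6 * δ ^ 2 * (L * (q * (1 - q)))
      + -4 * δ ^ 3 * 0 + δ ^ 4 ≤ 4 * l ^ 2 := by
  have hq : 0 ≤ 1 - q := by linarith
  obtain ⟨V, hV⟩ : ∃ V, V = L * (q * (1 - q)) := ⟨_, rfl⟩
  have hVn : 0 ≤ V := by rw [hV]; positivity
  have hVl : V ≤ l := by
    have : V = (l - δ) * (1 - q) := by rw [hV, ← hLq]; ring
    have : 0 ≤ (l - δ) * q := by rw [← hLq]; positivity
    linarith
  have hδ4 : δ ^ 2 ≤ 4 := by nlinarith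
  have t1 : 3 * L * (L - 1) * (q * (1 - q)) ^ 2 ≤ 3 * l ^ 2 := by
    have e : 3 * L * (L - 1) * (q * (1 - q)) ^ 2 = 3 * V ^ 2 - 3 * L * (q * (1 - q)) ^ 2 := by
      rw [hV]; ring
    have : 0 ≤ 3 * L * (q * (1 - q)) ^ 2 := by positivity
    have : V ^ 2 ≤ l ^ 2 := pow_le_pow_left₀ hVn hVl 2
    linarith
  rw [← hV]
  have t2 : V * (1 - 3 * (q * (1 - q))) ≤ l := by
    have : 0 ≤ V * (3 * (q * (1 - q))) := by positivity
    linarith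
  have t3 : -4 * δ * (V * (1 - 2 * q)) ≤ 8 * l := by
    have a1 : -(V * (1 - 2 * q)) ≤ V := by
      have : 0 ≤ V * (1 - q) := by positivity
      linarith
    have a2 : δ * -(V * (1 - 2 * q)) ≤ δ * V := mul_le_mul_of_nonneg_left a1 hδ0
    have a3 : δ * V ≤ 2 * l := mul_le_mul hδ2 hVl hVn (by norm_num)
    linarith
  have t4 : 6 * δ ^ 2 * V ≤ 24 * l := by
    have : δ ^ 2 * V ≤ 4 * l := mul_le_mul hδ4 hVl hVn (by norm_num)
    linarith
  have t5 : δ ^ 4 ≤ 16 := by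
    have := pow_le_pow_left₀ (sq_nonneg δ) hδ4 2
    linarith [show (δ ^ 2) ^ 2 = δ ^ 4 by ring]
  have t6 : 40 * l ≤ l ^ 2 := by
    rw [sq]; exact mul_le_mul_of_nonneg_right hl (by linarith)
  linarith

/-- Second and fourth moments of a count centred at the mean of a slightly larger number `n` of
trials. -/
lemma trialExp_moment_bounds (hp : ∀ j, 0 < p j) (hs : ∑ j, p j = 1) {n : ℝ}
    (hc : ∀ j, c j = n * p j) (j : Fin m) (hL : (L : ℝ) ≤ n - 1) (hL' : n - 2 ≤ (L : ℝ))
    (hn : 40 ≤ n * p j) :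
    trialExp p c L (fun d => d j ^ 2) ≤ c j ∧
    trialExp p c L (fun d => d j ^ 4) ≤ 4 * c j ^ 2 := by
  obtain ⟨h1, h2, h3, h4⟩ := trialExp_centered_moments (p := p) (c := c) (L := L) hs j
  have hp1 : p j ≤ 1 := by
    rw [← hs]; exact Finset.single_le_sum (fun k _ => (hp k).le) (Finset.mem_univ j)
  have hp0 := hp j
  set q := p j with hq
  set l := c j with hl
  have hlq : l = n * q := hc j
  -- The counts come from L trials but are centred at n q, so the centre is off by δ = (n - L) q, at
  -- most 2q.
  set δ : ℝ := l - L * q with hδ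
  have hδ0 : 0 ≤ δ := by rw [hδ, hlq]; nlinarith
  have hδ2 : δ ≤ 2 * q := by rw [hδ, hlq]; nlinarith
  have hLq : L * q = l - δ := by rw [hδ]; ring
  have hl40 : 40 ≤ l := by rw [hlq]; exact hn
  have hV : L * (q * (1 - q)) ≤ (l - δ) * (1 - q) := by rw [← hLq]; linarith
  have hV0 : 0 ≤ (1 - q) := by linarith
  have e2 : (fun d : Fin m → ℝ => d j ^ 2) = fun d => (d j + l - L * q) ^ 2
      + (-2 * δ) * (d j + l - L * q) + δ ^ 2 := by
    funext d; rw [hδ]; ring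
  have e4 : (fun d : Fin m → ℝ => d j ^ 4) = fun d => (d j + l - L * q) ^ 4
      + (-4 * δ) * (d j + l - L * q) ^ 3 + 6 * δ ^ 2 * (d j + l - L * q) ^ 2
      + (-4 * δ ^ 3) * (d j + l - L * q) + δ ^ 4 := by
    funext d; rw [hδ]; ring
  constructor
  · rw [e2, trialExp_add, trialExp_add, trialExp_const hs, trialExp_const_mul, h1, h2]
    nlinarith [mul_nonneg hδ0 hV0, mul_nonneg hp0.le hV0]
  · rw [e4, trialExp_add, trialExp_add, trialExp_add, trialExp_add, trialExp_const hs,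
      trialExp_const_mul, trialExp_const_mul, trialExp_const_mul, h1, h2, h3, h4]
    exact fourth_moment_aux hp0.le hp1 (Nat.cast_nonneg L) hLq hδ0 (by linarith) hl40

end Trials

/-! ### Taylor estimates on the closed half-line. -/

section Taylor

/-- Only a bound on the top derivative is assumed, not continuity, so the remainder comes from the
mean value inequality with the comparison function K t² / 2 instead of an integral formula. -/
lemma abs_taylor_unit_two {q q1 q2 : ℝ → ℝ} {K : ℝ}
    (h0 : ∀ t ∈ Icc (0 : ℝ) 1, HasDerivAt q (q1 t) t)
    (h1 : ∀ t ∈ Icc (0 : ℝ) 1, HasDerivAt q1 (q2 t) t)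
    (hK : ∀ t ∈ Icc (0 : ℝ) 1, |q2 t| ≤ K) {t : ℝ} (ht : t ∈ Icc (0 : ℝ) 1) :
    |q t - q 0 - q1 0 * t| ≤ K * (t ^ 2 / 2) := by
  have s1 : ∀ t ∈ Icc (0 : ℝ) 1, |q1 t - q1 0| ≤ K * t := fun t ht => by
    have := norm_image_sub_le_of_norm_deriv_le_segment' (f := q1) (f' := q2)
      (fun t ht => (h1 t ht).hasDerivWithinAt) (fun t ht => hK t (Ico_subset_Icc_self ht)) t ht
    simpa using this
  have hd : ∀ t ∈ Icc (0 : ℝ) 1, HasDerivAt (fun t => q t - q 0 - q1 0 * t) (q1 t - q1 0) t :=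
    fun t ht => by
      refine (((h0 t ht).sub_const (q 0)).sub ((hasDerivAt_id t).const_mul (q1 0))).congr_deriv ?_
      ring
  have hB : ∀ t : ℝ, HasDerivAt (fun t => K * (t ^ 2 / 2)) (K * t) t := fun t => by
    refine (((hasDerivAt_pow 2 t).div_const 2).const_mul K).congr_deriv ?_
    push_cast; ring
  exact image_norm_le_of_norm_deriv_right_le_deriv_boundary
    (f := fun t => q t - q 0 - q1 0 * t) (a := 0) (b := 1)
    (fun t ht => (hd t ht).continuousAt.continuousWithinAt)
    (fun t ht => (hd t (Ico_subset_Icc_self ht)).hasDerivWithinAt) (by simp) hB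
    (fun t ht => s1 t (Ico_subset_Icc_self ht)) ht

lemma abs_taylor_unit_three {q q1 q2 q3 : ℝ → ℝ} {K : ℝ}
    (h0 : ∀ t ∈ Icc (0 : ℝ) 1, HasDerivAt q (q1 t) t)
    (h1 : ∀ t ∈ Icc (0 : ℝ) 1, HasDerivAt q1 (q2 t) t)
    (h2 : ∀ t ∈ Icc (0 : ℝ) 1, HasDerivAt q2 (q3 t) t)
    (hK : ∀ t ∈ Icc (0 : ℝ) 1, |q3 t| ≤ K) {t : ℝ} (ht : t ∈ Icc (0 : ℝ) 1) :
    |q t - q 0 - q1 0 * t - q2 0 * (t ^ 2 / 2)| ≤ K * (t ^ 3 / 6) := by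
  have hd : ∀ t ∈ Icc (0 : ℝ) 1, HasDerivAt (fun t => q t - q 0 - q1 0 * t - q2 0 * (t ^ 2 / 2))
      (q1 t - q1 0 - q2 0 * t) t := fun t ht => by
    refine ((((h0 t ht).sub_const (q 0)).sub ((hasDerivAt_id t).const_mul (q1 0))).sub
      (((hasDerivAt_pow 2 t).div_const 2).const_mul (q2 0))).congr_deriv ?_
    push_cast; ring
  have hB : ∀ t : ℝ, HasDerivAt (fun t => K * (t ^ 3 / 6)) (K * (t ^ 2 / 2)) t := fun t => by
    refine (((hasDerivAt_pow 3 t).div_const 6).const_mul K).congr_deriv ?_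
    push_cast; ring
  exact image_norm_le_of_norm_deriv_right_le_deriv_boundary
    (f := fun t => q t - q 0 - q1 0 * t - q2 0 * (t ^ 2 / 2)) (a := 0) (b := 1)
    (fun t ht => (hd t ht).continuousAt.continuousWithinAt)
    (fun t ht => (hd t (Ico_subset_Icc_self ht)).hasDerivWithinAt) (by simp) hB
    (fun t ht => abs_taylor_unit_two h1 h2 hK (Ico_subset_Icc_self ht)) ht

variable {g g1 g2 g3 : ℝ → ℝ} {K x a : ℝ}

lemma segment_nonneg (hx : 0 ≤ x) (hxa : 0 ≤ x + a) {t : ℝ} (ht : t ∈ Icc (0 : ℝ) 1) :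
    0 ≤ x + t * a := by
  have : x + t * a = (1 - t) * x + t * (x + a) := by ring
  rw [this]
  have := sub_nonneg.2 ht.2
  have := ht.1
  positivity

lemma hasDerivAt_segment (hd : ∀ x, 0 ≤ x → HasDerivAt g (g1 x) x) (hx : 0 ≤ x)
    (hxa : 0 ≤ x + a) {t : ℝ} (ht : t ∈ Icc (0 : ℝ) 1) :
    HasDerivAt (fun t => g (x + t * a)) (g1 (x + t * a) * a) t := by
  have h2 : HasDerivAt (fun t : ℝ => x + t * a) a t := by
    simpa using ((hasDerivAt_id t).mul_const a).const_add x
  exact (hd _ (segment_nonneg hx hxa ht)).comp t h2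

lemma abs_sub_le_of_deriv (hd : ∀ x, 0 ≤ x → HasDerivAt g (g1 x) x)
    (hK : ∀ x, 0 ≤ x → |g1 x| ≤ K) (hx : 0 ≤ x) (hxa : 0 ≤ x + a) :
    |g (x + a) - g x| ≤ K * |a| := by
  have := (convex_Ici (0 : ℝ)).norm_image_sub_le_of_norm_hasDerivWithin_le (f := g) (f' := g1)
    (C := K) (fun z hz => (hd z hz).hasDerivWithinAt) (fun z hz => hK z hz)
    (mem_Ici.2 hx) (mem_Ici.2 hxa)
  simpa using this

lemma abs_taylor_two (hd : ∀ x, 0 ≤ x → HasDerivAt g (g1 x) x)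
    (hd1 : ∀ x, 0 ≤ x → HasDerivAt g1 (g2 x) x)
    (hK : ∀ x, 0 ≤ x → |g2 x| ≤ K) (hx : 0 ≤ x) (hxa : 0 ≤ x + a) :
    |g (x + a) - g x - a * g1 x| ≤ K * a ^ 2 / 2 := by
  have := abs_taylor_unit_two (q := fun t => g (x + t * a)) (q1 := fun t => g1 (x + t * a) * a)
    (q2 := fun t => g2 (x + t * a) * a * a) (K := K * a ^ 2)
    (fun t ht => hasDerivAt_segment hd hx hxa ht)
    (fun t ht => (hasDerivAt_segment hd1 hx hxa ht).mul_const a)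
    (fun t ht => by
      rw [mul_assoc, ← sq, abs_mul, abs_of_nonneg (sq_nonneg a)]
      exact mul_le_mul_of_nonneg_right (hK _ (segment_nonneg hx hxa ht)) (sq_nonneg a))
    (right_mem_Icc.2 zero_le_one)
  convert this using 2
  · simp; ring
  · ring

lemma abs_taylor_three (hd : ∀ x, 0 ≤ x → HasDerivAt g (g1 x) x)
    (hd1 : ∀ x, 0 ≤ x → HasDerivAt g1 (g2 x) x) (hd2 : ∀ x, 0 ≤ x → HasDerivAt g2 (g3 x) x)
    (hK : ∀ x, 0 ≤ x → |g3 x| ≤ K) (hx : 0 ≤ x) (hxa : 0 ≤ x + a) :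
    |g (x + a) - g x - a * g1 x - a ^ 2 / 2 * g2 x| ≤ K * |a| ^ 3 / 6 := by
  have := abs_taylor_unit_three (q := fun t => g (x + t * a))
    (q1 := fun t => g1 (x + t * a) * a)
    (q2 := fun t => g2 (x + t * a) * a * a) (q3 := fun t => g3 (x + t * a) * a * a * a)
    (K := K * |a| ^ 3)
    (fun t ht => hasDerivAt_segment hd hx hxa ht)
    (fun t ht => (hasDerivAt_segment hd1 hx hxa ht).mul_const a)
    (fun t ht => ((hasDerivAt_segment hd2 hx hxa ht).mul_const a).mul_const a)
    (fun t ht => by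
      rw [abs_mul, abs_mul, abs_mul, mul_assoc, mul_assoc]
      have : |a| * (|a| * |a|) = |a| ^ 3 := by ring
      rw [this]
      exact mul_le_mul_of_nonneg_right (hK _ (segment_nonneg hx hxa ht)) (by positivity))
    (right_mem_Icc.2 zero_le_one)
  convert this using 2
  · simp; ring
  · ring

end Taylor

/-! ### Pearson's quadratic form: increments and moments of standardised counts. -/

section Cells

variable {m : ℕ}

/-- Pearson's quadratic form in the centred counts `d`. -/
noncomputable def pearsonForm (n : ℕ) (p d : Fin m → ℝ) : ℝ := ∑ j, d j ^ 2 / (n * p j)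

/-- The increment of `pearsonForm` when cell `j` receives one more trial. -/
noncomputable def pearsonIncr (n : ℕ) (p d : Fin m → ℝ) (j : Fin m) : ℝ :=
  (2 * d j + 1) / (n * p j)

/-- The absolute value of a standardised count. -/
noncomputable def absStd (n : ℕ) (p d : Fin m → ℝ) (j : Fin m) : ℝ := |d j| / √(n * p j)

/-- Cell probabilities for which all expected counts are at least `1 / ρ ^ 2 ≥ 64`. -/
structure IsCells (n : ℕ) (p : Fin m → ℝ) (ρ : ℝ) : Prop where
  pos : ∀ j, 0 < p j
  sum_eq : ∑ j, p j = 1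
  two_le : 2 ≤ m
  rho_pos : 0 < ρ
  rho_le : ρ ≤ 1 / 8
  one_le : ∀ j, 1 ≤ ρ ^ 2 * (n * p j)

namespace IsCells

variable {n : ℕ} {p : Fin m → ℝ} {ρ : ℝ} (H : IsCells n p ρ)
include H

lemma nonneg (j : Fin m) : 0 ≤ p j := (H.pos j).le

lemma rho_sq_le : ρ ^ 2 ≤ 1 / 64 := by
  have := pow_le_pow_left₀ H.rho_pos.le H.rho_le 2
  linarith

lemma mean_ge (j : Fin m) : 64 ≤ n * p j := by
  have h1 := H.one_le j
  have h2 := H.rho_sq_le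
  by_contra! hc
  have : 0 < ρ ^ 2 := by have := H.rho_pos; positivity
  nlinarith

lemma mean_pos (j : Fin m) : 0 < n * p j := by linarith [H.mean_ge j]

lemma n_pos : (0 : ℝ) < n := by
  have := H.mean_pos ⟨0, by have := H.two_le; omega⟩
  exact pos_of_mul_pos_left this (H.nonneg _)

/-- Sum `one_le` over the cells. This makes every term of size m / n a term of order ρ². -/
lemma card_le : (m : ℝ) ≤ ρ ^ 2 * n := by
  have : ∑ j : Fin m, (1 : ℝ) ≤ ∑ j, ρ ^ 2 * (n * p j) := Finset.sum_le_sum fun j _ => H.one_le j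
  rw [← Finset.mul_sum, ← Finset.mul_sum, H.sum_eq] at this
  simpa using this

lemma two_le_cast : (2 : ℝ) ≤ m := by exact_mod_cast H.two_le

lemma card_div_le : (m : ℝ) / n ≤ ρ ^ 2 := (div_le_iff₀ H.n_pos).2 H.card_le

/-- Multiply 2 ≤ m ≤ ρ² n by p_j. Corrections carrying a bare p_j thereby become second order
relative to n p_j. -/
lemma prob_le (j : Fin m) : p j ≤ n * p j * ρ ^ 2 / 2 := by
  have h1 := H.card_le
  have h2 := H.two_le_cast
  have h3 := H.pos j
  nlinarith

lemma two_le_n : 2 ≤ n := by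
  have h1 := H.card_le
  have h2 := H.two_le_cast
  have h3 := H.rho_sq_le
  have h4 := H.n_pos
  have : (2 : ℝ) ≤ n := by nlinarith
  exact_mod_cast this

lemma sqrt_mean_pos (j : Fin m) : 0 < √(n * p j) := Real.sqrt_pos.2 (H.mean_pos j)

lemma sq_sqrt_mean (j : Fin m) : √(n * p j) * √(n * p j) = n * p j :=
  Real.mul_self_sqrt (H.mean_pos j).le

lemma one_le_sqrt (j : Fin m) : 1 ≤ ρ * √(n * p j) := by
  have h1 := H.one_le j
  rw [← H.sq_sqrt_mean j] at h1
  have := mul_pos H.rho_pos (H.sqrt_mean_pos j)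
  by_contra! hc
  nlinarith

omit H in
lemma absStd_nonneg (d : Fin m → ℝ) (j : Fin m) : 0 ≤ absStd n p d j := by
  unfold absStd; positivity

lemma abs_eq (d : Fin m → ℝ) (j : Fin m) : |d j| = absStd n p d j * √(n * p j) := by
  unfold absStd; rw [div_mul_cancel₀ _ (H.sqrt_mean_pos j).ne']

lemma absStd_sq (d : Fin m → ℝ) (j : Fin m) : d j ^ 2 = n * p j * absStd n p d j ^ 2 := by
  rw [← sq_abs, H.abs_eq, mul_pow, sq √_, H.sq_sqrt_mean]; ring

lemma abs_add_one_le (d : Fin m → ℝ) (j : Fin m) :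
    |d j + 1| ≤ √(n * p j) * (absStd n p d j + ρ) := by
  refine (abs_add_le _ _).trans ?_
  rw [abs_one, H.abs_eq]
  linarith [H.one_le_sqrt j]

lemma abs_incr_le' (d : Fin m → ℝ) (j : Fin m) :
    √(n * p j) * |pearsonIncr n p d j| ≤ 2 * absStd n p d j + ρ := by
  have h1 := H.sqrt_mean_pos j
  have h2 : √(n * p j) * |pearsonIncr n p d j| = |2 * d j + 1| / √(n * p j) := by
    rw [pearsonIncr, abs_div, abs_of_pos (H.mean_pos j), eq_div_iff h1.ne', mul_right_comm,
      H.sq_sqrt_mean, mul_div_cancel₀ _ (H.mean_pos j).ne']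
  rw [h2, div_le_iff₀ h1]
  refine (abs_add_le _ _).trans ?_
  rw [abs_one, abs_mul, abs_two, H.abs_eq]
  linarith [H.one_le_sqrt j]

lemma abs_incr_le (d : Fin m → ℝ) (j : Fin m) :
    |pearsonIncr n p d j| ≤ ρ * (2 * absStd n p d j + ρ) := by
  have h1 := H.abs_incr_le' d j
  have h2 := H.one_le_sqrt j
  have h3 := H.rho_pos
  have h4 := abs_nonneg (pearsonIncr n p d j)
  calc |pearsonIncr n p d j| ≤ ρ * √(n * p j) * |pearsonIncr n p d j| :=
        le_mul_of_one_le_left h4 h2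
    _ = ρ * (√(n * p j) * |pearsonIncr n p d j|) := by ring
    _ ≤ _ := by gcongr

lemma incr_sq_le (d : Fin m → ℝ) (j : Fin m) :
    pearsonIncr n p d j ^ 2 ≤ ρ ^ 2 * (2 * absStd n p d j + ρ) ^ 2 := by
  rw [← sq_abs, ← mul_pow]
  exact pow_le_pow_left₀ (abs_nonneg _) (H.abs_incr_le d j) 2

lemma abs_add_one_mul_incr_le (d : Fin m → ℝ) (j : Fin m) :
    |d j + 1| * |pearsonIncr n p d j| ≤
      (absStd n p d j + ρ) * (2 * absStd n p d j + ρ) := by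
  have h0 := absStd_nonneg (n := n) (p := p) d j
  have h3 := H.rho_pos
  calc |d j + 1| * |pearsonIncr n p d j|
      ≤ √(n * p j) * (absStd n p d j + ρ) * |pearsonIncr n p d j| := by
        gcongr; exact H.abs_add_one_le d j
    _ = (absStd n p d j + ρ) * (√(n * p j) * |pearsonIncr n p d j|) := by ring
    _ ≤ _ := by gcongr; exact H.abs_incr_le' d j

lemma form_nonneg (d : Fin m → ℝ) : 0 ≤ pearsonForm n p d :=
  Finset.sum_nonneg fun j _ => div_nonneg (sq_nonneg _) (H.mean_pos j).le

omit H in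
lemma form_add (d : Fin m → ℝ) (k : Fin m) :
    pearsonForm n p (d + unitVec k) = pearsonForm n p d + pearsonIncr n p d k := by
  have : ∀ j, (d + unitVec k) j ^ 2 / (n * p j) =
      d j ^ 2 / (n * p j) + if j = k then pearsonIncr n p d j else 0 := by
    intro j
    simp only [Pi.add_apply, unitVec_apply, pearsonIncr]
    split_ifs
    · ring
    · simp
  simp only [pearsonForm, this, Finset.sum_add_distrib, Finset.sum_ite_eq', Finset.mem_univ,
    if_true]

lemma form_add_nonneg (d : Fin m → ℝ) (k : Fin m) :
    0 ≤ pearsonForm n p d + pearsonIncr n p d k := by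
  rw [← form_add]; exact H.form_nonneg _

/-- Averaging over the cell of the new trial cancels p_k in the denominator, so the mean increment
depends only on the sum of the centred counts, which is deterministic. -/
lemma sum_prob_mul_incr (d : Fin m → ℝ) :
    ∑ k, p k * pearsonIncr n p d k = (2 * ∑ k, d k + m) / n := by
  have : ∀ k, p k * pearsonIncr n p d k = (2 * d k + 1) / n := fun k => by
    have := (H.pos k).ne'
    have := H.n_pos.ne'
    unfold pearsonIncr
    field_simp
  simp only [this, ← Finset.sum_div, Finset.sum_add_distrib, ← Finset.mul_sum]
  simp

/-- From (d + 1)(2d + 1) = 2d² + 3d + 1. The multiple of the form itself is what cancels the term W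
φ'(W) of the Stein operator. -/
lemma sum_add_one_mul_incr (d : Fin m → ℝ) :
    ∑ j, (d j + 1) * pearsonIncr n p d j =
      2 * pearsonForm n p d + ∑ j, (3 * d j + 1) / (n * p j) := by
  rw [pearsonForm, Finset.mul_sum, ← Finset.sum_add_distrib]
  refine Finset.sum_congr rfl fun j _ => ?_
  have := (H.mean_pos j).ne'
  unfold pearsonIncr
  field_simp
  ring

section Moments

variable {L : ℕ} (hL : (L : ℝ) ≤ n - 1) (hL' : (n : ℝ) - 2 ≤ L)
include hL hL'

local notation "𝔼" => trialExp p (fun j => n * p j) L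

lemma exp_absStd_sq_le (j : Fin m) : 𝔼 (fun d => absStd n p d j ^ 2) ≤ 1 := by
  have h := (trialExp_moment_bounds (c := fun j => n * p j) (n := n) H.pos H.sum_eq
    (fun _ => rfl) j hL hL' (by linarith [H.mean_ge j])).1
  have hm := H.mean_pos j
  have e : (fun d : Fin m → ℝ => d j ^ 2) = fun d => n * p j * absStd n p d j ^ 2 :=
    funext fun d => H.absStd_sq d j
  rw [e, trialExp_const_mul] at h
  exact le_of_mul_le_mul_left (by linarith) hm

lemma exp_absStd_four_le (j : Fin m) : 𝔼 (fun d => absStd n p d j ^ 4) ≤ 4 := by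
  have h := (trialExp_moment_bounds (c := fun j => n * p j) (n := n) H.pos H.sum_eq
    (fun _ => rfl) j hL hL' (by linarith [H.mean_ge j])).2
  have hm := H.mean_pos j
  have e : (fun d : Fin m → ℝ => d j ^ 4) = fun d => (n * p j) ^ 2 * absStd n p d j ^ 4 := by
    funext d
    have := H.absStd_sq d j
    calc d j ^ 4 = (d j ^ 2) ^ 2 := by ring
      _ = _ := by rw [this]; ring
  rw [e, trialExp_const_mul] at h
  exact le_of_mul_le_mul_left (by linarith) (pow_pos hm 2)

/-- Odd and mixed moments are reduced to the second and fourth by pointwise inequalities of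
arithmetic-geometric mean type. -/
lemma exp_le_of_le {F : (Fin m → ℝ) → ℝ} (j k : Fin m) (a b c e : ℝ)
    (ha : 0 ≤ a) (hb : 0 ≤ b) (hc : 0 ≤ c)
    (h : ∀ d, F d ≤ a * absStd n p d j ^ 2 + b * absStd n p d k ^ 2 + c * absStd n p d j ^ 4
      + e) : 𝔼 F ≤ a + b + 4 * c + e := by
  refine (trialExp_mono H.nonneg fun d _ => h d).trans ?_
  rw [trialExp_add, trialExp_add, trialExp_add, trialExp_const H.sum_eq, trialExp_const_mul,
    trialExp_const_mul, trialExp_const_mul]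
  have h1 := H.exp_absStd_sq_le hL hL' j
  have h2 := H.exp_absStd_sq_le hL hL' k
  have h3 := H.exp_absStd_four_le hL hL' j
  nlinarith

lemma exp_absStd_le (j : Fin m) : 𝔼 (fun d => absStd n p d j) ≤ 1 := by
  have := H.exp_le_of_le hL hL' (F := fun d => absStd n p d j) j j (1 / 2) 0 0 (1 / 2)
    (by norm_num) le_rfl le_rfl (fun d => by nlinarith [sq_nonneg (absStd n p d j - 1)])
  linarith

lemma exp_absStd_cube_le (j : Fin m) : 𝔼 (fun d => absStd n p d j ^ 3) ≤ 2 := by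
  have := H.exp_le_of_le hL hL' (F := fun d => absStd n p d j ^ 3) j j 1 0 (1 / 4) 0
    (by norm_num) le_rfl (by norm_num)
    (fun d => by nlinarith [sq_nonneg (absStd n p d j ^ 2 - 2 * absStd n p d j)])
  linarith

lemma exp_mul_le (j k : Fin m) : 𝔼 (fun d => absStd n p d j * absStd n p d k) ≤ 1 := by
  have := H.exp_le_of_le hL hL' (F := fun d => absStd n p d j * absStd n p d k) j k
    (1 / 2) (1 / 2) 0 0 (by norm_num) (by norm_num) le_rfl
    (fun d => by nlinarith [sq_nonneg (absStd n p d j - absStd n p d k)])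
  linarith

lemma exp_sq_mul_le (j k : Fin m) : 𝔼 (fun d => absStd n p d j ^ 2 * absStd n p d k) ≤ 2 := by
  have := H.exp_le_of_le hL hL' (F := fun d => absStd n p d j ^ 2 * absStd n p d k) j k
    0 1 (1 / 4) 0 le_rfl (by norm_num) (by norm_num)
    (fun d => by nlinarith [sq_nonneg (absStd n p d j ^ 2 - 2 * absStd n p d k)])
  linarith

lemma exp_sq_mul_sq_le (j k : Fin m) :
    𝔼 (fun d => absStd n p d j ^ 2 * absStd n p d k ^ 2) ≤ 4 := by
  have h : 𝔼 (fun d => absStd n p d j ^ 2 * absStd n p d k ^ 2) ≤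
      𝔼 (fun d => 1 / 2 * absStd n p d j ^ 4 + 1 / 2 * absStd n p d k ^ 4) :=
    trialExp_mono H.nonneg fun d _ => by
      nlinarith [sq_nonneg (absStd n p d j ^ 2 - absStd n p d k ^ 2)]
  rw [trialExp_add, trialExp_const_mul, trialExp_const_mul] at h
  linarith [H.exp_absStd_four_le hL hL' j, H.exp_absStd_four_le hL hL' k]

lemma exp_cube_mul_le (j k : Fin m) : 𝔼 (fun d => absStd n p d j ^ 3 * absStd n p d k) ≤ 4 := by
  have h : 𝔼 (fun d => absStd n p d j ^ 3 * absStd n p d k) ≤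
      𝔼 (fun d => 1 / 2 * absStd n p d j ^ 4
        + 1 / 2 * (absStd n p d j ^ 2 * absStd n p d k ^ 2)) :=
    trialExp_mono H.nonneg fun d _ => by
      nlinarith [sq_nonneg (absStd n p d j ^ 2 - absStd n p d j * absStd n p d k)]
  rw [trialExp_add, trialExp_const_mul, trialExp_const_mul] at h
  linarith [H.exp_absStd_four_le hL hL' j, H.exp_sq_mul_sq_le hL hL' j k]

lemma exp_poly_le (j : Fin m) (a₀ a₁ a₂ a₃ a₄ : ℝ) (h₁ : 0 ≤ a₁) (h₂ : 0 ≤ a₂) (h₃ : 0 ≤ a₃)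
    (h₄ : 0 ≤ a₄) :
    𝔼 (fun d => a₀ + a₁ * absStd n p d j + a₂ * absStd n p d j ^ 2 + a₃ * absStd n p d j ^ 3
      + a₄ * absStd n p d j ^ 4) ≤ a₀ + a₁ + a₂ + 2 * a₃ + 4 * a₄ := by
  simp only [trialExp_add, trialExp_const_mul, trialExp_const H.sum_eq]
  have e1 := H.exp_absStd_le hL hL' j
  have e2 := H.exp_absStd_sq_le hL hL' j
  have e3 := H.exp_absStd_cube_le hL hL' j
  have e4 := H.exp_absStd_four_le hL hL' j
  nlinarith

omit hL hL' in
/-- Averages over the cells are bounded by the uniform bound. -/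
lemma exp_average_le (F : Fin m → (Fin m → ℝ) → ℝ) (C : ℝ) (h : ∀ k, 𝔼 (F k) ≤ C) :
    𝔼 (fun d => ∑ k, p k * F k d) ≤ C := by
  rw [trialExp_sum]
  simp only [trialExp_const_mul]
  calc ∑ k, p k * 𝔼 (F k) ≤ ∑ k, p k * C :=
        Finset.sum_le_sum fun k _ => mul_le_mul_of_nonneg_left (h k) (H.nonneg k)
    _ = C := by rw [← Finset.sum_mul, H.sum_eq, one_mul]

omit H hL hL' in
lemma exp_sum_le (F : Fin m → (Fin m → ℝ) → ℝ) (C : ℝ) (h : ∀ k, 𝔼 (F k) ≤ C) :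
    𝔼 (fun d => ∑ k, F k d) ≤ m * C := by
  rw [trialExp_sum]
  calc ∑ k, 𝔼 (F k) ≤ ∑ k : Fin m, C := Finset.sum_le_sum fun k _ => h k
    _ = m * C := by simp

end Moments

end IsCells
end Cells

/-! ### The Stein operator at Pearson's statistic, and the error of order ρ. -/

namespace IsCells

variable {m n : ℕ} {p : Fin m → ℝ} {ρ : ℝ} (H : IsCells n p ρ)
include H

lemma sum_mean : ∑ j, (n : ℝ) * p j = n := by rw [← Finset.mul_sum, H.sum_eq, mul_one]

/-- With all n trials the d_j sum to zero, so W may be rewritten as the sum of U_j d_j / (n p_j).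
Each summand carries the factor U_j required by the size-bias identity, whose factor n p_j then
cancels the denominator. -/
lemma exp_form_mul {L : ℕ} (hn : n = L + 1) (φ : ℝ → ℝ) :
    trialExp p (fun j => n * p j) (L + 1) (fun d => pearsonForm n p d * φ (pearsonForm n p d)) =
    trialExp p (fun j => n * p j) L
      (fun d => ∑ j, (d j + 1) * φ (pearsonForm n p d + pearsonIncr n p d j)) := by
  have h1 : trialExp p (fun j => n * p j) (L + 1)
      (fun d => pearsonForm n p d * φ (pearsonForm n p d)) =
      trialExp p (fun j => n * p j) (L + 1) (fun d => ∑ j, (n * p j)⁻¹ *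
        ((d j + n * p j) * (d j * φ (pearsonForm n p d)))) := by
    refine trialExp_congr H.nonneg fun d hd => ?_
    have hd0 : ∑ j, d j = 0 := by rw [hd, H.sum_mean, hn]; simp
    have : ∀ j, (n * p j)⁻¹ * ((d j + n * p j) * (d j * φ (pearsonForm n p d))) =
        d j ^ 2 / (n * p j) * φ (pearsonForm n p d) + d j * φ (pearsonForm n p d) := by
      intro j
      have h0 := (H.mean_pos j).ne'
      generalize (n : ℝ) * p j = l at h0
      field_simp
    simp only [this, Finset.sum_add_distrib, ← Finset.sum_mul, hd0, zero_mul, add_zero]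
    rfl
  rw [h1, trialExp_sum, trialExp_sum]
  refine Finset.sum_congr rfl fun j _ => ?_
  rw [trialExp_const_mul, trialExp_count_mul j (fun d => d j * φ (pearsonForm n p d)), ← mul_assoc]
  have hn' : (n : ℝ) = L + 1 := by rw [hn]; push_cast; rfl
  rw [← hn', inv_mul_cancel₀ (H.mean_pos j).ne', one_mul]
  simp only [form_add, Pi.add_apply, unitVec_apply, if_true]

omit H in
lemma exp_form_succ {L : ℕ} (F : ℝ → ℝ) :
    trialExp p (fun j => n * p j) (L + 1) (fun d => F (pearsonForm n p d)) =
    trialExp p (fun j => n * p j) L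
      (fun d => ∑ k, p k * F (pearsonForm n p d + pearsonIncr n p d k)) := by
  rw [trialExp_succ, trialExp_sum]
  simp only [trialExp_const_mul, form_add]

/-- The Stein operator evaluated at Pearson's statistic, as an expectation over one trial less. -/
lemma exp_stein {L : ℕ} (hn : n = L + 1) (φ0 φ1 : ℝ → ℝ) :
    trialExp p (fun j => n * p j) (L + 1) (fun d => pearsonForm n p d * φ1 (pearsonForm n p d)
      + ((m : ℝ) - 1 - pearsonForm n p d) / 2 * φ0 (pearsonForm n p d)) =
    trialExp p (fun j => n * p j) L (fun d =>
      ∑ k, p k * ((pearsonForm n p d + pearsonIncr n p d k)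
        * φ1 (pearsonForm n p d + pearsonIncr n p d k))
      + ((m : ℝ) - 1) / 2 * ∑ k, p k * φ0 (pearsonForm n p d + pearsonIncr n p d k)
      - 1 / 2 * ∑ j, (d j + 1) * φ0 (pearsonForm n p d + pearsonIncr n p d j)) := by
  have e : (fun d => pearsonForm n p d * φ1 (pearsonForm n p d)
      + ((m : ℝ) - 1 - pearsonForm n p d) / 2 * φ0 (pearsonForm n p d)) = fun d =>
      pearsonForm n p d * φ1 (pearsonForm n p d) + ((m : ℝ) - 1) / 2 * φ0 (pearsonForm n p d)
        - 1 / 2 * (pearsonForm n p d * φ0 (pearsonForm n p d)) := by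
    funext d; ring
  rw [e, trialExp_sub, trialExp_add, trialExp_const_mul, trialExp_const_mul, H.exp_form_mul hn φ0,
    exp_form_succ (fun x => x * φ1 x), exp_form_succ, trialExp_sub, trialExp_add,
    trialExp_const_mul, trialExp_const_mul]

/-- Error of order `ρ` in the Stein identity for Pearson's statistic. -/
lemma abs_exp_stein_le {L : ℕ} (hn : n = L + 1) {φ0 φ1 φ2 : ℝ → ℝ} {K M2 M3 : ℝ}
    (hd0 : ∀ x, 0 ≤ x → HasDerivAt φ0 (φ1 x) x) (hd1 : ∀ x, 0 ≤ x → HasDerivAt φ1 (φ2 x) x)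
    (hM2 : ∀ x, 0 ≤ x → |φ1 x| ≤ M2) (hM3 : ∀ x, 0 ≤ x → |φ2 x| ≤ M3)
    (hK : ∀ x, 0 ≤ x → |φ1 x + x * φ2 x| ≤ K) :
    |trialExp p (fun j => n * p j) (L + 1) (fun d => pearsonForm n p d * φ1 (pearsonForm n p d)
      + ((m : ℝ) - 1 - pearsonForm n p d) / 2 * φ0 (pearsonForm n p d))| ≤
      ρ * (3 * K + 2 * (m * M2) + 3 * (m * M3)) := by
  have hn' : (n : ℝ) = L + 1 := by rw [hn]; push_cast; rfl
  have hM20 : 0 ≤ M2 := (abs_nonneg _).trans (hM2 0 le_rfl)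
  have hM30 : 0 ≤ M3 := (abs_nonneg _).trans (hM3 0 le_rfl)
  have hK0 : 0 ≤ K := (abs_nonneg _).trans (hK 0 le_rfl)
  have hm := H.two_le_cast
  have hρ := H.rho_pos
  rw [H.exp_stein hn]
  have hpt : ∀ d : Fin m → ℝ, ∑ j, d j = L - ∑ j, (n : ℝ) * p j →
      |∑ k, p k * ((pearsonForm n p d + pearsonIncr n p d k)
        * φ1 (pearsonForm n p d + pearsonIncr n p d k))
      + ((m : ℝ) - 1) / 2 * ∑ k, p k * φ0 (pearsonForm n p d + pearsonIncr n p d k)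
      - 1 / 2 * ∑ j, (d j + 1) * φ0 (pearsonForm n p d + pearsonIncr n p d j)| ≤
      ∑ k, p k * (K * (ρ * (2 * absStd n p d k + ρ))
          + m * M3 / 4 * (ρ ^ 2 * (2 * absStd n p d k + ρ) ^ 2))
        + ∑ j, (M2 / 2 * (ρ * (3 * absStd n p d j + ρ))
          + M3 / 4 * (ρ * ((absStd n p d j + ρ) * (2 * absStd n p d j + ρ) ^ 2)))
        + M2 / 2 * (m * ρ ^ 2) := by
    intro d hd
    -- One trial has been removed while the centring is still at n p_j.
    have hd1' : ∑ j, d j = -1 := by rw [hd, H.sum_mean, hn']; ring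
    obtain ⟨w, hw⟩ : ∃ w, w = pearsonForm n p d := ⟨_, rfl⟩
    obtain ⟨a, ha⟩ : ∃ a, a = pearsonIncr n p d := ⟨_, rfl⟩
    obtain ⟨t, ht⟩ : ∃ t, t = absStd n p d := ⟨_, rfl⟩
    have hw0 : 0 ≤ w := hw ▸ H.form_nonneg d
    have hwa : ∀ k, 0 ≤ w + a k := fun k => by rw [hw, ha]; exact H.form_add_nonneg d k
    have ht0 : ∀ k, 0 ≤ t k := fun k => ht ▸ absStd_nonneg d k
    rw [← hw, ← ha, ← ht]
    have hab : ∀ k, |a k| ≤ ρ * (2 * t k + ρ) := fun k => by rw [ha, ht]; exact H.abs_incr_le d k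
    have hasq : ∀ k, a k ^ 2 ≤ ρ ^ 2 * (2 * t k + ρ) ^ 2 := fun k => by
      rw [ha, ht]; exact H.incr_sq_le d k
    have hS1 : ∑ k, (d k + 1) = (m : ℝ) - 1 := by
      rw [Finset.sum_add_distrib, hd1']; simp; ring
    have hS2 : ∑ k, p k * a k = ((m : ℝ) - 2) / n := by
      rw [ha, H.sum_prob_mul_incr, hd1']; ring
    have hS3 : ∑ j, (d j + 1) * a j = 2 * w + ∑ j, (3 * d j + 1) / (n * p j) := by
      rw [ha, hw]; exact H.sum_add_one_mul_incr d
    set q : Fin m → ℝ := fun k => (w + a k) * φ1 (w + a k) - w * φ1 w with hq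
    set r : Fin m → ℝ := fun k => φ0 (w + a k) - φ0 w - a k * φ1 w with hr
    have hqb : ∀ k, |q k| ≤ K * |a k| := fun k =>
      abs_sub_le_of_deriv (g := fun x => x * φ1 x) (g1 := fun x => φ1 x + x * φ2 x)
        (fun x hx => ((hasDerivAt_id x).mul (hd1 x hx)).congr_deriv (by simp)) hK hw0 (hwa k)
    have hrb : ∀ k, |r k| ≤ M3 * a k ^ 2 / 2 := fun k => abs_taylor_two hd0 hd1 hM3 hw0 (hwa k)
    have e1 : ∑ k, p k * ((w + a k) * φ1 (w + a k)) = w * φ1 w + ∑ k, p k * q k := by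
      simp only [hq, mul_sub, Finset.sum_sub_distrib, ← Finset.sum_mul, H.sum_eq]; ring
    have e2 : ∑ k, p k * φ0 (w + a k) =
        φ0 w + ((m : ℝ) - 2) / n * φ1 w + ∑ k, p k * r k := by
      have : ∀ k, p k * r k = p k * φ0 (w + a k) - p k * φ0 w - p k * a k * φ1 w := fun k => by
        simp only [hr]; ring
      simp only [this, Finset.sum_sub_distrib, ← Finset.sum_mul, H.sum_eq, hS2]; ring
    have e3 : ∑ j, (d j + 1) * φ0 (w + a j) = ((m : ℝ) - 1) * φ0 w
        + (2 * w + ∑ j, (3 * d j + 1) / (n * p j)) * φ1 w + ∑ j, (d j + 1) * r j := by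
      have : ∀ j, (d j + 1) * r j =
          (d j + 1) * φ0 (w + a j) - (d j + 1) * φ0 w - (d j + 1) * a j * φ1 w := fun j => by
        simp only [hr]; ring
      simp only [this, Finset.sum_sub_distrib, ← Finset.sum_mul, hS1, hS3]; ring
    -- Both (m - 1) φ0(w) / 2 and w φ1(w) have cancelled; only Taylor remainders, the linear terms
    -- (3 d_j + 1) / (n p_j) and a term of size m / n times m are left.
    have e4 : ∑ k, p k * ((w + a k) * φ1 (w + a k))
        + ((m : ℝ) - 1) / 2 * ∑ k, p k * φ0 (w + a k)
        - 1 / 2 * ∑ j, (d j + 1) * φ0 (w + a j) =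
        ∑ k, p k * (q k + ((m : ℝ) - 1) / 2 * r k)
        + ∑ j, (-(1 / 2) * ((3 * d j + 1) / (n * p j) * φ1 w) + -(1 / 2) * ((d j + 1) * r j))
        + ((m : ℝ) - 1) / 2 * (((m : ℝ) - 2) / n) * φ1 w := by
      rw [e1, e2, e3]
      simp only [mul_add, Finset.sum_add_distrib, ← Finset.mul_sum, ← Finset.sum_mul]
      simp only [mul_left_comm (p _) (((m : ℝ) - 1) / 2), ← Finset.mul_sum]
      ring
    rw [e4]
    refine (abs_add_le _ _).trans (add_le_add ((abs_add_le _ _).trans (add_le_add ?_ ?_)) ?_)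
    · refine (Finset.abs_sum_le_sum_abs _ _).trans (Finset.sum_le_sum fun k _ => ?_)
      rw [abs_mul, abs_of_pos (H.pos k)]
      refine mul_le_mul_of_nonneg_left ?_ (H.nonneg k)
      refine (abs_add_le _ _).trans (add_le_add ?_ ?_)
      · exact (hqb k).trans (mul_le_mul_of_nonneg_left (hab k) hK0)
      · rw [abs_mul, abs_of_nonneg (by linarith : (0 : ℝ) ≤ ((m : ℝ) - 1) / 2)]
        calc ((m : ℝ) - 1) / 2 * |r k| ≤ m / 2 * (M3 * (ρ ^ 2 * (2 * t k + ρ) ^ 2) / 2) := by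
              refine mul_le_mul (by linarith) ((hrb k).trans ?_) (abs_nonneg _) (by linarith)
              gcongr
              exact hasq k
          _ = _ := by ring
    · refine (Finset.abs_sum_le_sum_abs _ _).trans (Finset.sum_le_sum fun j _ => ?_)
      refine (abs_add_le _ _).trans (add_le_add ?_ ?_)
      · rw [abs_mul, abs_mul, abs_neg, abs_of_pos (by norm_num : (0 : ℝ) < 1 / 2)]
        have h1 : |(3 * d j + 1) / (n * p j)| ≤ ρ * (3 * t j + ρ) := by
          rw [abs_div, abs_of_pos (H.mean_pos j), div_le_iff₀ (H.mean_pos j)]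
          refine (abs_add_le _ _).trans ?_
          rw [abs_one, abs_mul, abs_of_pos (by norm_num : (0 : ℝ) < 3), H.abs_eq, ← ht]
          have h2 := H.one_le_sqrt j
          have h3 := H.one_le j
          have h4 := H.sq_sqrt_mean j
          have h5 : √(n * p j) ≤ ρ * (n * p j) := by
            have := le_mul_of_one_le_left (Real.sqrt_nonneg (n * p j)) h2
            rwa [mul_assoc, h4] at this
          have h6 := mul_le_mul_of_nonneg_left h5 (ht0 j)
          linarith
        have h2 := mul_le_mul h1 (hM2 w hw0) (abs_nonneg _) (by have := ht0 j; positivity)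
        linarith
      · rw [abs_mul, abs_mul, abs_neg, abs_of_pos (by norm_num : (0 : ℝ) < 1 / 2)]
        have h1 : |d j + 1| * |a j| ≤ (t j + ρ) * (2 * t j + ρ) := by
          rw [ha, ht]; exact H.abs_add_one_mul_incr_le d j
        have h2 : |d j + 1| * |a j| * |a j| ≤
            (t j + ρ) * (2 * t j + ρ) * (ρ * (2 * t j + ρ)) :=
          mul_le_mul h1 (hab j) (abs_nonneg _) (by have := ht0 j; positivity)
        calc 1 / 2 * (|d j + 1| * |r j|) ≤ 1 / 2 * (|d j + 1| * (M3 * a j ^ 2 / 2)) := by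
              gcongr; exact hrb j
          _ = M3 / 4 * (|d j + 1| * |a j| * |a j|) := by rw [← sq_abs]; ring
          _ ≤ M3 / 4 * ((t j + ρ) * (2 * t j + ρ) * (ρ * (2 * t j + ρ))) := by gcongr
          _ = _ := by ring
    · rw [abs_mul, abs_of_nonneg]
      · have h1 : ((m : ℝ) - 1) / 2 * (((m : ℝ) - 2) / n) ≤ m / 2 * ρ ^ 2 := by
          have h2 : ((m : ℝ) - 2) / n ≤ ρ ^ 2 := by
            refine le_trans ?_ H.card_div_le
            have := H.n_pos
            gcongr
            linarith
          have h3 : 0 ≤ ((m : ℝ) - 2) / n := div_nonneg (by linarith) H.n_pos.le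
          exact mul_le_mul (by linarith) h2 h3 (by linarith)
        calc _ ≤ m / 2 * ρ ^ 2 * M2 :=
              mul_le_mul h1 (hM2 w hw0) (abs_nonneg _) (by positivity)
          _ = _ := by ring
      · exact mul_nonneg (by linarith) (div_nonneg (by linarith) H.n_pos.le)
  refine (abs_trialExp_le H.nonneg hpt).trans ?_
  have hL : (L : ℝ) ≤ n - 1 := by rw [hn']; linarith
  have hL' : (n : ℝ) - 2 ≤ L := by rw [hn']; linarith
  rw [trialExp_add, trialExp_add, trialExp_const H.sum_eq]
  have b1 := H.exp_average_le (L := L) (fun k d => K * (ρ * (2 * absStd n p d k + ρ))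
          + m * M3 / 4 * (ρ ^ 2 * (2 * absStd n p d k + ρ) ^ 2))
          (K * (ρ * (2 + ρ)) + m * M3 / 4 * (ρ ^ 2 * (4 + 4 * ρ + ρ ^ 2))) (fun k => by
    have := H.exp_poly_le hL hL' k (K * ρ * ρ + m * M3 / 4 * ρ ^ 4)
      (2 * K * ρ + m * M3 * ρ ^ 3) (m * M3 * ρ ^ 2) 0 0 (by positivity) (by positivity) le_rfl
      le_rfl
    refine le_trans (le_of_eq (congrArg _ (funext fun d => ?_))) (this.trans (le_of_eq ?_)) <;>
    ring)
  have b2 := exp_sum_le (n := n) (p := p) (L := L) (fun j d => M2 / 2 * (ρ * (3 * absStd n p d j + ρ))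
          + M3 / 4 * (ρ * ((absStd n p d j + ρ) * (2 * absStd n p d j + ρ) ^ 2)))
          (M2 / 2 * (ρ * (3 + ρ)) + M3 / 4 * (ρ * (8 + 8 * ρ + 5 * ρ ^ 2 + ρ ^ 3))) (fun k => by
    have := H.exp_poly_le hL hL' k (M2 / 2 * ρ * ρ + M3 / 4 * ρ ^ 4)
      (3 / 2 * M2 * ρ + 5 / 4 * M3 * ρ ^ 3) (2 * M3 * ρ ^ 2) (M3 * ρ) 0 (by positivity)
      (by positivity) (by positivity) le_rfl
    refine le_trans (le_of_eq (congrArg _ (funext fun d => ?_))) (this.trans (le_of_eq ?_)) <;>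
    ring)
  refine (add_le_add (add_le_add b1 b2) le_rfl).trans ?_
  have hρ1 := H.rho_le
  have hρ2 := H.rho_sq_le
  have hρ3 : ρ ^ 3 ≤ 1 / 512 := by
    have := pow_le_pow_left₀ hρ.le H.rho_le 3; linarith
  -- Higher powers of ρ are absorbed by ρ ≤ 1/8, with totals 29/16 ≤ 2 for M2 and 11/4 ≤ 3 for M3.
  have g1 : K * (ρ * (2 + ρ)) ≤ K * (ρ * 3) := by gcongr; linarith
  have g2 : ρ ^ 2 * (4 + 4 * ρ + ρ ^ 2) ≤ ρ * (1 / 8 * 8) := by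
    rw [sq, mul_assoc]; gcongr; linarith
  have g2' := mul_le_mul_of_nonneg_left g2 (by positivity : 0 ≤ m * M3 / 4)
  have g3 : m * (M2 / 2 * (ρ * (3 + ρ))) ≤ m * (M2 / 2 * (ρ * (7 / 2))) := by gcongr; linarith
  have g4 : m * (M3 / 4 * (ρ * (8 + 8 * ρ + 5 * ρ ^ 2 + ρ ^ 3))) ≤
      m * (M3 / 4 * (ρ * 10)) := by gcongr; linarith
  have g5 : M2 / 2 * (m * ρ ^ 2) ≤ M2 / 2 * (m * (ρ * (1 / 8))) := by
    rw [sq]; gcongr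
  have g6 : 0 ≤ ρ * (m * M2) := by positivity
  have g7 : 0 ≤ ρ * (m * M3) := by positivity
  linarith

end IsCells

/-! ### Odd first-order terms, through the equation G - 2 G' = g. -/

/-- The bounded solution of `G - 2 G' = g`. -/
lemma exists_sub_two_mul_deriv_eq {c : ℝ} (hc : c < 0) {g g1 : ℝ → ℝ} {b0 b1 : ℝ}
    (hd : ∀ x, c < x → HasDerivAt g (g1 x) x) (hb0 : ∀ x, c < x → |g x| ≤ b0)
    (hb1 : ∀ x, c < x → |g1 x| ≤ b1) :
    ∃ G G1 G2 : ℝ → ℝ, (∀ x, c < x → HasDerivAt G (G1 x) x) ∧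
      (∀ x, c < x → HasDerivAt G1 (G2 x) x) ∧ (∀ x, c < x → G x - 2 * G1 x = g x) ∧
      (∀ x, c < x → |G x| ≤ b0) ∧ (∀ x, c < x → |G1 x| ≤ b0) ∧
      (∀ x, c < x → |G2 x| ≤ (b0 + b1) / 2) := by
  -- The solution is G(x) = ∫_x^∞ exp((x - t) / 2) g(t) / 2 dt. The kernel has mass one, which
  -- explains why G inherits the bound b0.
  set f : ℝ → ℝ := fun t => Real.exp (-(1 / 2) * t) * (g t / 2) with hf
  have hgc : ContinuousOn g (Ioi c) := fun x hx => (hd x hx).continuousAt.continuousWithinAt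
  have hfc : ContinuousOn f (Ioi c) :=
    (by fun_prop : Continuous fun t : ℝ => Real.exp (-(1 / 2) * t)).continuousOn.mul
      (hgc.div_const 2)
  have hfi : IntegrableOn f (Ioi 0) := by
    have h1 := integrableOn_exp_mul_Ioi (a := -(1 / 2)) (by norm_num) 0
    refine Integrable.mono' (h1.mul_const (b0 / 2))
      ((hfc.mono (Ioi_subset_Ioi hc.le)).aestronglyMeasurable measurableSet_Ioi) ?_
    filter_upwards [ae_restrict_mem measurableSet_Ioi] with x hx
    rw [Real.norm_eq_abs, hf, abs_mul, Real.abs_exp, abs_div, abs_two]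
    gcongr
    exact hb0 x (hc.trans hx)
  set I := ∫ t in Ioi 0, f t
  set F : ℝ → ℝ := fun x => I - ∫ t in (0 : ℝ)..x, f t with hF
  have hFd : ∀ x, c < x → HasDerivAt F (-f x) x := fun x hx => by
    refine HasDerivAt.const_sub _ (intervalIntegral.integral_hasDerivAt_right ?_
      (hfc.stronglyMeasurableAtFilter isOpen_Ioi x hx) (hfc.continuousAt (isOpen_Ioi.mem_nhds hx)))
    refine (hfc.mono fun y hy => ?_).intervalIntegrable
    exact (lt_min hc hx).trans_le hy.1
  have hFlim : Tendsto F atTop (𝓝 0) := by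
    have := (intervalIntegral_tendsto_integral_Ioi 0 hfi tendsto_id).const_sub I
    have h : I - ∫ t in Ioi 0, f t = 0 := sub_self I
    rwa [h] at this
  have hexp : ∀ x : ℝ, HasDerivAt (fun x : ℝ => Real.exp (1 / 2 * x))
      (Real.exp (1 / 2 * x) * (1 / 2)) x := fun x => by
    simpa using ((hasDerivAt_id x).const_mul (1 / 2 : ℝ)).exp
  have hexp' : ∀ x : ℝ, HasDerivAt (fun x : ℝ => Real.exp (-(1 / 2) * x))
      (Real.exp (-(1 / 2) * x) * (-(1 / 2))) x := fun x => by
    simpa using ((hasDerivAt_id x).const_mul (-(1 / 2) : ℝ)).exp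
  have hmul : ∀ x : ℝ, Real.exp (1 / 2 * x) * Real.exp (-(1 / 2) * x) = 1 := fun x => by
    rw [← Real.exp_add]; simp
  set G : ℝ → ℝ := fun x => Real.exp (1 / 2 * x) * F x with hG
  have hGd : ∀ x, c < x → HasDerivAt G ((G x - g x) / 2) x := fun x hx => by
    refine ((hexp x).mul (hFd x hx)).congr_deriv ?_
    have := hmul x
    simp only [hf, hG]
    linear_combination (-(g x / 2)) * this
  have hEF : ∀ x, Real.exp (-(1 / 2) * x) * G x = F x := fun x => by
    simp only [hG]; rw [← mul_assoc, mul_comm (Real.exp _) (Real.exp _), hmul, one_mul]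
  have hlim0 : Tendsto (fun x : ℝ => Real.exp (-(1 / 2) * x)) atTop (𝓝 0) := by
    refine Real.tendsto_exp_atBot.comp ?_
    exact tendsto_id.const_mul_atTop_of_neg (by norm_num)
  -- The bound is proved for both signs at once: the difference of σ F and exp(-x / 2) b0 increases
  -- to 0 at infinity.
  have hbd : ∀ σ : ℝ, (σ = 1 ∨ σ = -1) → ∀ x, c < x → σ * G x ≤ b0 := by
    intro σ hσ x hx
    have h := nonpos_of_deriv_nonneg_of_tendsto_zero (a := x)
      (y := fun x => σ * F x - Real.exp (-(1 / 2) * x) * b0)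
      (y' := fun x => σ * -f x - Real.exp (-(1 / 2) * x) * (-(1 / 2)) * b0)
      (fun y hy => ((hFd y (hx.trans_le hy)).const_mul σ).sub ((hexp' y).mul_const b0))
      (fun y hy => by
        have h1 : σ * g y ≤ b0 := by
          have := abs_le.1 (hb0 y (hx.trans_le hy))
          rcases hσ with rfl | rfl <;> linarith
        have h2 := Real.exp_pos (-(1 / 2) * y)
        simp only [hf]
        nlinarith)
      (by simpa using (hFlim.const_mul σ).sub (hlim0.mul_const b0))
    have h2 := Real.exp_pos (-(1 / 2) * x)
    have h3 : Real.exp (-(1 / 2) * x) * (σ * G x - b0) ≤ 0 := by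
      have := hEF x
      have h' : σ * F x - Real.exp (-(1 / 2) * x) * b0 ≤ 0 := h
      rw [← this] at h'
      linarith
    by_contra! hcon
    nlinarith
  have hGb : ∀ x, c < x → |G x| ≤ b0 := fun x hx => abs_le'.2
    ⟨by simpa using hbd 1 (Or.inl rfl) x hx, by simpa using hbd (-1) (Or.inr rfl) x hx⟩
  have hG1b : ∀ x, c < x → |(G x - g x) / 2| ≤ b0 := fun x hx => by
    rw [abs_div, abs_two]
    linarith [abs_sub (G x) (g x), hGb x hx, hb0 x hx]
  refine ⟨G, fun x => (G x - g x) / 2, fun x => ((G x - g x) / 2 - g1 x) / 2, hGd,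
    fun x hx => ((hGd x hx).sub (hd x hx)).div_const 2, fun x _ => by ring, hGb, hG1b,
    fun x hx => ?_⟩
  rw [abs_div, abs_two]
  linarith [abs_sub ((G x - g x) / 2) (g1 x), hG1b x hx, hb1 x hx]

namespace IsCells

variable {m n : ℕ} {p : Fin m → ℝ} {ρ : ℝ} (H : IsCells n p ρ)
include H

omit H in
-- A discrete integration by parts: write d_j = U_j - n p_j and apply the size-bias identity to U_j.
-- With n - 1 trials that identity has the factor (n - 1) p_j instead of n p_j, whence the last
-- term.
lemma exp_coord_mul {L : ℕ} (hn : n = L + 2) (j : Fin m) (F : (Fin m → ℝ) → ℝ) :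
    trialExp p (fun j => n * p j) (L + 1) (fun d => d j * F d) =
    trialExp p (fun j => n * p j) L (fun d => n * p j *
      (F (d + unitVec j) - ∑ k, p k * F (d + unitVec k)) - p j * F (d + unitVec j)) := by
  have h1 : (fun d : Fin m → ℝ => d j * F d) =
      fun d => (d j + n * p j) * F d - n * p j * F d := by funext d; ring
  rw [h1, trialExp_sub, trialExp_count_mul j F, trialExp_const_mul, trialExp_sub,
    trialExp_const_mul, trialExp_const_mul, trialExp_sub, trialExp_sum, trialExp_succ]
  simp only [trialExp_const_mul]
  rw [hn]
  push_cast
  ring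

omit H in
lemma exp_succ_eq {L : ℕ} (F : (Fin m → ℝ) → ℝ) :
    trialExp p (fun j => n * p j) (L + 1) F =
    trialExp p (fun j => n * p j) L (fun d => ∑ k, p k * F (d + unitVec k)) := by
  rw [trialExp_succ, trialExp_sum]
  simp only [trialExp_const_mul]

/-- With two trials removed the centred counts sum to -2, so the average is (m - 4) / n, and |m - 4|
≤ m because m ≥ 2. -/
lemma abs_sum_prob_mul_incr_le {L : ℕ} (hn : n = L + 2) {d : Fin m → ℝ}
    (hd : ∑ j, d j = L - ∑ j, (n : ℝ) * p j) :
    |∑ k, p k * pearsonIncr n p d k| ≤ ρ ^ 2 := by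
  have h1 : ∑ j, d j = -2 := by rw [hd, H.sum_mean, hn]; push_cast; ring
  rw [H.sum_prob_mul_incr, h1, abs_div, abs_of_pos H.n_pos]
  refine le_trans ?_ H.card_div_le
  have := H.n_pos
  have := H.two_le_cast
  gcongr
  rw [abs_le]; constructor <;> linarith

lemma abs_mul_incr_le (d : Fin m → ℝ) (j k : Fin m) :
    |d j| * |pearsonIncr n p d k| ≤
      n * p j * ρ ^ 2 * (absStd n p d j * (2 * absStd n p d k + ρ)) := by
  have h1 := H.one_le_sqrt j
  have h2 := H.sq_sqrt_mean j
  have h3 := H.rho_pos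
  have ht := absStd_nonneg (n := n) (p := p) d
  have h4 : √(n * p j) * ρ ≤ n * p j * ρ ^ 2 := by
    have := le_mul_of_one_le_left (mul_nonneg (Real.sqrt_nonneg (n * p j)) h3.le) h1
    calc _ ≤ _ := this
      _ = (√(n * p j) * √(n * p j)) * ρ ^ 2 := by ring
      _ = _ := by rw [h2]
  have htj := ht j
  have htk := ht k
  calc |d j| * |pearsonIncr n p d k|
      ≤ absStd n p d j * √(n * p j) * (ρ * (2 * absStd n p d k + ρ)) := by
        rw [H.abs_eq d j]; gcongr; exact H.abs_incr_le d k
    _ = (√(n * p j) * ρ) * (absStd n p d j * (2 * absStd n p d k + ρ)) := by ring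
    _ ≤ _ := by gcongr

omit H in
lemma sum_prob_mul_ite (j : Fin m) (F : Fin m → ℝ) (x : ℝ) :
    ∑ k, p k * ((x + if j = k then 1 else 0) * F k) = x * (∑ k, p k * F k) + p j * F j := by
  have : ∀ k, p k * ((x + if j = k then 1 else 0) * F k) =
      x * (p k * F k) + if j = k then p k * F k else 0 := fun k => by
    split_ifs <;> ring
  simp only [this, Finset.sum_add_distrib, ← Finset.mul_sum, Finset.sum_ite_eq, Finset.mem_univ,
    if_true]

/-- Weighted averages of quantities bounded cellwise. -/
lemma abs_sum_prob_mul_le {f g : Fin m → ℝ} (h : ∀ k, |f k| ≤ g k) :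
    |∑ k, p k * f k| ≤ ∑ k, p k * g k := by
  refine (Finset.abs_sum_le_sum_abs _ _).trans (Finset.sum_le_sum fun k _ => ?_)
  rw [abs_mul, abs_of_pos (H.pos k)]
  exact mul_le_mul_of_nonneg_left (h k) (H.nonneg k)

/-- Removing one trial in the expectation of an odd first-order term. -/
lemma abs_exp_coord_level {L : ℕ} (hn : n = L + 2) (j : Fin m) {G G1 : ℝ → ℝ} {b0 b1 : ℝ}
    (hd : ∀ x, 0 ≤ x → HasDerivAt G (G1 x) x) (hb0 : ∀ x, 0 ≤ x → |G x| ≤ b0)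
    (hb1 : ∀ x, 0 ≤ x → |G1 x| ≤ b1) :
    |trialExp p (fun j => n * p j) (L + 1) (fun d => d j * G (pearsonForm n p d)) -
      trialExp p (fun j => n * p j) L (fun d => d j * G (pearsonForm n p d))| ≤
      n * p j * ρ ^ 2 * (b0 / 2 + 9 / 4 * b1) := by
  have hn' : (n : ℝ) = L + 2 := by rw [hn]; push_cast; rfl
  have hb00 : 0 ≤ b0 := (abs_nonneg _).trans (hb0 0 le_rfl)
  have hb10 : 0 ≤ b1 := (abs_nonneg _).trans (hb1 0 le_rfl)
  have hρ := H.rho_pos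
  have hρ1 := H.rho_le
  have hl := H.mean_pos j
  rw [exp_succ_eq, ← trialExp_sub]
  have hpt : ∀ d : Fin m → ℝ, ∑ j, d j = L - ∑ j, (n : ℝ) * p j →
      |∑ k, p k * ((d + unitVec k) j * G (pearsonForm n p (d + unitVec k)))
        - d j * G (pearsonForm n p d)| ≤
      ∑ k, p k * (n * p j * ρ ^ 2 * b1 * (absStd n p d j * (2 * absStd n p d k + ρ)))
        + n * p j * ρ ^ 2 * b0 / 2 := by
    intro d _
    simp only [form_add, Pi.add_apply, unitVec_apply]
    have hw0 := H.form_nonneg d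
    have hwa := H.form_add_nonneg d
    set w := pearsonForm n p d
    have e : ∑ k, p k * ((d j + if j = k then 1 else 0) * G (w + pearsonIncr n p d k))
        - d j * G w = ∑ k, p k * (d j * (G (w + pearsonIncr n p d k) - G w))
        + p j * G (w + pearsonIncr n p d j) := by
      rw [sum_prob_mul_ite j (fun k => G (w + pearsonIncr n p d k))]
      have : ∀ k, p k * (d j * (G (w + pearsonIncr n p d k) - G w)) =
          d j * (p k * G (w + pearsonIncr n p d k)) - p k * (d j * G w) := fun k => by ring
      simp only [this, Finset.sum_sub_distrib, ← Finset.mul_sum, ← Finset.sum_mul, H.sum_eq]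
      ring
    rw [e]
    refine (abs_add_le _ _).trans (add_le_add (H.abs_sum_prob_mul_le fun k => ?_) ?_)
    · rw [abs_mul]
      calc _ ≤ |d j| * (b1 * |pearsonIncr n p d k|) := by
            gcongr; exact abs_sub_le_of_deriv hd hb1 hw0 (hwa k)
        _ = b1 * (|d j| * |pearsonIncr n p d k|) := by ring
        _ ≤ _ := by
          refine (mul_le_mul_of_nonneg_left (H.abs_mul_incr_le d j k) hb10).trans (le_of_eq ?_)
          ring
    · rw [abs_mul, abs_of_pos (H.pos j)]
      calc _ ≤ (n * p j * ρ ^ 2 / 2) * b0 :=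
            mul_le_mul (H.prob_le j) (hb0 _ (hwa j)) (abs_nonneg _) (by positivity)
        _ = _ := by ring
  refine (abs_trialExp_le H.nonneg hpt).trans ?_
  have hL : (L : ℝ) ≤ n - 1 := by rw [hn']; linarith
  have hL' : (n : ℝ) - 2 ≤ L := by rw [hn']; linarith
  rw [trialExp_add, trialExp_const H.sum_eq]
  have b := H.exp_average_le (L := L) (fun k d => n * p j * ρ ^ 2 * b1 *
    (absStd n p d j * (2 * absStd n p d k + ρ))) (n * p j * ρ ^ 2 * b1 * (9 / 4)) (fun k => by
      have e : (fun d => n * p j * ρ ^ 2 * b1 * (absStd n p d j * (2 * absStd n p d k + ρ))) =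
        fun d => n * p j * ρ ^ 2 * b1 * (2 * (absStd n p d j * absStd n p d k)
          + ρ * absStd n p d j) := by funext d; ring
      rw [e, trialExp_const_mul, trialExp_add, trialExp_const_mul, trialExp_const_mul]
      have := H.exp_mul_le hL hL' j k
      have := H.exp_absStd_le hL hL' j
      gcongr
      nlinarith)
  linarith

/-- Odd first-order terms are negligible. -/
lemma abs_exp_coord_mul_le {L : ℕ} (hn : n = L + 2) (j : Fin m) {c : ℝ} (hc : c < 0)
    {g g1 : ℝ → ℝ} {b0 b1 : ℝ}
    (hd : ∀ x, c < x → HasDerivAt g (g1 x) x) (hb0 : ∀ x, c < x → |g x| ≤ b0)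
    (hb1 : ∀ x, c < x → |g1 x| ≤ b1) :
    |trialExp p (fun j => n * p j) (L + 1) (fun d => d j * g (pearsonForm n p d))| ≤
      n * p j * ρ ^ 2 * (9 * b0 + 5 * b1) := by
  obtain ⟨G, G1, G2, hG, hG1, hGg, hGb, hG1b, hG2b⟩ := exists_sub_two_mul_deriv_eq hc hd hb0 hb1
  have h0 : ∀ {x : ℝ}, 0 ≤ x → c < x := fun hx => hc.trans_le hx
  obtain ⟨b2, hb2⟩ : ∃ b2, b2 = (b0 + b1) / 2 := ⟨_, rfl⟩
  rw [← hb2] at hG2b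
  have hn' : (n : ℝ) = L + 2 := by rw [hn]; push_cast; rfl
  have hb00 : 0 ≤ b0 := (abs_nonneg _).trans (hb0 0 hc)
  have hb20 : 0 ≤ b2 := (abs_nonneg _).trans (hG2b 0 hc)
  have hb10 : 0 ≤ b1 := (abs_nonneg _).trans (hb1 0 hc)
  have hρ := H.rho_pos
  have hρ1 := H.rho_le
  have hρ2 := H.rho_sq_le
  have hl := H.mean_pos j
  have hL : (L : ℝ) ≤ n - 1 := by rw [hn']; linarith
  have hL' : (n : ℝ) - 2 ≤ L := by rw [hn']; linarith
  have hlev := H.abs_exp_coord_level hn j (fun x hx => hG1 x (h0 hx)) (fun x hx => hG1b x (h0 hx))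
    (fun x hx => hG2b x (h0 hx))
  have e0 : trialExp p (fun j => n * p j) (L + 1) (fun d => d j * g (pearsonForm n p d)) =
      trialExp p (fun j => n * p j) (L + 1) (fun d => d j * G (pearsonForm n p d)) -
      2 * trialExp p (fun j => n * p j) (L + 1) (fun d => d j * G1 (pearsonForm n p d)) := by
    rw [← trialExp_const_mul, ← trialExp_sub]
    refine congrArg _ (funext fun d => ?_)
    rw [← hGg _ (h0 (H.form_nonneg d))]; ring
  -- Integration by parts replaces d_j G by n p_j times the difference of G(w + a_j) and its
  -- average. To first order this is n p_j a_j G1 = (2 d_j + 1) G1, hence the comparison with twice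
  -- d_j G1; the average increment contributes only order ρ².
  have key : |trialExp p (fun j => n * p j) (L + 1) (fun d => d j * G (pearsonForm n p d)) -
      2 * trialExp p (fun j => n * p j) L (fun d => d j * G1 (pearsonForm n p d))| ≤
      n * p j * ρ ^ 2 * (5 / 2 * b0 + 14 / 3 * b2) := by
    rw [exp_coord_mul hn, ← trialExp_const_mul, ← trialExp_sub]
    have hpt : ∀ d : Fin m → ℝ, ∑ j, d j = L - ∑ j, (n : ℝ) * p j →
        |n * p j * (G (pearsonForm n p (d + unitVec j)) -
          ∑ k, p k * G (pearsonForm n p (d + unitVec k))) - p j * G (pearsonForm n p (d + unitVec j))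
          - 2 * (d j * G1 (pearsonForm n p d))| ≤
        ∑ k, p k * (n * p j * (b2 * (ρ ^ 2 * (2 * absStd n p d k + ρ) ^ 2) / 2))
          + n * p j * (b2 * (ρ ^ 2 * (2 * absStd n p d j + ρ) ^ 2) / 2)
          + n * p j * ρ ^ 2 * (5 / 2 * b0) := by
      intro d hd
      simp only [form_add]
      have hw0 := H.form_nonneg d
      have hwa := H.form_add_nonneg d
      have hsum := H.abs_sum_prob_mul_incr_le hn hd
      have hsq := H.incr_sq_le d
      have ha : n * p j * pearsonIncr n p d j = 2 * d j + 1 := by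
        unfold pearsonIncr; rw [mul_div_cancel₀ _ hl.ne']
      set w := pearsonForm n p d
      set a := pearsonIncr n p d
      set r : Fin m → ℝ := fun k => G (w + a k) - G w - a k * G1 w with hr
      have hrb : ∀ k, |r k| ≤ b2 * (ρ ^ 2 * (2 * absStd n p d k + ρ) ^ 2) / 2 := fun k => by
        have := abs_taylor_two (fun x hx => hG x (h0 hx)) (fun x hx => hG1 x (h0 hx))
          (fun x hx => hG2b x (h0 hx)) hw0 (hwa k)
        refine this.trans ?_
        have := hsq k
        gcongr
      have e1 : ∑ k, p k * G (w + a k) = G w + (∑ k, p k * a k) * G1 w + ∑ k, p k * r k := by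
        have : ∀ k, p k * r k = p k * G (w + a k) - p k * G w - p k * a k * G1 w := fun k => by
          simp only [hr]; ring
        simp only [this, Finset.sum_sub_distrib, ← Finset.sum_mul, H.sum_eq]; ring
      have e2 : n * p j * (G (w + a j) - ∑ k, p k * G (w + a k)) - p j * G (w + a j)
          - 2 * (d j * G1 w) = -(∑ k, p k * (n * p j * r k)) + n * p j * r j
          + (G1 w - n * p j * ((∑ k, p k * a k) * G1 w) - p j * G (w + a j)) := by
        have : ∑ k, p k * (n * p j * r k) = n * p j * ∑ k, p k * r k := by
          rw [Finset.mul_sum]; exact Finset.sum_congr rfl fun k _ => by ring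
        rw [this, e1]
        have : G (w + a j) = G w + a j * G1 w + r j := by simp only [hr]; ring
        rw [this]
        linear_combination (G1 w) * ha
      rw [e2]
      refine (abs_add_le _ _).trans (add_le_add ((abs_add_le _ _).trans (add_le_add ?_ ?_)) ?_)
      · rw [abs_neg]
        refine H.abs_sum_prob_mul_le fun k => ?_
        rw [abs_mul, abs_of_pos hl]
        exact mul_le_mul_of_nonneg_left (hrb k) hl.le
      · rw [abs_mul, abs_of_pos hl]
        exact mul_le_mul_of_nonneg_left (hrb j) hl.le
      · have h1 : |G1 w| ≤ n * p j * ρ ^ 2 * b0 := by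
          refine (hG1b w (h0 hw0)).trans (le_mul_of_one_le_left hb00 ?_)
          linarith [H.one_le j]
        have h2 : |n * p j * ((∑ k, p k * a k) * G1 w)| ≤ n * p j * ρ ^ 2 * b0 := by
          rw [abs_mul (n * p j), abs_of_pos hl, abs_mul, mul_assoc (n * p j)]
          exact mul_le_mul_of_nonneg_left (mul_le_mul hsum (hG1b w (h0 hw0)) (abs_nonneg _)
            (by positivity)) hl.le
        have h3 : |p j * G (w + a j)| ≤ n * p j * ρ ^ 2 / 2 * b0 := by
          rw [abs_mul, abs_of_pos (H.pos j)]
          exact mul_le_mul (H.prob_le j) (hGb _ (h0 (hwa j))) (abs_nonneg _) (by positivity)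
        have h4 := abs_sub (G1 w - n * p j * ((∑ k, p k * a k) * G1 w)) (p j * G (w + a j))
        have h5 := abs_sub (G1 w) (n * p j * ((∑ k, p k * a k) * G1 w))
        linarith
    refine (abs_trialExp_le H.nonneg hpt).trans ?_
    rw [trialExp_add, trialExp_add, trialExp_const H.sum_eq]
    have hone : ∀ k, trialExp p (fun j => n * p j) L (fun d =>
        n * p j * (b2 * (ρ ^ 2 * (2 * absStd n p d k + ρ) ^ 2) / 2)) ≤
        n * p j * ρ ^ 2 * b2 * (7 / 3) := fun k => by
      have e : (fun d : Fin m → ℝ => n * p j * (b2 * (ρ ^ 2 * (2 * absStd n p d k + ρ) ^ 2) / 2)) =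
          fun d => n * p j * ρ ^ 2 * b2 * (ρ ^ 2 / 2 + 2 * ρ * absStd n p d k
            + 2 * absStd n p d k ^ 2 + 0 * absStd n p d k ^ 3 + 0 * absStd n p d k ^ 4) := by
        funext d; ring
      rw [e, trialExp_const_mul]
      have := H.exp_poly_le hL hL' k (ρ ^ 2 / 2) (2 * ρ) 2 0 0 (by positivity) (by norm_num) le_rfl
        le_rfl
      gcongr
      linarith
    have b := H.exp_average_le (L := L) (fun k d =>
      n * p j * (b2 * (ρ ^ 2 * (2 * absStd n p d k + ρ) ^ 2) / 2)) _ hone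
    linarith [hone j]
  rw [e0]
  -- Integration by parts lowered the number of trials by one in the G1 term; `hlev` accounts for
  -- that change.
  have tri : ∀ x y z : ℝ, |x - 2 * y| ≤ |x - 2 * z| + 2 * |y - z| := fun x y z => by
    have : x - 2 * y = (x - 2 * z) - 2 * (y - z) := by ring
    rw [this]
    refine (abs_sub _ _).trans ?_
    rw [abs_mul, abs_two]
  refine (tri _ _ _).trans ((add_le_add key (mul_le_mul_of_nonneg_left hlev zero_le_two)).trans ?_)
  have hpos : 0 ≤ n * p j * ρ ^ 2 := by positivity
  have : n * p j * ρ ^ 2 * (5 / 2 * b0 + 14 / 3 * b2) + 2 * (n * p j * ρ ^ 2 * (b0 / 2 + 9 / 4 * b2))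
      = n * p j * ρ ^ 2 * (7 / 2 * b0 + 55 / 6 * b2) := by ring
  rw [this, hb2]
  exact mul_le_mul_of_nonneg_left (by linarith) hpos

end IsCells

/-! ### Odd third-order terms. -/

namespace IsCells

variable {m n : ℕ} {p : Fin m → ℝ} {ρ : ℝ} (H : IsCells n p ρ)
include H

omit H in
lemma sum_prob_mul_add_ite (j : Fin m) (F : Fin m → ℝ) (x y : ℝ) :
    ∑ k, p k * ((x + if j = k then y else 0) * F k) = x * (∑ k, p k * F k) + p j * (y * F j) := by
  have : ∀ k, p k * ((x + if j = k then y else 0) * F k) =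
      x * (p k * F k) + if j = k then p k * (y * F k) else 0 := fun k => by
    split_ifs <;> ring
  simp only [this, Finset.sum_add_distrib, ← Finset.mul_sum, Finset.sum_ite_eq, Finset.mem_univ,
    if_true]

lemma mean_le (j : Fin m) : n * p j ≤ (n * p j) ^ 2 * ρ ^ 2 := by
  have h1 := H.one_le j
  have := H.mean_pos j
  nlinarith

lemma abs_mul_incr_self_le (d : Fin m → ℝ) (j : Fin m) :
    |d j| * |pearsonIncr n p d j| ≤ absStd n p d j * (2 * absStd n p d j + ρ) := by
  rw [H.abs_eq, mul_assoc]
  exact mul_le_mul_of_nonneg_left (H.abs_incr_le' d j) (absStd_nonneg d j)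

lemma add_one_sq_le (d : Fin m → ℝ) (j : Fin m) :
    (d j + 1) ^ 2 ≤ n * p j * (absStd n p d j + ρ) ^ 2 := by
  rw [← sq_abs, ← H.sq_sqrt_mean j, ← sq, ← mul_pow]
  exact pow_le_pow_left₀ (abs_nonneg _) (H.abs_add_one_le d j) 2

lemma abs_cube_diff_le (d : Fin m → ℝ) (j : Fin m) :
    |3 * d j ^ 2 + 3 * d j + 1| ≤
      n * p j * (3 * absStd n p d j ^ 2 + 3 * ρ * absStd n p d j + ρ ^ 2) := by
  have h1 := H.one_le_sqrt j
  have h2 := H.sq_sqrt_mean j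
  have ht := absStd_nonneg (n := n) (p := p) d j
  have h3 : |d j| ≤ n * p j * ρ * absStd n p d j := by
    rw [H.abs_eq, ← h2]
    have : √(n * p j) ≤ √(n * p j) * √(n * p j) * ρ := by
      have := le_mul_of_one_le_left (Real.sqrt_nonneg (n * p j)) h1
      linarith
    rw [h2] at this ⊢
    nlinarith
  have h4 : |3 * d j ^ 2 + 3 * d j + 1| ≤ 3 * d j ^ 2 + 3 * |d j| + 1 := by
    refine (abs_add_le _ _).trans (add_le_add ((abs_add_le _ _).trans (add_le_add ?_ ?_)) ?_)
    · rw [abs_of_nonneg (by positivity)]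
    · rw [abs_mul, abs_of_pos (by norm_num : (0 : ℝ) < 3)]
    · simp
  refine h4.trans ?_
  rw [H.absStd_sq]
  linarith [H.one_le j]

set_option maxHeartbeats 1000000 in
/-- Odd third-order terms are negligible. -/
lemma abs_exp_coord_cube_mul_le {L : ℕ} (hn : n = L + 2) (j : Fin m) {c : ℝ} (hc : c < 0)
    {g g1 : ℝ → ℝ} {b0 b1 : ℝ}
    (hd : ∀ x, c < x → HasDerivAt g (g1 x) x) (hb0 : ∀ x, c < x → |g x| ≤ b0)
    (hb1 : ∀ x, c < x → |g1 x| ≤ b1) :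
    |trialExp p (fun j => n * p j) (L + 1) (fun d => d j ^ 3 * g (pearsonForm n p d))| ≤
      (n * p j) ^ 2 * ρ ^ 2 * (64 * b0 + 18 * b1) := by
  obtain ⟨G, G1, G2, hG, hG1, hGg, hGb, hG1b, hG2b⟩ := exists_sub_two_mul_deriv_eq hc hd hb0 hb1
  have h0 : ∀ {x : ℝ}, 0 ≤ x → c < x := fun hx => hc.trans_le hx
  obtain ⟨b2, hb2⟩ : ∃ b2, b2 = (b0 + b1) / 2 := ⟨_, rfl⟩
  rw [← hb2] at hG2b
  have hn' : (n : ℝ) = L + 2 := by rw [hn]; push_cast; rfl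
  have hb00 : 0 ≤ b0 := (abs_nonneg _).trans (hb0 0 hc)
  have hb20 : 0 ≤ b2 := (abs_nonneg _).trans (hG2b 0 hc)
  have hb10 : 0 ≤ b1 := (abs_nonneg _).trans (hb1 0 hc)
  have hρ := H.rho_pos
  have hρ1 := H.rho_le
  have hρ2 := H.rho_sq_le
  have hl := H.mean_pos j
  have hlV := H.mean_le j
  have hpj := H.pos j
  have hpj1 : p j ≤ 1 := by
    rw [← H.sum_eq]; exact Finset.single_le_sum (fun k _ => H.nonneg k) (Finset.mem_univ j)
  have hpl := H.prob_le j
  have hL : (L : ℝ) ≤ n - 1 := by rw [hn']; linarith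
  have hL' : (n : ℝ) - 2 ≤ L := by rw [hn']; linarith
  obtain ⟨V, hV⟩ : ∃ V, V = (n * p j) ^ 2 * ρ ^ 2 := ⟨_, rfl⟩
  have hV0 : 0 ≤ V := by rw [hV]; positivity
  rw [← hV] at hlV ⊢
  have e0 : trialExp p (fun j => n * p j) (L + 1) (fun d => d j ^ 3 * g (pearsonForm n p d)) =
      trialExp p (fun j => n * p j) (L + 1) (fun d => d j * (d j ^ 2 * G (pearsonForm n p d))) -
      2 * trialExp p (fun j => n * p j) (L + 1) (fun d => d j ^ 3 * G1 (pearsonForm n p d)) := by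
    rw [← trialExp_const_mul, ← trialExp_sub]
    refine congrArg _ (funext fun d => ?_)
    rw [← hGg _ (h0 (H.form_nonneg d))]; ring
  -- In the integration by parts for d_j · (d_j² G), the increment of G gives 2 d_j³ G1 as before,
  -- while the increment of d_j² gives 2 n p_j (1 - p_j) d_j G. The factor 1 - p_j appears because
  -- the new trial also affects d_j in the subtracted average.
  have key : |trialExp p (fun j => n * p j) (L + 1)
        (fun d => d j * (d j ^ 2 * G (pearsonForm n p d))) -
      2 * trialExp p (fun j => n * p j) (L + 1) (fun d => d j ^ 3 * G1 (pearsonForm n p d)) -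
      2 * (n * p j * (1 - p j)) *
        trialExp p (fun j => n * p j) L (fun d => d j * G (pearsonForm n p d))| ≤
      V * (12 * b0 + 35 * b2) := by
    rw [exp_coord_mul hn j (fun d => d j ^ 2 * G (pearsonForm n p d)), exp_succ_eq,
      ← trialExp_const_mul, ← trialExp_sub, ← trialExp_const_mul, ← trialExp_sub]
    have hpt : ∀ d : Fin m → ℝ, ∑ j, d j = L - ∑ j, (n : ℝ) * p j →
        |n * p j * ((d + unitVec j) j ^ 2 * G (pearsonForm n p (d + unitVec j)) -
          ∑ k, p k * ((d + unitVec k) j ^ 2 * G (pearsonForm n p (d + unitVec k))))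
          - p j * ((d + unitVec j) j ^ 2 * G (pearsonForm n p (d + unitVec j)))
          - 2 * ∑ k, p k * ((d + unitVec k) j ^ 3 * G1 (pearsonForm n p (d + unitVec k)))
          - 2 * (n * p j * (1 - p j)) * (d j * G (pearsonForm n p d))| ≤
        ∑ k, p k * (V * b2 * (absStd n p d j ^ 2 * (2 * absStd n p d k + ρ) ^ 2 / 2
            + 2 * (absStd n p d j ^ 3 * (2 * absStd n p d k + ρ))))
          + V * (b2 * (absStd n p d j ^ 2 * (2 * absStd n p d j + ρ) ^ 2 / 2)
            + b0 * (19 / 2 * absStd n p d j ^ 2 + 6 * ρ * absStd n p d j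
              + (1 + 3 / 2 * ρ ^ 2))) := by
      intro d hd
      simp only [form_add, Pi.add_apply, unitVec_apply, if_true]
      have hw0 := H.form_nonneg d
      have hwa := H.form_add_nonneg d
      have hsum := H.abs_sum_prob_mul_incr_le hn hd
      have hsq := H.incr_sq_le d
      have hxa := H.abs_mul_incr_le d j
      have hxaj := H.abs_mul_incr_self_le d j
      have hx2 := H.absStd_sq d j
      have hx3 := H.add_one_sq_le d j
      have hx4 := H.abs_cube_diff_le d j
      have ha : n * p j * pearsonIncr n p d j = 2 * d j + 1 := by
        unfold pearsonIncr; rw [mul_div_cancel₀ _ hl.ne']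
      have ht0 := absStd_nonneg (n := n) (p := p) d
      set w := pearsonForm n p d
      set a := pearsonIncr n p d
      set t := absStd n p d
      set x := d j
      have htj := ht0 j
      set r : Fin m → ℝ := fun k => G (w + a k) - G w - a k * G1 w with hr
      set q : Fin m → ℝ := fun k => G1 (w + a k) - G1 w with hq
      have hrb : ∀ k, |r k| ≤ b2 * (ρ ^ 2 * (2 * t k + ρ) ^ 2) / 2 := fun k => by
        have := abs_taylor_two (fun x hx => hG x (h0 hx)) (fun x hx => hG1 x (h0 hx))
          (fun x hx => hG2b x (h0 hx)) hw0 (hwa k)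
        refine this.trans ?_
        have := hsq k
        gcongr
      have hqb : ∀ k, |q k| ≤ b2 * |a k| := fun k =>
        abs_sub_le_of_deriv (fun x hx => hG1 x (h0 hx)) (fun x hx => hG2b x (h0 hx)) hw0 (hwa k)
      have hGq : |G (w + a j) - G w| ≤ b0 * |a j| :=
        abs_sub_le_of_deriv (fun x hx => hG x (h0 hx)) (fun x hx => hG1b x (h0 hx)) hw0 (hwa j)
      have hrx : ∀ k, |n * p j * x ^ 2 * r k| ≤ V * b2 * (t j ^ 2 * (2 * t k + ρ) ^ 2 / 2) := by
        intro k
        rw [abs_mul, abs_of_nonneg (by positivity)]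
        calc n * p j * x ^ 2 * |r k|
            ≤ n * p j * x ^ 2 * (b2 * (ρ ^ 2 * (2 * t k + ρ) ^ 2) / 2) := by gcongr; exact hrb k
          _ = _ := by rw [hx2, hV]; ring
      have i2 : ∀ k, (x + if j = k then 1 else 0) ^ 2 = x ^ 2 + if j = k then 2 * x + 1 else 0 :=
        fun k => by split_ifs <;> ring
      have i3 : ∀ k, (x + if j = k then 1 else 0) ^ 3 =
          x ^ 3 + if j = k then 3 * x ^ 2 + 3 * x + 1 else 0 := fun k => by split_ifs <;> ring
      simp only [i2, i3]
      rw [sum_prob_mul_add_ite j (fun k => G (w + a k)),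
        sum_prob_mul_add_ite j (fun k => G1 (w + a k))]
      have e1 : ∑ k, p k * G (w + a k) = G w + (∑ k, p k * a k) * G1 w + ∑ k, p k * r k := by
        have : ∀ k, p k * r k = p k * G (w + a k) - p k * G w - p k * a k * G1 w := fun k => by
          simp only [hr]; ring
        simp only [this, Finset.sum_sub_distrib, ← Finset.sum_mul, H.sum_eq]; ring
      have e2 : ∑ k, p k * G1 (w + a k) = G1 w + ∑ k, p k * q k := by
        simp only [hq, mul_sub, Finset.sum_sub_distrib, ← Finset.sum_mul, H.sum_eq]; ring
      have e3 : ∑ k, p k * (n * p j * x ^ 2 * r k + 2 * x ^ 3 * q k) =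
          n * p j * x ^ 2 * ∑ k, p k * r k + 2 * x ^ 3 * ∑ k, p k * q k := by
        rw [Finset.mul_sum, Finset.mul_sum, ← Finset.sum_add_distrib]
        exact Finset.sum_congr rfl fun k _ => by ring
      have e4 : n * p j * ((x + 1) ^ 2 * G (w + a j) -
          (x ^ 2 * ∑ k, p k * G (w + a k) + p j * ((2 * x + 1) * G (w + a j))))
          - p j * ((x + 1) ^ 2 * G (w + a j))
          - 2 * (x ^ 3 * ∑ k, p k * G1 (w + a k) + p j * ((3 * x ^ 2 + 3 * x + 1) * G1 (w + a j)))
          - 2 * (n * p j * (1 - p j)) * (x * G w) =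
          -(∑ k, p k * (n * p j * x ^ 2 * r k + 2 * x ^ 3 * q k))
          + (n * p j * x ^ 2 * r j + (x ^ 2 * G1 w - n * p j * x ^ 2 * ((∑ k, p k * a k) * G1 w)
            + n * p j * (1 - p j) * (2 * (x * (G (w + a j) - G w)) + G (w + a j))
            - p j * ((x + 1) ^ 2 * G (w + a j))
            - 2 * p j * ((3 * x ^ 2 + 3 * x + 1) * G1 (w + a j)))) := by
        rw [e3, e1, e2]
        have : r j = G (w + a j) - G w - a j * G1 w := rfl
        rw [this]
        linear_combination (x ^ 2 * G1 w) * ha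
      have hGj := hGb _ (h0 (hwa j))
      have hG1j := hG1b _ (h0 (hwa j))
      have hG1w := hG1b _ (h0 hw0)
      rw [e4]
      refine (abs_add_le _ _).trans (add_le_add ?_ ?_)
      · rw [abs_neg]
        refine H.abs_sum_prob_mul_le fun k => ?_
        refine (abs_add_le _ _).trans ?_
        rw [mul_add]
        refine add_le_add (hrx k) ?_
        have htk := ht0 k
        calc |2 * x ^ 3 * q k| = 2 * x ^ 2 * (|x| * |q k|) := by
              rw [abs_mul, abs_mul, abs_two, abs_pow, ← sq_abs x]; ring
          _ ≤ 2 * x ^ 2 * (|x| * (b2 * |a k|)) := by gcongr; exact hqb k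
          _ = 2 * b2 * x ^ 2 * (|x| * |a k|) := by ring
          _ ≤ 2 * b2 * x ^ 2 * (n * p j * ρ ^ 2 * (t j * (2 * t k + ρ))) := by
              exact mul_le_mul_of_nonneg_left (hxa k) (by positivity)
          _ = _ := by rw [hx2, hV]; ring
      · rw [mul_add V]
        refine (abs_add_le _ _).trans (add_le_add ((hrx j).trans_eq (by ring)) ?_)
        have k1 : |x ^ 2 * G1 w| ≤ V * (b0 * t j ^ 2) := by
          rw [abs_mul, abs_of_nonneg (sq_nonneg x), hx2]
          calc n * p j * t j ^ 2 * |G1 w| ≤ V * t j ^ 2 * b0 := by gcongr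
            _ = _ := by ring
        have k2 : |n * p j * x ^ 2 * ((∑ k, p k * a k) * G1 w)| ≤ V * (b0 * t j ^ 2) := by
          rw [abs_mul, abs_of_nonneg (by positivity), abs_mul, hx2, hV]
          calc _ ≤ n * p j * (n * p j * t j ^ 2) * (ρ ^ 2 * b0) :=
                mul_le_mul_of_nonneg_left (mul_le_mul hsum hG1w (abs_nonneg _) (by positivity))
                  (by positivity)
            _ = _ := by ring
        have k3 : |n * p j * (1 - p j) * (2 * (x * (G (w + a j) - G w)) + G (w + a j))| ≤
            V * (b0 * (4 * t j ^ 2 + 2 * ρ * t j + 1)) := by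
          rw [abs_mul, abs_mul, abs_of_pos hl, abs_of_nonneg (by linarith : 0 ≤ 1 - p j)]
          have s1 : n * p j * (1 - p j) ≤ V :=
            (mul_le_of_le_one_right hl.le (by linarith)).trans hlV
          have s2 : |2 * (x * (G (w + a j) - G w)) + G (w + a j)| ≤
              b0 * (4 * t j ^ 2 + 2 * ρ * t j + 1) := by
            refine (abs_add_le _ _).trans ?_
            rw [abs_mul, abs_mul, abs_two]
            have : |x| * |G (w + a j) - G w| ≤ b0 * (t j * (2 * t j + ρ)) := by
              calc _ ≤ |x| * (b0 * |a j|) := by gcongr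
                _ = b0 * (|x| * |a j|) := by ring
                _ ≤ _ := by gcongr
            linarith
          exact mul_le_mul s1 s2 (abs_nonneg _) hV0
        have k4 : |p j * ((x + 1) ^ 2 * G (w + a j))| ≤ V * (b0 * ((t j + ρ) ^ 2 / 2)) := by
          rw [abs_mul, abs_mul, abs_of_pos hpj, abs_of_nonneg (sq_nonneg (x + 1))]
          calc _ ≤ n * p j * ρ ^ 2 / 2 * (n * p j * (t j + ρ) ^ 2 * b0) := by gcongr
            _ = _ := by rw [hV]; ring
        have k5 : |2 * p j * ((3 * x ^ 2 + 3 * x + 1) * G1 (w + a j))| ≤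
            V * (b0 * (3 * t j ^ 2 + 3 * ρ * t j + ρ ^ 2)) := by
          rw [abs_mul, abs_mul, abs_mul, abs_two, abs_of_pos hpj]
          calc _ ≤ 2 * (n * p j * ρ ^ 2 / 2) *
                (n * p j * (3 * t j ^ 2 + 3 * ρ * t j + ρ ^ 2) * b0) := by gcongr
            _ = _ := by rw [hV]; ring
        have tri : ∀ a b c d e : ℝ, |a - b + c - d - e| ≤ |a| + |b| + |c| + |d| + |e| := by
          intro a b c d e
          have := abs_sub (a - b + c - d) e
          have := abs_sub (a - b + c) d
          have := abs_add_le (a - b) c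
          have := abs_sub a b
          linarith
        refine (tri _ _ _ _ _).trans
          ((add_le_add (add_le_add (add_le_add (add_le_add k1 k2) k3) k4) k5).trans_eq ?_)
        ring
    refine (abs_trialExp_le H.nonneg hpt).trans ?_
    rw [trialExp_add, trialExp_const_mul, trialExp_add, trialExp_const_mul, trialExp_const_mul]
    have hk : ∀ k, trialExp p (fun j => n * p j) L (fun d => V * b2 *
        (absStd n p d j ^ 2 * (2 * absStd n p d k + ρ) ^ 2 / 2
            + 2 * (absStd n p d j ^ 3 * (2 * absStd n p d k + ρ)))) ≤ V * b2 * 26 := fun k => by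
      rw [trialExp_const_mul]
      refine mul_le_mul_of_nonneg_left ?_ (by positivity)
      have e : (fun d : Fin m → ℝ => absStd n p d j ^ 2 * (2 * absStd n p d k + ρ) ^ 2 / 2
            + 2 * (absStd n p d j ^ 3 * (2 * absStd n p d k + ρ))) =
          fun d => 2 * (absStd n p d j ^ 2 * absStd n p d k ^ 2)
            + 2 * ρ * (absStd n p d j ^ 2 * absStd n p d k) + ρ ^ 2 / 2 * absStd n p d j ^ 2
            + 4 * (absStd n p d j ^ 3 * absStd n p d k) + 2 * ρ * absStd n p d j ^ 3 := by
        funext d; ring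
      rw [e]
      simp only [trialExp_add, trialExp_const_mul]
      have f1 := H.exp_sq_mul_sq_le hL hL' j k
      have f2 := H.exp_sq_mul_le hL hL' j k
      have f3 := H.exp_absStd_sq_le hL hL' j
      have f4 := H.exp_cube_mul_le hL hL' j k
      have f5 := H.exp_absStd_cube_le hL hL' j
      have f2' := mul_le_mul_of_nonneg_left f2 hρ.le
      have f3' := mul_le_mul_of_nonneg_left f3 (sq_nonneg ρ)
      have f5' := mul_le_mul_of_nonneg_left f5 hρ.le
      linarith
    have b := H.exp_average_le (L := L) _ _ hk
    have f1 : trialExp p (fun j => n * p j) L (fun d =>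
        absStd n p d j ^ 2 * (2 * absStd n p d j + ρ) ^ 2 / 2) ≤ 9 := by
      have := H.exp_poly_le hL hL' j 0 0 (ρ ^ 2 / 2) (2 * ρ) 2 le_rfl (by positivity)
        (by positivity) (by norm_num)
      refine le_trans (le_of_eq (congrArg _ (funext fun d => ?_))) (this.trans ?_)
      · ring
      · linarith
    have f2 : trialExp p (fun j => n * p j) L (fun d =>
        19 / 2 * absStd n p d j ^ 2 + 6 * ρ * absStd n p d j + (1 + 3 / 2 * ρ ^ 2)) ≤ 12 := by
      have := H.exp_poly_le hL hL' j (1 + 3 / 2 * ρ ^ 2) (6 * ρ) (19 / 2) 0 0 (by positivity)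
        (by norm_num) le_rfl le_rfl
      refine le_trans (le_of_eq (congrArg _ (funext fun d => ?_))) (this.trans ?_)
      · ring
      · linarith
    have f3 := mul_le_mul_of_nonneg_left f1 hb20
    have f4 := mul_le_mul_of_nonneg_left f2 hb00
    have f5 := mul_le_mul_of_nonneg_left (add_le_add f3 f4) hV0
    linarith
  have hlev := H.abs_exp_coord_level hn j (fun x hx => hG x (h0 hx)) (fun x hx => hGb x (h0 hx))
    (fun x hx => hG1b x (h0 hx))
  -- The cubic term has been reduced to a linear one, to which the first-order estimate applies with
  -- G in the role of g. The constant 67/4 is 9 + 5 plus 1/2 + 9/4 for the change in the number of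
  -- trials.
  have hA := H.abs_exp_coord_mul_le hn j hc hG hGb hG1b
  have hEL : |trialExp p (fun j => n * p j) L (fun d => d j * G (pearsonForm n p d))| ≤
      n * p j * ρ ^ 2 * (67 / 4 * b0) := by
    have tri : ∀ x y : ℝ, |y| ≤ |x| + |x - y| := fun x y => by
      have := abs_sub x (x - y); rwa [sub_sub_cancel] at this
    refine (tri _ _).trans ((add_le_add hA hlev).trans_eq ?_)
    ring
  rw [e0]
  have tri : ∀ x y : ℝ, |x| ≤ |x - y| + |y| := fun x y => by
    have := abs_add_le (x - y) y; rwa [sub_add_cancel] at this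
  have hlast : |2 * (n * p j * (1 - p j)) *
      trialExp p (fun j => n * p j) L (fun d => d j * G (pearsonForm n p d))| ≤
      2 * V * (67 / 4 * b0) := by
    rw [abs_mul, abs_of_nonneg (by have := sub_nonneg.2 hpj1; positivity)]
    calc _ ≤ 2 * (n * p j * 1) * (n * p j * ρ ^ 2 * (67 / 4 * b0)) := by
          gcongr; linarith
      _ = _ := by rw [hV]; ring
  refine (tri _ _).trans ((add_le_add key hlast).trans ?_)
  rw [hb2]
  have := mul_nonneg hV0 hb00
  have := mul_nonneg hV0 hb10
  linarith

end IsCells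

/-! ### The error of order ρ² in the Stein identity. -/

namespace IsCells

variable {m n : ℕ} {p : Fin m → ℝ} {ρ : ℝ} (H : IsCells n p ρ)
include H

lemma abs_le_mean_mul (d : Fin m → ℝ) (j : Fin m) :
    |d j| ≤ n * p j * (ρ * absStd n p d j) := by
  have h := H.one_le_sqrt j
  have ht := absStd_nonneg (n := n) (p := p) d j
  rw [H.abs_eq]
  calc absStd n p d j * √(n * p j) ≤ absStd n p d j * √(n * p j) * (ρ * √(n * p j)) :=
        le_mul_of_one_le_right (by positivity) h
    _ = (√(n * p j) * √(n * p j)) * (ρ * absStd n p d j) := by ring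
    _ = _ := by rw [H.sq_sqrt_mean]

lemma inv_mean_le (j : Fin m) : (n * p j)⁻¹ ≤ ρ ^ 2 := by
  rw [inv_le_iff_one_le_mul₀ (H.mean_pos j)]; exact H.one_le j

/-- The even part of the third-order term. -/
lemma abs_even_cube_le (d : Fin m → ℝ) (j : Fin m) :
    |(8 * d j ^ 2 + 5 * d j + 1) / (n * p j) ^ 2| ≤
      ρ ^ 2 * (8 * absStd n p d j ^ 2 + 5 * ρ * absStd n p d j + ρ ^ 2) := by
  have hl := H.mean_pos j
  have ht := absStd_nonneg (n := n) (p := p) d j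
  have hρ := H.rho_pos
  have h1 : |8 * d j ^ 2 + 5 * d j + 1| ≤
      n * p j * (8 * absStd n p d j ^ 2 + 5 * ρ * absStd n p d j + ρ ^ 2) := by
    have h2 := H.abs_le_mean_mul d j
    have h3 := H.one_le j
    have h4 : |8 * d j ^ 2 + 5 * d j + 1| ≤ 8 * d j ^ 2 + 5 * |d j| + 1 := by
      refine (abs_add_le _ _).trans (add_le_add ((abs_add_le _ _).trans (add_le_add ?_ ?_)) ?_)
      · rw [abs_of_nonneg (by positivity)]
      · rw [abs_mul, abs_of_pos (by norm_num : (0 : ℝ) < 5)]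
      · simp
    refine h4.trans ?_
    rw [H.absStd_sq]
    linarith
  rw [abs_div, abs_of_pos (pow_pos hl 2), div_le_iff₀ (pow_pos hl 2)]
  refine h1.trans ?_
  have h5 := H.mean_le j
  calc _ ≤ (n * p j) ^ 2 * ρ ^ 2 *
        (8 * absStd n p d j ^ 2 + 5 * ρ * absStd n p d j + ρ ^ 2) := by gcongr
    _ = _ := by ring

omit H in
-- From (d + 1)(2d + 1)² = 4d³ + 8d² + 5d + 1. The cubic part is only of order ρ in absolute value
-- and must be treated by cancellation; the rest is already of order ρ².
lemma add_one_mul_incr_sq (d : Fin m → ℝ) (j : Fin m) :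
    (d j + 1) * pearsonIncr n p d j ^ 2 =
      4 * (((n * p j) ^ 2)⁻¹ * d j ^ 3) + (8 * d j ^ 2 + 5 * d j + 1) / (n * p j) ^ 2 := by
  unfold pearsonIncr
  rw [div_pow, ← mul_div_assoc, inv_mul_eq_div, ← mul_div_assoc, ← add_div]
  ring

set_option maxHeartbeats 1000000 in
/-- Error of order `ρ ^ 2` in the Stein identity for Pearson's statistic. -/
lemma abs_exp_stein_le_sq {L : ℕ} (hn : n = L + 2) {c : ℝ} (hc : c < 0) {φ0 φ1 φ2 φ3 : ℝ → ℝ}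
    {P1 P2 M2 M3 M4 : ℝ}
    (hd0 : ∀ x, c < x → HasDerivAt φ0 (φ1 x) x) (hd1 : ∀ x, c < x → HasDerivAt φ1 (φ2 x) x)
    (hd2 : ∀ x, c < x → HasDerivAt φ2 (φ3 x) x)
    (hM2 : ∀ x, c < x → |φ1 x| ≤ M2) (hM3 : ∀ x, c < x → |φ2 x| ≤ M3)
    (hM4 : ∀ x, c < x → |φ3 x| ≤ M4)
    (hP1 : ∀ x, 0 ≤ x → |φ1 x + x * φ2 x| ≤ P1)
    (hP2 : ∀ x, 0 ≤ x → |2 * φ2 x + x * φ3 x| ≤ P2) :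
    |trialExp p (fun j => n * p j) (L + 2) (fun d => pearsonForm n p d * φ1 (pearsonForm n p d)
      + ((m : ℝ) - 1 - pearsonForm n p d) / 2 * φ0 (pearsonForm n p d))| ≤
      ρ ^ 2 * (P1 + 5 / 2 * P2 + m * (15 * M2 + 75 * M3 + 22 * M4)) := by
  have h0 : ∀ {x : ℝ}, 0 ≤ x → c < x := fun hx => hc.trans_le hx
  have hn' : (n : ℝ) = L + 2 := by rw [hn]; push_cast; rfl
  have hM20 : 0 ≤ M2 := (abs_nonneg _).trans (hM2 0 hc)
  have hM30 : 0 ≤ M3 := (abs_nonneg _).trans (hM3 0 hc)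
  have hM40 : 0 ≤ M4 := (abs_nonneg _).trans (hM4 0 hc)
  have hP10 : 0 ≤ P1 := (abs_nonneg _).trans (hP1 0 le_rfl)
  have hP20 : 0 ≤ P2 := (abs_nonneg _).trans (hP2 0 le_rfl)
  have hm := H.two_le_cast
  have hρ := H.rho_pos
  rw [H.exp_stein (L := L + 1) hn]
  set Ψ : (Fin m → ℝ) → ℝ := fun d =>
      ∑ k, p k * ((pearsonForm n p d + pearsonIncr n p d k)
        * φ1 (pearsonForm n p d + pearsonIncr n p d k))
      + ((m : ℝ) - 1) / 2 * ∑ k, p k * φ0 (pearsonForm n p d + pearsonIncr n p d k)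
      - 1 / 2 * ∑ j, (d j + 1) * φ0 (pearsonForm n p d + pearsonIncr n p d j) with hΨ
  -- Q is the negative of the odd first-order part of Ψ. Its expectation is bounded by the results
  -- on odd terms, whereas Ψ + Q is of order ρ² in mean absolute value and is estimated pointwise.
  set Q : (Fin m → ℝ) → ℝ := fun d => ∑ j, (3 / 2 * (n * p j)⁻¹ * (d j * φ1 (pearsonForm n p d))
      + ((n * p j) ^ 2)⁻¹ * (d j ^ 3 * φ2 (pearsonForm n p d))) with hQ
  have hQb : |trialExp p (fun j => n * p j) (L + 1) Q| ≤
      m * (ρ ^ 2 * (3 / 2 * (9 * M2 + 5 * M3) + (64 * M3 + 18 * M4))) := by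
    rw [hQ, trialExp_sum]
    refine (Finset.abs_sum_le_sum_abs _ _).trans ?_
    have : ∀ j ∈ Finset.univ, |trialExp p (fun j => n * p j) (L + 1) (fun d =>
        3 / 2 * (n * p j)⁻¹ * (d j * φ1 (pearsonForm n p d))
        + ((n * p j) ^ 2)⁻¹ * (d j ^ 3 * φ2 (pearsonForm n p d)))| ≤
        ρ ^ 2 * (3 / 2 * (9 * M2 + 5 * M3) + (64 * M3 + 18 * M4)) := by
      intro j _
      have hl := H.mean_pos j
      rw [trialExp_add, trialExp_const_mul, trialExp_const_mul]
      refine (abs_add_le _ _).trans ?_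
      rw [abs_mul (3 / 2 * (n * p j)⁻¹), abs_mul ((n * p j) ^ 2)⁻¹,
        abs_of_pos (by positivity : 0 < 3 / 2 * (n * p j)⁻¹),
        abs_of_pos (by positivity : 0 < ((n * p j) ^ 2)⁻¹), mul_add]
      refine add_le_add ?_ ?_
      · calc _ ≤ 3 / 2 * (n * p j)⁻¹ * (n * p j * ρ ^ 2 * (9 * M2 + 5 * M3)) := 
              mul_le_mul_of_nonneg_left (H.abs_exp_coord_mul_le hn j hc hd1 hM2 hM3) (by positivity)
          _ = ((n * p j)⁻¹ * (n * p j)) * (ρ ^ 2 * (3 / 2 * (9 * M2 + 5 * M3))) := by ring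
          _ = _ := by rw [inv_mul_cancel₀ hl.ne', one_mul]
      · calc _ ≤ ((n * p j) ^ 2)⁻¹ * ((n * p j) ^ 2 * ρ ^ 2 * (64 * M3 + 18 * M4)) := 
              mul_le_mul_of_nonneg_left (H.abs_exp_coord_cube_mul_le hn j hc hd2 hM3 hM4)
                (by positivity)
          _ = (((n * p j) ^ 2)⁻¹ * (n * p j) ^ 2) * (ρ ^ 2 * (64 * M3 + 18 * M4)) := by ring
          _ = _ := by rw [inv_mul_cancel₀ (pow_pos hl 2).ne', one_mul]
    refine (Finset.sum_le_sum this).trans (le_of_eq ?_)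
    simp
  have hRest : |trialExp p (fun j => n * p j) (L + 1) (fun d => Ψ d + Q d)| ≤
      ρ ^ 2 * (P1 + 5 / 2 * P2 + m * (M2 + 7 / 2 * M3 + 4 * M4)) := by
    have hpt : ∀ d : Fin m → ℝ, ∑ j, d j = (L + 1 : ℕ) - ∑ j, (n : ℝ) * p j →
        |Ψ d + Q d| ≤
        ∑ k, p k * ((P2 / 2 + m * M3 / 4) * (ρ ^ 2 * (2 * absStd n p d k + ρ) ^ 2))
          + ∑ j, (M2 / 2 * ρ ^ 2
            + M3 / 4 * (ρ ^ 2 * (8 * absStd n p d j ^ 2 + 5 * ρ * absStd n p d j + ρ ^ 2))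
            + M4 / 12 * (ρ ^ 2 * ((absStd n p d j + ρ) * (2 * absStd n p d j + ρ) ^ 3)))
          + (P1 * ρ ^ 2 + M2 / 2 * (m * ρ ^ 2)) := by
      intro d hd
      have hd1' : ∑ j, d j = -1 := by rw [hd, H.sum_mean, hn']; push_cast; ring
      simp only [hΨ, hQ]
      have heven := H.abs_even_cube_le d
      have hcube := add_one_mul_incr_sq (n := n) (p := p) d
      have hda := H.abs_add_one_mul_incr_le d
      have hw0 := H.form_nonneg d
      have hwa := H.form_add_nonneg d
      have ht0 := absStd_nonneg (n := n) (p := p) d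
      have hab := H.abs_incr_le d
      have hasq := H.incr_sq_le d
      have hS1 : ∑ k, (d k + 1) = (m : ℝ) - 1 := by
        rw [Finset.sum_add_distrib, hd1']; simp; ring
      have hS2 : ∑ k, p k * pearsonIncr n p d k = ((m : ℝ) - 2) / n := by
        rw [H.sum_prob_mul_incr, hd1']; ring
      have hS3 := H.sum_add_one_mul_incr d
      set w := pearsonForm n p d
      set a := pearsonIncr n p d
      set t := absStd n p d
      set q : Fin m → ℝ := fun k =>
        (w + a k) * φ1 (w + a k) - w * φ1 w - a k * (φ1 w + w * φ2 w) with hq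
      set r : Fin m → ℝ := fun k => φ0 (w + a k) - φ0 w - a k * φ1 w with hr
      set z : Fin m → ℝ := fun k =>
        φ0 (w + a k) - φ0 w - a k * φ1 w - a k ^ 2 / 2 * φ2 w with hz
      have hqb : ∀ k, |q k| ≤ P2 * a k ^ 2 / 2 := fun k =>
        abs_taylor_two (g := fun x => x * φ1 x) (g1 := fun x => φ1 x + x * φ2 x)
          (g2 := fun x => 2 * φ2 x + x * φ3 x)
          (fun x hx => ((hasDerivAt_id x).mul (hd1 x (h0 hx))).congr_deriv (by simp))
          (fun x hx => ((hd1 x (h0 hx)).add ((hasDerivAt_id x).mul (hd2 x (h0 hx)))).congr_deriv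
            (by simp; ring)) hP2 hw0 (hwa k)
      have hrb : ∀ k, |r k| ≤ M3 * a k ^ 2 / 2 := fun k =>
        abs_taylor_two (fun x hx => hd0 x (h0 hx)) (fun x hx => hd1 x (h0 hx))
          (fun x hx => hM3 x (h0 hx)) hw0 (hwa k)
      have hzb : ∀ k, |z k| ≤ M4 * |a k| ^ 3 / 6 := fun k =>
        abs_taylor_three (fun x hx => hd0 x (h0 hx)) (fun x hx => hd1 x (h0 hx))
          (fun x hx => hd2 x (h0 hx)) (fun x hx => hM4 x (h0 hx)) hw0 (hwa k)
      have e1 : ∑ k, p k * ((w + a k) * φ1 (w + a k)) =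
          w * φ1 w + ((m : ℝ) - 2) / n * (φ1 w + w * φ2 w) + ∑ k, p k * q k := by
        have : ∀ k, p k * q k = p k * ((w + a k) * φ1 (w + a k)) - p k * (w * φ1 w)
            - p k * a k * (φ1 w + w * φ2 w) := fun k => by simp only [hq]; ring
        simp only [this, Finset.sum_sub_distrib, ← Finset.sum_mul, H.sum_eq, hS2]; ring
      have e2 : ∑ k, p k * φ0 (w + a k) =
          φ0 w + ((m : ℝ) - 2) / n * φ1 w + ∑ k, p k * r k := by
        have : ∀ k, p k * r k = p k * φ0 (w + a k) - p k * φ0 w - p k * a k * φ1 w := fun k => by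
          simp only [hr]; ring
        simp only [this, Finset.sum_sub_distrib, ← Finset.sum_mul, H.sum_eq, hS2]; ring
      have e3 : ∑ j, (d j + 1) * φ0 (w + a j) = ((m : ℝ) - 1) * φ0 w
          + (2 * w + ∑ j, (3 * d j + 1) / (n * p j)) * φ1 w
          + ∑ j, ((d j + 1) * a j ^ 2 / 2 * φ2 w + (d j + 1) * z j) := by
        have : ∀ j, (d j + 1) * a j ^ 2 / 2 * φ2 w + (d j + 1) * z j =
            (d j + 1) * φ0 (w + a j) - (d j + 1) * φ0 w - (d j + 1) * a j * φ1 w := fun j => by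
          simp only [hz]; ring
        simp only [this, Finset.sum_sub_distrib, ← Finset.sum_mul, hS1, hS3]; ring
      have e4 : ∑ k, p k * (q k + ((m : ℝ) - 1) / 2 * r k) =
          ∑ k, p k * q k + ((m : ℝ) - 1) / 2 * ∑ k, p k * r k := by
        rw [Finset.mul_sum, ← Finset.sum_add_distrib]
        exact Finset.sum_congr rfl fun k _ => by ring
      have e5 : ∑ j, (-(1 / 2) * ((n * p j)⁻¹ * φ1 w)
            + -(1 / 4) * ((8 * d j ^ 2 + 5 * d j + 1) / (n * p j) ^ 2 * φ2 w)
            + -(1 / 2) * ((d j + 1) * z j)) =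
          ∑ j, (3 / 2 * (n * p j)⁻¹ * (d j * φ1 w) + ((n * p j) ^ 2)⁻¹ * (d j ^ 3 * φ2 w))
          - 1 / 2 * ((∑ j, (3 * d j + 1) / (n * p j)) * φ1 w
          + ∑ j, ((d j + 1) * a j ^ 2 / 2 * φ2 w + (d j + 1) * z j)) := by
        rw [Finset.sum_mul, ← Finset.sum_add_distrib, Finset.mul_sum, ← Finset.sum_sub_distrib]
        refine Finset.sum_congr rfl fun j _ => ?_
        rw [hcube j]
        ring
      -- Besides the main terms, adding Q has removed d_j φ1 and d_j³ φ2; every term on the right is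
      -- of second order.
      have e6 : ∑ k, p k * ((w + a k) * φ1 (w + a k))
          + ((m : ℝ) - 1) / 2 * ∑ k, p k * φ0 (w + a k)
          - 1 / 2 * ∑ j, (d j + 1) * φ0 (w + a j)
          + ∑ j, (3 / 2 * (n * p j)⁻¹ * (d j * φ1 w) + ((n * p j) ^ 2)⁻¹ * (d j ^ 3 * φ2 w)) =
          ∑ k, p k * (q k + ((m : ℝ) - 1) / 2 * r k)
          + ∑ j, (-(1 / 2) * ((n * p j)⁻¹ * φ1 w)
            + -(1 / 4) * ((8 * d j ^ 2 + 5 * d j + 1) / (n * p j) ^ 2 * φ2 w)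
            + -(1 / 2) * ((d j + 1) * z j))
          + (((m : ℝ) - 2) / n * (φ1 w + w * φ2 w)
            + ((m : ℝ) - 1) / 2 * (((m : ℝ) - 2) / n) * φ1 w) := by
        rw [e4, e5, e1, e2, e3]
        ring
      rw [e6]
      have hmn : ((m : ℝ) - 2) / n ≤ ρ ^ 2 := by
        refine le_trans ?_ H.card_div_le
        have := H.n_pos
        gcongr
        linarith
      have hmn0 : 0 ≤ ((m : ℝ) - 2) / n := div_nonneg (by linarith) H.n_pos.le
      refine (abs_add_le _ _).trans (add_le_add ((abs_add_le _ _).trans (add_le_add ?_ ?_)) ?_)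
      · refine H.abs_sum_prob_mul_le fun k => ?_
        refine (abs_add_le _ _).trans ?_
        rw [abs_mul, abs_of_nonneg (by linarith : (0 : ℝ) ≤ ((m : ℝ) - 1) / 2)]
        calc |q k| + ((m : ℝ) - 1) / 2 * |r k|
            ≤ P2 * a k ^ 2 / 2 + m / 2 * (M3 * a k ^ 2 / 2) :=
              add_le_add (hqb k) (mul_le_mul (by linarith) (hrb k) (abs_nonneg _) (by linarith))
          _ = (P2 / 2 + m * M3 / 4) * a k ^ 2 := by ring
          _ ≤ _ := by gcongr; exact hasq k
      · refine (Finset.abs_sum_le_sum_abs _ _).trans (Finset.sum_le_sum fun j _ => ?_)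
        have hl := H.mean_pos j
        have htj := ht0 j
        refine (abs_add_le _ _).trans (add_le_add ((abs_add_le _ _).trans (add_le_add ?_ ?_)) ?_)
        · rw [abs_mul, abs_mul, abs_neg, abs_of_pos (by norm_num : (0 : ℝ) < 1 / 2),
            abs_of_pos (inv_pos.2 hl)]
          have := mul_le_mul (H.inv_mean_le j) (hM2 w (h0 hw0)) (abs_nonneg _) (by positivity)
          linarith
        · rw [abs_mul, abs_mul, abs_neg, abs_of_pos (by norm_num : (0 : ℝ) < 1 / 4)]
          have := mul_le_mul (heven j) (hM3 w (h0 hw0)) (abs_nonneg _) (by positivity)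
          linarith
        · rw [abs_mul, abs_mul, abs_neg, abs_of_pos (by norm_num : (0 : ℝ) < 1 / 2)]
          calc 1 / 2 * (|d j + 1| * |z j|) ≤ 1 / 2 * (|d j + 1| * (M4 * |a j| ^ 3 / 6)) := by
                gcongr; exact hzb j
            _ = M4 / 12 * ((|d j + 1| * |a j|) * |a j| ^ 2) := by ring
            _ ≤ M4 / 12 * (((t j + ρ) * (2 * t j + ρ)) * (ρ * (2 * t j + ρ)) ^ 2) := by
                refine mul_le_mul_of_nonneg_left (mul_le_mul (hda j) ?_ (by positivity)
                  (by positivity)) (by positivity)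
                exact pow_le_pow_left₀ (abs_nonneg _) (hab j) 2
            _ = _ := by ring
      · refine (abs_add_le _ _).trans (add_le_add ?_ ?_)
        · rw [abs_mul, abs_of_nonneg hmn0, mul_comm P1]
          exact mul_le_mul hmn (hP1 w hw0) (abs_nonneg _) (by positivity)
        · rw [abs_mul, abs_of_nonneg (mul_nonneg (by linarith) hmn0)]
          have h1 : ((m : ℝ) - 1) / 2 * (((m : ℝ) - 2) / n) ≤ m / 2 * ρ ^ 2 :=
            mul_le_mul (by linarith) hmn hmn0 (by linarith)
          calc _ ≤ m / 2 * ρ ^ 2 * M2 :=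
                mul_le_mul h1 (hM2 w (h0 hw0)) (abs_nonneg _) (by positivity)
            _ = _ := by ring
    refine (abs_trialExp_le H.nonneg hpt).trans ?_
    have hL : ((L + 1 : ℕ) : ℝ) ≤ n - 1 := by rw [hn']; push_cast; linarith
    have hL' : (n : ℝ) - 2 ≤ (L + 1 : ℕ) := by rw [hn']; push_cast; linarith
    have hρ1 := H.rho_le
    have hρ2 := H.rho_sq_le
    have hρ3 : ρ ^ 3 ≤ 1 / 512 := by
      have := pow_le_pow_left₀ hρ.le H.rho_le 3; linarith
    have hρ4 : ρ ^ 4 ≤ 1 / 4096 := by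
      have := pow_le_pow_left₀ hρ.le H.rho_le 4; linarith
    rw [trialExp_add, trialExp_add, trialExp_const H.sum_eq]
    have b1 := H.exp_average_le (L := L + 1)
      (fun k d => (P2 / 2 + m * M3 / 4) * (ρ ^ 2 * (2 * absStd n p d k + ρ) ^ 2))
      ((P2 / 2 + m * M3 / 4) * (ρ ^ 2 * 5)) (fun k => by
        rw [trialExp_const_mul, trialExp_const_mul]
        have := H.exp_poly_le hL hL' k (ρ ^ 2) (4 * ρ) 4 0 0 (by positivity) (by norm_num) le_rfl
          le_rfl
        gcongr
        refine le_trans (le_of_eq (congrArg _ (funext fun d => ?_))) (this.trans ?_)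
        · ring
        · linarith)
    have b2 := exp_sum_le (n := n) (p := p) (L := L + 1) (fun j d => M2 / 2 * ρ ^ 2
        + M3 / 4 * (ρ ^ 2 * (8 * absStd n p d j ^ 2 + 5 * ρ * absStd n p d j + ρ ^ 2))
        + M4 / 12 * (ρ ^ 2 * ((absStd n p d j + ρ) * (2 * absStd n p d j + ρ) ^ 3)))
        (M2 / 2 * ρ ^ 2 + M3 / 4 * (ρ ^ 2 * 9) + M4 / 12 * (ρ ^ 2 * 38)) (fun k => by
      simp only [trialExp_add, trialExp_const_mul, trialExp_const H.sum_eq]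
      have f1 : trialExp p (fun j => n * p j) (L + 1) (fun d => (absStd n p d k + ρ) *
          (2 * absStd n p d k + ρ) ^ 3) ≤ 38 := by
        have := H.exp_poly_le hL hL' k (ρ ^ 4) (7 * ρ ^ 3) (18 * ρ ^ 2) (20 * ρ) 8
          (by positivity) (by positivity) (by positivity) (by norm_num)
        refine le_trans (le_of_eq (congrArg _ (funext fun d => ?_))) (this.trans ?_)
        · ring
        · linarith
      have f2 := H.exp_absStd_sq_le hL hL' k
      have f3 := mul_le_mul_of_nonneg_left (H.exp_absStd_le hL hL' k) hρ.le
      gcongr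
      linarith)
    refine (add_le_add (add_le_add b1 b2) le_rfl).trans ?_
    have : 0 ≤ m * (ρ ^ 2 * M2) := by positivity
    have : 0 ≤ m * (ρ ^ 2 * M3) := by positivity
    have : 0 ≤ m * (ρ ^ 2 * M4) := by positivity
    linarith
  rw [trialExp_add] at hRest
  have tri : ∀ x y : ℝ, |x| ≤ |x + y| + |y| := fun x y => by
    have := abs_sub (x + y) y; rwa [add_sub_cancel_right] at this
  refine (tri _ _).trans ((add_le_add hRest hQb).trans ?_)
  have : 0 ≤ ρ ^ 2 * m * M2 := by positivity
  have : 0 ≤ ρ ^ 2 * m * M3 := by positivity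
  have : 0 ≤ ρ ^ 2 * m * M4 := by positivity
  linarith

end IsCells

/-! ### From independent random variables to `trialExp`. -/

section Bridge

variable {m : ℕ}

lemma cellCount_cons {L : ℕ} (k : Fin m) (x : Fin L → Fin m) (j : Fin m) :
    cellCount (Fin.cons k x : Fin (L + 1) → Fin m) j = cellCount x j + if j = k then 1 else 0 := by
  simp only [cellCount, Finset.card_filter, Fin.sum_univ_succ, Fin.cons_zero, Fin.cons_succ,
    eq_comm (a := j)]
  ring

lemma trialExp_eq_sum (p c : Fin m → ℝ) (L : ℕ) (F : (Fin m → ℝ) → ℝ) :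
    trialExp p c L F =
      ∑ x : Fin L → Fin m, (∏ i, p (x i)) * F (fun j => (cellCount x j : ℝ) - c j) := by
  induction L generalizing F with
  | zero =>
    rw [Fintype.sum_unique]
    simp only [trialExp, Finset.univ_eq_empty, Finset.prod_empty, one_mul]
    congr 1
    funext j
    simp [cellCount]
  | succ L ih =>
    rw [← (Fin.consEquiv (fun _ : Fin (L + 1) => Fin m)).sum_comp, Fintype.sum_prod_type,
      trialExp_succ]
    refine Finset.sum_congr rfl fun k _ => ?_
    rw [ih, Finset.mul_sum]
    refine Finset.sum_congr rfl fun x _ => ?_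
    simp only [Fin.consEquiv_apply, Fin.prod_univ_succ, Fin.cons_zero, Fin.cons_succ, mul_assoc]
    congr 3
    funext j
    have e : cellCount ((Fin.consEquiv fun _ : Fin (L + 1) => Fin m) (k, x)) j =
        cellCount x j + if j = k then 1 else 0 := cellCount_cons k x j
    simp only [Pi.add_apply, unitVec_apply]
    rw [e]
    push_cast
    ring

/-- W depends only on the vector of outcomes, whose law lives on a finite set; independence gives
each outcome vector the product of its cell probabilities. -/
lemma integral_eq_trialExp {Ω : Type*} [MeasurableSpace Ω] {μ : Measure Ω}
    [IsProbabilityMeasure μ] {n : ℕ} {p : Fin m → ℝ} {X : Fin n → Ω → Fin m}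
    (hX : ∀ i, Measurable (X i)) (hindep : iIndepFun X μ)
    (hlaw : ∀ i j, μ.real {ω | X i ω = j} = p j) {W : Ω → ℝ}
    (hW : ∀ ω, W ω = pearsonStat n p (cellCount fun i => X i ω)) (h : ℝ → ℝ) :
    ∫ ω, h (W ω) ∂μ = trialExp p (fun j => n * p j) n (fun d => h (pearsonForm n p d)) := by
  have hm : Measurable fun ω => fun i => X i ω := measurable_pi_lambda _ hX
  have h1 : ∫ ω, h (W ω) ∂μ =
      ∫ x, h (pearsonStat n p (cellCount x)) ∂(μ.map fun ω => fun i => X i ω) := by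
    rw [integral_map hm.aemeasurable (measurable_of_finite _).aestronglyMeasurable]
    simp only [hW]
  have : IsProbabilityMeasure (μ.map fun ω => fun i => X i ω) :=
    Measure.isProbabilityMeasure_map hm.aemeasurable
  rw [h1, integral_fintype Integrable.of_finite, trialExp_eq_sum]
  refine Finset.sum_congr rfl fun x _ => ?_
  have h2 : (μ.map fun ω => fun i => X i ω).real {x} = ∏ i, p (x i) := by
    rw [map_measureReal_apply hm (measurableSet_singleton x)]
    have e : (fun ω => fun i => X i ω) ⁻¹' {x} = ⋂ i ∈ Finset.univ, X i ⁻¹' {x i} := by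
      ext ω; simp [funext_iff]
    rw [e, measureReal_def, hindep.measure_inter_preimage_eq_mul Finset.univ
      (fun i _ => measurableSet_singleton (x i)), ENNReal.toReal_prod]
    exact Finset.prod_congr rfl fun i _ => hlaw i (x i)
  rw [h2, smul_eq_mul]
  rfl

end Bridge

/-! ### From the Stein operator to the distance of expectations. -/

section Transfer

variable {m n : ℕ} {p : Fin m → ℝ}

/-- From bounds on the Stein operator at shifted functions to the distance of expectations. -/
lemma abs_trialExp_sub_le (hp : ∀ j, 0 < p j) (hs : ∑ j, p j = 1) {h u0 u1 : ℝ → ℝ} {c C0 C1 B : ℝ}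
    (hc : Continuous h) (hsol : SteinSol ((m : ℝ) - 1) u0 u1 (fun x => h x - c))
    (h0 : ∀ x, 0 < x → |u0 x| ≤ C0) (h1 : ∀ x, 0 < x → |u1 x| ≤ C1)
    (hB : ∀ ε, 0 < ε → |trialExp p (fun j => n * p j) n (fun d =>
      pearsonForm n p d * u1 (pearsonForm n p d + ε) +
      ((m : ℝ) - 1 - pearsonForm n p d) / 2 * u0 (pearsonForm n p d + ε))| ≤ B) :
    |trialExp p (fun j => n * p j) n (fun d => h (pearsonForm n p d)) - c| ≤ B := by
  have hp' : ∀ j, 0 ≤ p j := fun j => (hp j).le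
  have hW : ∀ d : Fin m → ℝ, 0 ≤ pearsonForm n p d := fun d =>
    Finset.sum_nonneg fun j _ => by have := hp j; positivity
  have hcont : Tendsto (fun ε : ℝ => |trialExp p (fun j => n * p j) n
      (fun d => h (pearsonForm n p d + ε)) - c|) (𝓝[>] 0)
      (𝓝 |trialExp p (fun j => n * p j) n (fun d => h (pearsonForm n p d)) - c|) := by
    have : Continuous (fun ε : ℝ => |trialExp p (fun j => n * p j) n
      (fun d => h (pearsonForm n p d + ε)) - c|) := by
      simp only [trialExp_eq_sum]
      fun_prop
    have h2 := this.tendsto 0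
    simp only [add_zero] at h2
    exact h2.mono_left nhdsWithin_le_nhds
  have hlim : Tendsto (fun ε : ℝ => B + ε * (C1 + C0 / 2)) (𝓝[>] 0) (𝓝 B) := by
    have : Continuous fun ε : ℝ => B + ε * (C1 + C0 / 2) := by fun_prop
    have h2 := this.tendsto 0
    simp only [zero_mul, add_zero] at h2
    exact h2.mono_left nhdsWithin_le_nhds
  refine le_of_tendsto_of_tendsto hcont hlim ?_
  filter_upwards [self_mem_nhdsWithin] with ε hε
  have hε' : 0 < ε := hε
  have hpos : ∀ d : Fin m → ℝ, 0 < pearsonForm n p d + ε := fun d => by linarith [hW d]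
  -- The Stein equation is used at W + ε > 0, but the coefficients of the operator involve W; the
  -- mismatch is ε (u1 - u0 / 2), which vanishes in the limit.
  have e : trialExp p (fun j => n * p j) n (fun d => h (pearsonForm n p d + ε)) - c =
      trialExp p (fun j => n * p j) n (fun d =>
        pearsonForm n p d * u1 (pearsonForm n p d + ε) +
        ((m : ℝ) - 1 - pearsonForm n p d) / 2 * u0 (pearsonForm n p d + ε)) +
      ε * trialExp p (fun j => n * p j) n (fun d => u1 (pearsonForm n p d + ε)
        - 1 / 2 * u0 (pearsonForm n p d + ε)) := by
    have hcc : c = trialExp p (fun j => n * p j) n (fun _ => c) := (trialExp_const hs c).symm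
    conv_lhs => rw [hcc]
    rw [← trialExp_sub, ← trialExp_const_mul, ← trialExp_add]
    refine congrArg _ (funext fun d => ?_)
    rw [← hsol.eqn _ (hpos d)]
    ring
  rw [e]
  refine (abs_add_le _ _).trans (add_le_add (hB ε hε') ?_)
  rw [abs_mul, abs_of_pos hε']
  refine mul_le_mul_of_nonneg_left ?_ hε'.le
  refine (abs_trialExp_le hp' (G := fun _ => C1 + C0 / 2) fun d _ => ?_).trans
    (trialExp_const hs _).le
  refine (abs_sub _ _).trans ?_
  rw [abs_mul, abs_of_pos (by norm_num : (0 : ℝ) < 1 / 2)]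
  linarith [h0 _ (hpos d), h1 _ (hpos d)]

end Transfer

/-! ### The class of test functions, extended to the whole line, and the trivial bound. -/

namespace MemCb

variable {k : ℕ} {h : ℝ → ℝ} (H : MemCb k h)
include H

lemma mono {l : ℕ} (hl : l ≤ k) : MemCb l h :=
  ⟨H.continuousOn, fun i hi => H.differentiableAt i (hi.trans_le hl),
    fun i hi => H.bounded i (hi.trans hl)⟩

lemma abs_le_supNorm {i : ℕ} (hi : i ≤ k) {x : ℝ} (hx : 0 < x) :
    |iteratedDeriv i h x| ≤ supNorm (iteratedDeriv i h) := by
  obtain ⟨C, hC⟩ := H.bounded i hi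
  exact le_ciSup (f := fun x : Ioi (0 : ℝ) => |iteratedDeriv i h x|)
    ⟨C, by rintro _ ⟨y, rfl⟩; exact hC y y.2⟩ ⟨x, hx⟩

lemma hasDerivAt {i : ℕ} (hi : i < k) {x : ℝ} (hx : 0 < x) :
    HasDerivAt (iteratedDeriv i h) (iteratedDeriv (i + 1) h x) x := by
  rw [iteratedDeriv_succ]
  exact (H.differentiableAt i hi x hx).hasDerivAt

/-- The constant extension of `h` to the negative half-line is continuous. -/
lemma continuous_extend : Continuous fun x => h (max x 0) :=
  H.continuousOn.comp_continuous (by fun_prop) fun x => le_max_right x 0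

lemma abs_extend_le (x : ℝ) : |h (max x 0)| ≤ supNorm h := by
  have hpos : ∀ y, 0 < y → |h (max y 0)| ≤ supNorm h := fun y hy => by
    rw [max_eq_left hy.le]
    simpa using H.abs_le_supNorm (Nat.zero_le k) hy
  rcases lt_or_ge 0 x with hx | hx
  · exact hpos x hx
  -- `supNorm` does not see the point 0, so the value there is bounded by continuity.
  · have h1 : Tendsto (fun y => |h (max y 0)|) (𝓝[>] 0) (𝓝 |h (max 0 0)|) :=
      (H.continuous_extend.abs.tendsto 0).mono_left nhdsWithin_le_nhds
    rw [max_eq_right hx, ← max_self (0 : ℝ)]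
    refine le_of_tendsto h1 ?_
    filter_upwards [self_mem_nhdsWithin] with y hy using hpos y hy

lemma hasDerivAt_extend (hk : 0 < k) {x : ℝ} (hx : 0 < x) :
    HasDerivAt (fun x => h (max x 0)) (iteratedDeriv 1 h x) x := by
  have := H.hasDerivAt hk hx
  rw [iteratedDeriv_zero] at this
  refine this.congr_of_eventuallyEq ?_
  filter_upwards [lt_mem_nhds hx] with y hy
  rw [max_eq_left hy.le]

end MemCb

lemma integral_chiSquare_extend {d : ℕ} (hd : 0 < d) (h : ℝ → ℝ) :
    ∫ x, h x ∂(chiSquare d) = ∫ x, h (max x 0) ∂(chiSquare d) := by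
  rw [integral_chiSquare hd, integral_chiSquare hd (fun x => h (max x 0))]
  congr 1
  refine setIntegral_congr_fun measurableSet_Ioi fun x (hx : 0 < x) => ?_
  simp only [max_eq_left hx.le]

/-- Covers small expected counts, where the claimed bounds are at least 2‖h‖. -/
lemma abs_trialExp_sub_integral_le {m n d : ℕ} (hd : 0 < d) {p : Fin m → ℝ} (hp : ∀ j, 0 < p j)
    (hs : ∑ j, p j = 1) {h : ℝ → ℝ} {A : ℝ} (hA : ∀ x, |h x| ≤ A) :
    |trialExp p (fun j => n * p j) n (fun d => h (pearsonForm n p d)) -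
      ∫ x, h x ∂(chiSquare d)| ≤ 2 * A := by
  have : NeZero d := ⟨hd.ne'⟩
  have h1 := norm_integral_le_of_norm_le_const (μ := chiSquare d) (f := h)
      (C := A) (ae_of_all _ fun x => hA x)
  have h2 : |trialExp p (fun j => n * p j) n (fun d => h (pearsonForm n p d))| ≤ A :=
    (abs_trialExp_le (fun j => (hp j).le) (G := fun _ => A) fun d _ => hA _).trans
      (trialExp_const hs _).le
  simp only [Real.norm_eq_abs, probReal_univ, mul_one] at h1
  linarith [abs_sub (trialExp p (fun j => n * p j) n (fun d => h (pearsonForm n p d)))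
    (∫ x, h x ∂(chiSquare d))]

lemma hasDerivAt_shift {u u' : ℝ → ℝ} (hd : ∀ x, 0 < x → HasDerivAt u (u' x) x) {ε x : ℝ}
    (hx : -ε < x) : HasDerivAt (fun x => u (x + ε)) (u' (x + ε)) x :=
  (hd (x + ε) (by linarith)).comp_add_const x ε

/-! ### The two bounds for large expected counts. -/

namespace IsCells

variable {m n : ℕ} {p : Fin m → ℝ} {ρ : ℝ} (H : IsCells n p ρ)
include H

/-- No factor m remains because the bounds used for u1 and u2 decay like 1 / m, which cancels the m
from summing over cells. The 62 is 3 · 22/3 + 8 + 32. -/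
lemma abs_sub_le_of_memCb_two {h : ℝ → ℝ} (hh : MemCb 2 h) :
    |trialExp p (fun j => n * p j) n (fun d => h (max (pearsonForm n p d) 0)) -
      ∫ x, h (max x 0) ∂(chiSquare (m - 1))| ≤
      ρ * (8 * supNorm h + 62 * supNorm (iteratedDeriv 1 h) + 6 * supNorm (iteratedDeriv 2 h)) := by
  have hm := H.two_le
  have hd : 0 < m - 1 := by omega
  have hcast : ((m - 1 : ℕ) : ℝ) = m - 1 := by rw [Nat.cast_sub (by omega)]; simp
  obtain ⟨u0, u1, u2, hu0, hu1, b0, b1, b1', b2, b2', -⟩ := exists_steinSol_bounds hd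
    hh.continuous_extend hh.abs_extend_le (fun x hx => hh.hasDerivAt_extend two_pos hx)
    (fun x hx => hh.hasDerivAt one_lt_two hx) (fun x hx => hh.abs_le_supNorm one_le_two hx)
    (fun x hx => hh.abs_le_supNorm le_rfl hx)
  set A0 := supNorm h
  set A1 := supNorm (iteratedDeriv 1 h)
  set A2 := supNorm (iteratedDeriv 2 h)
  have hA0 : 0 ≤ A0 := (abs_nonneg _).trans (hh.abs_extend_le 1)
  have hA1 : 0 ≤ A1 := (abs_nonneg _).trans (hh.abs_le_supNorm one_le_two one_pos)
  have hA2 : 0 ≤ A2 := (abs_nonneg _).trans (hh.abs_le_supNorm le_rfl one_pos)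
  rw [hcast] at hu0 hu1 b1 b2'
  have hm' := H.two_le_cast
  have hM2 : ∀ x, 0 < x → |u1 x| ≤ (4 * A0 + 4 * A1) / m := fun x hx => by
    rw [le_div_iff₀ (by linarith)]
    nlinarith [b1 x hx, abs_nonneg (u1 x)]
  have hM3 : ∀ x, 0 < x → |u2 x| ≤ (2 * A2 + 32 / 3 * A1) / m := fun x hx => by
    rw [le_div_iff₀ (by linarith)]
    nlinarith [b2' x hx, abs_nonneg (u2 x)]
  obtain ⟨L, hL⟩ : ∃ L, n = L + 1 := ⟨n - 1, by have := H.two_le_n; omega⟩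
  refine abs_trialExp_sub_le H.pos H.sum_eq hh.continuous_extend hu0 b0 b1' fun ε hε => ?_
  have hpos : ∀ {x : ℝ}, 0 ≤ x → 0 < x + ε := fun hx => by linarith
  have := H.abs_exp_stein_le hL (φ0 := fun x => u0 (x + ε)) (φ1 := fun x => u1 (x + ε))
    (φ2 := fun x => u2 (x + ε)) (K := 22 / 3 * A1)
    (fun x hx => hasDerivAt_shift hu0.hasDerivAt (by linarith))
    (fun x hx => hasDerivAt_shift hu1.hasDerivAt (by linarith))
    (fun x hx => hM2 _ (hpos hx)) (fun x hx => hM3 _ (hpos hx))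
    (fun x hx => by
      refine (abs_add_le _ _).trans ?_
      rw [abs_mul, abs_of_nonneg hx]
      have h1 := b1' _ (hpos hx)
      have h2 := b2 _ (hpos hx)
      have h3 := abs_nonneg (u2 (x + ε))
      nlinarith)
  rw [← hL] at this
  refine this.trans (mul_le_mul_of_nonneg_left ?_ H.rho_pos.le)
  rw [mul_div_cancel₀ _ (by linarith : (m : ℝ) ≠ 0), mul_div_cancel₀ _ (by linarith : (m : ℝ) ≠ 0)]
  linarith

/-- Here the bounds on u1, u2, u3 are uniform in m, so the factor m from the sum over cells stays.
Each bound comes from the equation of the corresponding derivative, so three derivatives of h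
suffice. -/
lemma abs_sub_le_of_memCb_three {h : ℝ → ℝ} (hh : MemCb 3 h) :
    |trialExp p (fun j => n * p j) n (fun d => h (max (pearsonForm n p d) 0)) -
      ∫ x, h (max x 0) ∂(chiSquare (m - 1))| ≤
      m * ρ ^ 2 * (700 * supNorm (iteratedDeriv 1 h) + 200 * supNorm (iteratedDeriv 2 h)
        + 30 * supNorm (iteratedDeriv 3 h)) := by
  have hm := H.two_le
  have hd : 0 < m - 1 := by omega
  have hcast : ((m - 1 : ℕ) : ℝ) = m - 1 := by rw [Nat.cast_sub (by omega)]; simp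
  obtain ⟨u0, u1, u2, hu0, hu1, b0, -, b1, b2, -, u3, hu2⟩ := exists_steinSol_bounds hd
    hh.continuous_extend hh.abs_extend_le (fun x hx => hh.hasDerivAt_extend (by norm_num) hx)
    (fun x hx => hh.hasDerivAt (by norm_num) hx)
    (fun x hx => hh.abs_le_supNorm (by norm_num) hx)
    (fun x hx => hh.abs_le_supNorm (by norm_num) hx)
  set A1 := supNorm (iteratedDeriv 1 h)
  set A2 := supNorm (iteratedDeriv 2 h)
  have hA3b : ∀ x, 0 < x → |iteratedDeriv 3 h x| ≤ supNorm (iteratedDeriv 3 h) :=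
    fun x hx => hh.abs_le_supNorm le_rfl hx
  set A3 := supNorm (iteratedDeriv 3 h)
  have hA1 : 0 ≤ A1 := (abs_nonneg _).trans (hh.abs_le_supNorm (by norm_num) one_pos)
  have hA2 : 0 ≤ A2 := (abs_nonneg _).trans (hh.abs_le_supNorm (by norm_num) one_pos)
  have hA3 : 0 ≤ A3 := (abs_nonneg _).trans (hh.abs_le_supNorm le_rfl one_pos)
  rw [hcast] at hu0 hu1 hu2
  have hm' := H.two_le_cast
  have hH2 : ∀ x, 0 < x → |iteratedDeriv 2 h x + u1 x| ≤ A2 + 10 / 3 * A1 := fun x hx =>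
    (abs_add_le _ _).trans (add_le_add (hh.abs_le_supNorm (by norm_num) hx) (b1 x hx))
  -- The parameter of the equation is m + 3 ≥ 5, so 1 + 2 / s ≤ 7/5; for u3 it is m + 5 ≥ 7, giving
  -- 9/7.
  have hM3 : ∀ x, 0 < x → |u2 x| ≤ 7 / 5 * (A2 + 10 / 3 * A1) := fun x hx => by
    refine (hu2.abs_le_of_two_le (by linarith) hH2 hx).trans ?_
    have : 2 / ((m : ℝ) - 1 + 4) ≤ 2 / 5 := by gcongr; linarith
    gcongr
    linarith
  have hx3 : ∀ x, 0 < x → x * |u3 x| ≤ 2 * (A2 + 10 / 3 * A1) := fun x hx =>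
    hu2.mul_abs_deriv_le (by linarith) hH2 hx
  obtain ⟨u4, hu3⟩ := hu2.derivSol (by linarith) hH2
    (H' := fun x => iteratedDeriv 3 h x + u2 x)
    (fun x hx => (hh.hasDerivAt (by norm_num) hx).add (hu1.hasDerivAt x hx))
  have hM4 : ∀ x, 0 < x → |u3 x| ≤ 9 / 7 * (A3 + 3 / 2 * (7 / 5 * (A2 + 10 / 3 * A1))) := by
    intro x hx
    have hH3 : ∀ x, 0 < x → |iteratedDeriv 3 h x + u2 x + u2 x / 2| ≤
        A3 + 3 / 2 * (7 / 5 * (A2 + 10 / 3 * A1)) := fun x hx => by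
      have e : iteratedDeriv 3 h x + u2 x + u2 x / 2 = iteratedDeriv 3 h x + 3 / 2 * u2 x := by ring
      rw [e]
      refine (abs_add_le _ _).trans (add_le_add (hA3b x hx) ?_)
      rw [abs_mul, abs_of_pos (by norm_num : (0 : ℝ) < 3 / 2)]
      exact mul_le_mul_of_nonneg_left (hM3 x hx) (by norm_num)
    refine (hu3.abs_le_of_two_le (by linarith) hH3 hx).trans ?_
    have : 2 / ((m : ℝ) - 1 + 4 + 2) ≤ 2 / 7 := by gcongr; linarith
    gcongr
    linarith
  obtain ⟨L, hL⟩ : ∃ L, n = L + 2 := ⟨n - 2, by have := H.two_le_n; omega⟩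
  refine abs_trialExp_sub_le H.pos H.sum_eq hh.continuous_extend hu0 b0 b1 fun ε hε => ?_
  have hpos : ∀ {x : ℝ}, -ε < x → 0 < x + ε := fun hx => by linarith
  have h0 : ∀ {x : ℝ}, 0 ≤ x → 0 < x + ε := fun hx => by linarith
  have := H.abs_exp_stein_le_sq hL (c := -ε) (by linarith) (φ0 := fun x => u0 (x + ε))
    (φ1 := fun x => u1 (x + ε)) (φ2 := fun x => u2 (x + ε)) (φ3 := fun x => u3 (x + ε))
    (P1 := 22 / 3 * A1) (P2 := 24 / 5 * A2 + 16 * A1)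
    (fun x hx => hasDerivAt_shift hu0.hasDerivAt hx)
    (fun x hx => hasDerivAt_shift hu1.hasDerivAt hx)
    (fun x hx => hasDerivAt_shift hu2.hasDerivAt hx)
    (fun x hx => b1 _ (hpos hx)) (fun x hx => hM3 _ (hpos hx)) (fun x hx => hM4 _ (hpos hx))
    (fun x hx => by
      refine (abs_add_le _ _).trans ?_
      rw [abs_mul, abs_of_nonneg hx]
      have h1 := b1 _ (h0 hx)
      have h2 := b2 _ (h0 hx)
      have h3 := abs_nonneg (u2 (x + ε))
      nlinarith)
    (fun x hx => by
      refine (abs_add_le _ _).trans ?_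
      rw [abs_mul, abs_mul, abs_two, abs_of_nonneg hx]
      have h1 := hM3 _ (h0 hx)
      have h2 := hx3 _ (h0 hx)
      have h3 := abs_nonneg (u3 (x + ε))
      nlinarith)
  rw [← hL] at this
  refine this.trans ?_
  rw [show (m : ℝ) * ρ ^ 2 * (700 * A1 + 200 * A2 + 30 * A3) =
    ρ ^ 2 * (m * (700 * A1 + 200 * A2 + 30 * A3)) by ring]
  refine mul_le_mul_of_nonneg_left ?_ (sq_nonneg ρ)
  -- The terms without a factor m are absorbed using m ≥ 2.
  have g1 : 22 / 3 * A1 + 5 / 2 * (24 / 5 * A2 + 16 * A1) ≤ m * (24 * A1 + 6 * A2) := by nlinarith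
  have g2 : 15 * (10 / 3 * A1) + 75 * (7 / 5 * (A2 + 10 / 3 * A1)) +
      22 * (9 / 7 * (A3 + 3 / 2 * (7 / 5 * (A2 + 10 / 3 * A1)))) ≤
      676 * A1 + 194 * A2 + 30 * A3 := by linarith
  have g3 := mul_le_mul_of_nonneg_left g2 (by linarith : (0 : ℝ) ≤ m)
  linarith

end IsCells

/-- Cells with expected counts at least `64`. -/
lemma isCells_of_le {m n : ℕ} {p : Fin m → ℝ} (hm : 2 ≤ m) (hp : ∀ j, 0 < p j)
    (hsum : ∑ j, p j = 1) {q : ℝ} (hq : ∀ j, q ≤ p j) (hn : 64 ≤ n * q) :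
    IsCells n p (1 / √(n * q)) where
  pos := hp
  sum_eq := hsum
  two_le := hm
  rho_pos := by have : 0 < n * q := by linarith
                positivity
  rho_le := by
    have h8 : (8 : ℝ) ≤ √(n * q) := Real.le_sqrt_of_sq_le (by linarith)
    exact one_div_le_one_div_of_le (by norm_num) h8
  one_le j := by
    rw [div_pow, one_pow, Real.sq_sqrt (by linarith), one_div, inv_mul_eq_div,
      one_le_div (by linarith)]
    exact mul_le_mul_of_nonneg_left (hq j) (Nat.cast_nonneg n)

end PearsonChiSquare

/-! ### The theorem: small and large expected counts. -/

open PearsonChiSquare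
theorem corollary4p4 {Ω : Type*} [MeasurableSpace Ω] (μ : Measure Ω) [IsProbabilityMeasure μ]
    (n m : ℕ) (hm : 2 ≤ m)
    (p : Fin m → ℝ) (hp : ∀ j, 0 < p j) (hsum : ∑ j, p j = 1)
    (X : Fin n → Ω → Fin m) (hX : ∀ i, Measurable (X i)) (hindep : iIndepFun X μ)
    (hlaw : ∀ i j, μ.real {ω | X i ω = j} = p j)
    (W : Ω → ℝ) (hW : ∀ ω, W ω = pearsonStat n p (cellCount fun i => X i ω))
    (hnp : 1 ≤ n * pMin p) :
    (∀ h : ℝ → ℝ, MemCb 2 h →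
      |∫ ω, h (W ω) ∂μ - ∫ x, h x ∂(chiSquare (m - 1))| ≤
        12 / √(n * pMin p) *
          (6 * supNorm h + 46 * supNorm (iteratedDeriv 1 h) + 84 * supNorm (iteratedDeriv 2 h))) ∧
    (∀ h : ℝ → ℝ, MemCb 5 h →
      |∫ ω, h (W ω) ∂μ - ∫ x, h x ∂(chiSquare (m - 1))| ≤
        4 * m / (n * pMin p) *
          (19 * supNorm h + 366 * supNorm (iteratedDeriv 1 h) + 2016 * supNorm (iteratedDeriv 2 h)
            + 5264 * supNorm (iteratedDeriv 3 h) + 106965 * supNorm (iteratedDeriv 4 h)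
            + 302922 * supNorm (iteratedDeriv 5 h))) := by
  have hd : 0 < m - 1 := by omega
  have hmin : ∀ j, pMin p ≤ p j := fun j => ciInf_le (Set.finite_range p).bddBelow j
  have hWn : ∀ d : Fin m → ℝ, 0 ≤ pearsonForm n p d := fun d =>
    Finset.sum_nonneg fun j _ => by have := hp j; positivity
  have hpos : (0 : ℝ) < n * pMin p := by linarith
  have hsq : 0 < √(n * pMin p) := Real.sqrt_pos.2 hpos
  have hm' : (2 : ℝ) ≤ m := by exact_mod_cast hm
  -- W is nonnegative and the chi-square law lives on (0, ∞), so h may be replaced by its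
  -- continuous, bounded extension h(max x 0).
  have hred : ∀ h : ℝ → ℝ, ∫ ω, h (W ω) ∂μ - ∫ x, h x ∂(chiSquare (m - 1)) =
      trialExp p (fun j => n * p j) n (fun d => h (max (pearsonForm n p d) 0)) -
      ∫ x, h (max x 0) ∂(chiSquare (m - 1)) := fun h => by
    rw [integral_eq_trialExp hX hindep hlaw hW, integral_chiSquare_extend hd]
    simp only [max_eq_left (hWn _)]
  refine ⟨fun h hh => ?_, fun h hh => ?_⟩
  · rw [hred]
    have hA0 : 0 ≤ supNorm h := (abs_nonneg _).trans (hh.abs_extend_le 1)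
    have hA1 : 0 ≤ supNorm (iteratedDeriv 1 h) :=
      (abs_nonneg _).trans (hh.abs_le_supNorm one_le_two one_pos)
    have hA2 : 0 ≤ supNorm (iteratedDeriv 2 h) :=
      (abs_nonneg _).trans (hh.abs_le_supNorm le_rfl one_pos)
    -- The threshold is 12 · 6 / 2 = 36: below it the ‖h‖ term alone gives 2‖h‖, and above it n p_*
    -- is well over 64.
    rcases le_total (√(n * pMin p)) 36 with hc | hc
    · refine (abs_trialExp_sub_integral_le hd hp hsum (h := fun x => h (max x 0))
        hh.abs_extend_le).trans ?_
      rw [div_mul_eq_mul_div, le_div_iff₀ hsq]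
      nlinarith
    · have h64 : 64 ≤ n * pMin p := by
        have := Real.sq_sqrt hpos.le
        nlinarith
      have H := isCells_of_le hm hp hsum hmin h64
      refine (H.abs_sub_le_of_memCb_two hh).trans ?_
      rw [div_eq_mul_one_div (12 : ℝ), mul_comm (12 : ℝ), mul_assoc]
      refine mul_le_mul_of_nonneg_left ?_ H.rho_pos.le
      linarith
  · rw [hred]
    have hA : ∀ i, i ≤ 5 → 0 ≤ supNorm (iteratedDeriv i h) := fun i hi =>
      (abs_nonneg _).trans (hh.abs_le_supNorm hi one_pos)
    have hA0 : 0 ≤ supNorm h := (abs_nonneg _).trans (hh.abs_extend_le 1)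
    have hA1 := hA 1 (by norm_num)
    have hA2 := hA 2 (by norm_num)
    have hA3 := hA 3 (by norm_num)
    have hA4 := hA 4 (by norm_num)
    have hA5 := hA 5 (by norm_num)
    -- Likewise 4 · 19 / 2 = 38, and 38 m ≥ 76 puts the other case in the range n p_* ≥ 64.
    rcases le_total (n * pMin p) (38 * m) with hc | hc
    · refine (abs_trialExp_sub_integral_le hd hp hsum (h := fun x => h (max x 0))
        hh.abs_extend_le).trans ?_
      rw [div_mul_eq_mul_div, le_div_iff₀ hpos]
      have h1 : 2 * supNorm h * (n * pMin p) ≤ 2 * supNorm h * (38 * m) := by gcongr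
      have h2 : 4 * (m : ℝ) * (19 * supNorm h) ≤ 4 * m * (19 * supNorm h
          + 366 * supNorm (iteratedDeriv 1 h) + 2016 * supNorm (iteratedDeriv 2 h)
          + 5264 * supNorm (iteratedDeriv 3 h) + 106965 * supNorm (iteratedDeriv 4 h)
          + 302922 * supNorm (iteratedDeriv 5 h)) := by
        gcongr; linarith
      linarith
    · have H := isCells_of_le hm hp hsum hmin (by linarith : 64 ≤ n * pMin p)
      -- The constants 700, 200 and 30 lie below 4 · 366, 4 · 2016 and 4 · 5264; the norms of h and
      -- of its fourth and fifth derivatives enter only through being nonnegative.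
      refine (H.abs_sub_le_of_memCb_three (hh.mono (by norm_num))).trans ?_
      have e : 4 * (m : ℝ) / (n * pMin p) = m * (1 / √(n * pMin p)) ^ 2 * 4 := by
        rw [div_pow, one_pow, Real.sq_sqrt hpos.le]; ring
      rw [e, mul_assoc _ (4 : ℝ)]
      refine mul_le_mul_of_nonneg_left ?_ (by positivity)
      linarith
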